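/- Write $U=\begin{pmatrix}u_1&u_2&u_3\\ v_1&v_2&v_3\end{pmatrix}$ for the matrix of first derivatives $u_i=\partial u/\partial x^i$, $v_i=\partial v/\partial x^i$ of two functions $u,v$ of $(x^1,x^2,x^3)$, regarded as a point of the affine chart $\mathbb R^{2\times3}$ of the Grassmannian $\mathrm{Gr}(3,5)$. Let $F,G$ be smooth real functions on an open set $\Omega\subset\mathbb R^{2\times 3}$ and suppose that $X=\{U\in\Omega: F(U)=G(U)=0\}$ is connected (and non-empty). Suppose that the system $$F(u_1,u_2,u_3,v_1,v_2,v_3)=0,\qquad G(u_1,u_2,u_3,v_1,v_2,v_3)=0$$ is non-degenerate, i.e. the symmetric matrix $g^{ij}=\tfrac12\left(F_{u_i}G_{v_j}+F_{u_j}G_{v_i}-F_{v_i}G_{u_j}-F_{v_j}G_{u_i}\right)$ of its dispersion relation satisfies $\det(g^{ij})\neq0$ at every point of $X$. A block matrix $S=\begin{pmatrix}A&B\\C&D\end{pmatrix}\in\mathrm{SL}(5,\mathbb R)$, with blocks $A,B,C,D$ of sizes $2\times2$, $2\times3$, $3\times2$, $3\times3$, acts linearly on the variables $(u,v,x^1,x^2,x^3)$,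 hence on first derivatives by $S\cdot U=(AU+B)(CU+D)^{-1}$ wherever $CU+D$ is invertible. Then the following conditions are equivalent. (a) The system is linearisable by a transformation from $\mathrm{SL}(5,\mathbb R)$: there are $S\in\mathrm{SL}(5,\mathbb R)$ and two linearly independent linear forms $\ell_1,\ell_2$ on $\mathbb R^{2\times3}$ such that the points $U\in X$ with $\det(CU+D)\ne0$ are dense in $X$ and, near each of them, $X$ is given by the equations $\ell_1(S\cdot U)=\ell_2(S\cdot U)=0$. (b) The system is of Monge–Ampère type: there are two linearly independent functions of the form $$\sum_{i,j}a^{ij}(u_iv_j-u_jv_i)+\sum_i b^iu_i+\sum_i c^iv_i+m$$ with constant coefficients (linear combinations of the minors of $U$) such that near each of its points $X$ is given by the vanishing of both functions. (c) The system is invariant under an $8$-dimensional Lie subgroup $H$ of $\mathrm{SL}(5,\mathbb R)$: for every $U\in X$, all $h\in H$ sufficiently close to the identity (in the Lie group topology of $H$) satisfy $h\cdot U\in X$. (d) On every smooth solution $(u,v)$, defined on any open subset of $\mathbb R^3$, the conformal structure of the metric $g_{ij}\,dx^i dx^j$, where $(g_{ij})$ is the inverse of $(g^{ij})$ evaluated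 at the first derivatives of the solution, is flat, i.e. its Cotton tensor vanishes: $\nabla_r(R_{pq}-\tfrac14Rg_{pq})=\nabla_q(R_{pr}-\tfrac14Rg_{pr})$, where $\nabla$, $R_{pq}$ and $R$ are the Levi-Civita connection, the Ricci tensor and the scalar curvature of $g_{ij}$. -/

import Mathlib

open scoped ContDiff Topology

noncomputable section

namespace GrassmannSystem

/-! ## First-order systems `F(uᵢ, vᵢ) = 0`, `G(uᵢ, vᵢ) = 0` in three independent variables -/

/-- The affine chart of the Grassmannian `Gr(3, 5)`: the `2 × 3` matrices `U` of first derivatives,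
with `U 0 i = uᵢ` and `U 1 i = vᵢ`. -/
abbrev Jet : Type := Fin 2 → Fin 3 → ℝ

/-- Indices of the coordinates `(u, v, x¹, x², x³)` of the five-dimensional space. -/
abbrev Ix : Type := Fin 2 ⊕ Fin 3

/-- The coordinate direction of the entry `(a, i)` of `U`. -/
def jetDir (a : Fin 2) (i : Fin 3) : Jet := Pi.single a (Pi.single i 1)

/-- The partial derivative `∂F/∂uᵢ` (for `a = 0`) or `∂F/∂vᵢ` (for `a = 1`). -/
def jetDeriv (F : Jet → ℝ) (a : Fin 2) (i : Fin 3) (U : Jet) : ℝ :=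
  fderiv ℝ F U (jetDir a i)

/-- The fourfold of the system `F = 0`, `G = 0` whose left hand sides are given on `Ω`. -/
def fourfold (Ω : Set Jet) (F G : Jet → ℝ) : Set Jet :=
  {U | U ∈ Ω ∧ F U = 0 ∧ G U = 0}

/-- The symmetric matrix `gⁱʲ` of the dispersion relation
`det (∑ᵢ λⁱ [[F_{uᵢ}, F_{vᵢ}], [G_{uᵢ}, G_{vᵢ}]]) = ∑ᵢⱼ gⁱʲ λⁱ λʲ`. -/
def symbolForm (F G : Jet → ℝ) (U : Jet) : Matrix (Fin 3) (Fin 3) ℝ :=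
  Matrix.of fun i j => (1 / 2 : ℝ) *
    (jetDeriv F 0 i U * jetDeriv G 1 j U + jetDeriv F 0 j U * jetDeriv G 1 i U
      - jetDeriv F 1 i U * jetDeriv G 0 j U - jetDeriv F 1 j U * jetDeriv G 0 i U)

/-- Non-degeneracy: the characteristic conic is irreducible, that is `det gⁱʲ ≠ 0`, at every point
of the fourfold. -/
def IsNondegenerate (Ω : Set Jet) (F G : Jet → ℝ) : Prop :=
  ∀ U ∈ fourfold Ω F G, (symbolForm F G U).det ≠ 0

/-! ## The action of `SL(5)` -/

/-- The matrix `C U + D`, for a `5 × 5` matrix with blocks `A, B, C, D`. -/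
def denom (M : Matrix Ix Ix ℝ) (U : Jet) : Matrix (Fin 3) (Fin 3) ℝ :=
  M.toBlocks₂₁ * Matrix.of U + M.toBlocks₂₂

/-- The fractional linear action `U ↦ (A U + B) (C U + D)⁻¹`, meaningful where `C U + D` is
invertible (elsewhere the image leaves the affine chart). -/
def act (M : Matrix Ix Ix ℝ) (U : Jet) : Jet :=
  Matrix.of.symm ((M.toBlocks₁₁ * Matrix.of U + M.toBlocks₁₂) * (denom M U)⁻¹)

/-- (a) Some element `S` of `SL(5)` takes the system to a linear one: near each point of the
fourfold whose image lies in the affine chart, the system is `ℓ₁(S • U) = ℓ₂(S • U) = 0` with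
independent linear forms `ℓ₁, ℓ₂`. Points sent to infinity are allowed, but must be nowhere dense
in the fourfold. -/
def IsLinearisable (Ω : Set Jet) (F G : Jet → ℝ) : Prop :=
  ∃ S : Matrix.SpecialLinearGroup Ix ℝ, ∃ l₁ l₂ : Jet →ₗ[ℝ] ℝ,
    LinearIndependent ℝ ![l₁, l₂] ∧
    fourfold Ω F G ⊆ closure {U | U ∈ fourfold Ω F G ∧ (denom S.1 U).det ≠ 0} ∧
    ∀ U ∈ fourfold Ω F G, (denom S.1 U).det ≠ 0 →
      ∀ᶠ V in 𝓝 U, V ∈ fourfold Ω F G ↔ (l₁ (act S.1 V) = 0 ∧ l₂ (act S.1 V) = 0)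

/-! ## Monge–Ampère systems -/

/-- `Φ` is a linear combination of the minors (of orders `2`, `1`, `0`) of the matrix `U`. -/
def IsMinorCombination (Φ : Jet → ℝ) : Prop :=
  ∃ (a : Fin 3 → Fin 3 → ℝ) (b c : Fin 3 → ℝ) (m : ℝ), ∀ U : Jet,
    Φ U = ∑ i, ∑ j, a i j * (U 0 i * U 1 j - U 0 j * U 1 i)
      + ∑ i, b i * U 0 i + ∑ i, c i * U 1 i + m

/-- (b) Along its fourfold the system is a pair of independent Monge–Ampère equations. -/
def IsMongeAmpere (Ω : Set Jet) (F G : Jet → ℝ) : Prop :=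
  ∃ Φ Ψ : Jet → ℝ, IsMinorCombination Φ ∧ IsMinorCombination Ψ ∧
    LinearIndependent ℝ ![Φ, Ψ] ∧
    ∀ U ∈ fourfold Ω F G, ∀ᶠ V in 𝓝 U, V ∈ fourfold Ω F G ↔ (Φ V = 0 ∧ Ψ V = 0)

/-! ## Symmetry -/

/-- `𝔥` is the Lie algebra of the subgroup `H` of `SL(5)`: it consists of the generators of the
one-parameter subgroups of `H` (closure under commutators is automatic). -/
def IsLieAlgebraOf (𝔥 : Submodule ℝ (Matrix Ix Ix ℝ))
    (H : Subgroup (Matrix.SpecialLinearGroup Ix ℝ)) : Prop :=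
  ∀ A : Matrix Ix Ix ℝ, A ∈ 𝔥 ↔ ∀ t : ℝ, ∃ h ∈ H, h.1 = NormedSpace.exp (t • A)

/-- (c) The system is invariant under a `d`-dimensional subgroup `H` of `SL(5)`. The fourfold is
only a piece of a subset of the Grassmannian, so invariance is that under the local group: each
point of the fourfold stays in it under all elements of `H` close enough to the identity (in the
topology of the Lie group `H`, whose neighbourhoods of the identity are the images under `exp` of
neighbourhoods of zero in its Lie algebra). -/
def IsInvariantUnderSubgroupOfDim (d : ℕ) (Ω : Set Jet) (F G : Jet → ℝ) : Prop :=
  ∃ (H : Subgroup (Matrix.SpecialLinearGroup Ix ℝ)) (𝔥 : Submodule ℝ (Matrix Ix Ix ℝ)),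
    IsLieAlgebraOf 𝔥 H ∧ Module.finrank ℝ 𝔥 = d ∧
    ∀ U ∈ fourfold Ω F G, ∀ᶠ A in 𝓝 (0 : Matrix Ix Ix ℝ), A ∈ 𝔥 →
      act (NormedSpace.exp A) U ∈ fourfold Ω F G

/-! ## Curvature of a (pseudo-)Riemannian metric on a domain of `ℝ³` -/

/-- The partial derivative `∂ᵢ f`. -/
def pd (i : Fin 3) (f : (Fin 3 → ℝ) → ℝ) (x : Fin 3 → ℝ) : ℝ :=
  fderiv ℝ f x (Pi.single i 1)

/-- Christoffel symbols `Γᵏᵢⱼ` of the Levi-Civita connection. -/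
def christoffel (g : (Fin 3 → ℝ) → Matrix (Fin 3) (Fin 3) ℝ) (k i j : Fin 3)
    (x : Fin 3 → ℝ) : ℝ :=
  (1 / 2 : ℝ) * ∑ l, (g x)⁻¹ k l *
    (pd i (fun y => g y j l) x + pd j (fun y => g y i l) x - pd l (fun y => g y i j) x)

/-- The Ricci tensor `Rᵢⱼ`. -/
def ricci (g : (Fin 3 → ℝ) → Matrix (Fin 3) (Fin 3) ℝ) (i j : Fin 3) (x : Fin 3 → ℝ) : ℝ :=
  ∑ k, (pd k (christoffel g k i j) x - pd j (christoffel g k i k) x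
    + ∑ l, (christoffel g k k l x * christoffel g l i j x
      - christoffel g k j l x * christoffel g l i k x))

/-- The scalar curvature `R`. -/
def scalarCurv (g : (Fin 3 → ℝ) → Matrix (Fin 3) (Fin 3) ℝ) (x : Fin 3 → ℝ) : ℝ :=
  ∑ i, ∑ j, (g x)⁻¹ i j * ricci g i j x

/-- The Schouten tensor `R_{pq} - R g_{pq} / 4`. -/
def schouten (g : (Fin 3 → ℝ) → Matrix (Fin 3) (Fin 3) ℝ) (p q : Fin 3) (x : Fin 3 → ℝ) : ℝ :=
  ricci g p q x - (1 / 4 : ℝ) * scalarCurv g x * g x p q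

/-- The covariant derivative `∇ᵣ T_{pq}` in the Levi-Civita connection of `g`. -/
def covDeriv (g : (Fin 3 → ℝ) → Matrix (Fin 3) (Fin 3) ℝ)
    (T : Fin 3 → Fin 3 → (Fin 3 → ℝ) → ℝ) (r p q : Fin 3) (x : Fin 3 → ℝ) : ℝ :=
  pd r (T p q) x - ∑ s, christoffel g s r p x * T s q x - ∑ s, christoffel g s r q x * T p s x

/-- The Cotton tensor, whose vanishing is conformal flatness in dimension three. -/
def cotton (g : (Fin 3 → ℝ) → Matrix (Fin 3) (Fin 3) ℝ) (p q r : Fin 3) (x : Fin 3 → ℝ) : ℝ :=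
  covDeriv g (schouten g) r p q x - covDeriv g (schouten g) q p r x

/-! ## Solutions and their conformal structures -/

/-- The matrix of first derivatives of `(u, v)`. -/
def jetOf (u v : (Fin 3 → ℝ) → ℝ) (x : Fin 3 → ℝ) : Jet :=
  ![fun i => pd i u x, fun i => pd i v x]

/-- `(u, v)` is a smooth solution of the system on the open set `D`. -/
def IsSolution (Ω : Set Jet) (F G : Jet → ℝ) (D : Set (Fin 3 → ℝ))
    (u v : (Fin 3 → ℝ) → ℝ) : Prop :=
  IsOpen D ∧ ContDiffOn ℝ ∞ u D ∧ ContDiffOn ℝ ∞ v D ∧ ∀ x ∈ D, jetOf u v x ∈ fourfold Ω F G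

/-- The characteristic metric `g_{ij}`, the inverse of `gⁱʲ`, on a solution. -/
def charMetric (F G : Jet → ℝ) (u v : (Fin 3 → ℝ) → ℝ) (x : Fin 3 → ℝ) :
    Matrix (Fin 3) (Fin 3) ℝ :=
  (symbolForm F G (jetOf u v x))⁻¹

/-- (d) The characteristic conformal structure is flat on every solution. -/
def IsFlatOnSolutions (Ω : Set Jet) (F G : Jet → ℝ) : Prop :=
  ∀ (D : Set (Fin 3 → ℝ)) (u v : (Fin 3 → ℝ) → ℝ), IsSolution Ω F G D u v →
    ∀ x ∈ D, ∀ p q r : Fin 3, cotton (charMetric F G u v) p q r x = 0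

end GrassmannSystem

end

open scoped ContDiff Topology

noncomputable section

namespace GrassmannSystem

open Matrix

/-! ## Pencils of linear forms on `2 × 3` matrices -/

/-! Let X be the fourfold and α, β the differentials of F, G at one of its points. Non-degeneracy
says that the characteristic covectors (x α₀ + y α₁) × (x β₀ + y β₁) trace an irreducible conic
whose three coefficients form a basis of ℝ³ (`conicDet_eq`). In this basis the tangent space of X
consists of the 2 × 3 Hankel arrays. It is a copy of the binary cubics, and its matrices of rank one
form the cone over a twisted cubic (`frame`, `charDir`). The proof revolves around one pointwise
condition, `IsRankOneFlat`: the Hessians of F and G vanish on these rank-one directions. Each of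
(a), (c), (d) implies it, it implies (b), and (b) implies the other three.

From flatness to (b). The quadrics through a twisted cubic are spanned by the 2 × 2 minors, so on
the tangent space the Hessians of F and G agree with combinations of minors; this gives osculating
functions `osc`. Differentiating along X produces a symmetric trilinear form all of whose polar
quadrics contain the twisted cubic, and such a form is zero (`VanishesOnCubic.trilinear_eq_zero`).
Hence the quadratic parts of the two osculating functions vary only within their own span
(`IsDefining.fderiv_oscCoeff`), the functions satisfy a linear differential equation along curves in
X, and they vanish on X near the point. Connectedness then spreads one pair over all of X
(`IsRegular.isMongeAmpere_of_isRankOneFlat`).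

Linear form. The quadratic parts of two combinations of minors have six coefficients, and a
projective transformation that moves the base point to the origin with derivative one has six free
parameters. Non-degeneracy makes this correspondence bijective (`shiftCoeff_surjective`), so a
Monge–Ampère system becomes linear. Conversely, minors are affine along rank-one directions, so
characteristic lines lie in X locally and the Hessians vanish on them.

Symmetry. For a linear system the translations along the kernel (dimension 4) and the 2 × 2
matrices, each extended so as to preserve the twisted cubic (dimension 4), form an eight-dimensional
algebra (`finrank_stabAlg`). For an arbitrary system a symmetry is determined by its value and its
left 2 × 2 part at a point. Dimension eight therefore forces a symmetry that fixes the point and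
dilates the tangent space (`exists_dilation`), and the second derivative of the tangency condition
then expresses the Hessian through minors.

Flatness on solutions. In the linear form the conformal structure is constant in the new independent
variables, whose differentials are the rows of C U + D (`IsRegular.symb_conj`,
`IsConformallyFlatOn.cotton_eq_zero`). Conversely, through each point and in each characteristic
direction there is a simple wave whose jet depends on the cube of a phase vanishing at the origin.
There the Cotton tensor sees only the first derivative of the symbol (`cotton_of_cube`), and its
vanishing for all characteristic directions gives the flatness of the Hessians
(`eq_zero_of_symb_variation`). -/

/-- The rows of coefficients of a linear form on `2 × 3` matrices. -/
def row (α : Jet →L[ℝ] ℝ) (a : Fin 2) : Fin 3 → ℝ := fun i => α (jetDir a i)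

lemma jet_eq_sum (H : Jet) : H = ∑ a, ∑ i, H a i • jetDir a i := by
  ext a i
  fin_cases a <;> fin_cases i <;>
    simp [jetDir, Fin.sum_univ_two, Fin.sum_univ_three]

lemma apply_eq_row (α : Jet →L[ℝ] ℝ) (H : Jet) :
    α H = H 0 0 * row α 0 0 + H 0 1 * row α 0 1 + H 0 2 * row α 0 2
      + H 1 0 * row α 1 0 + H 1 1 * row α 1 1 + H 1 2 * row α 1 2 := by
  conv_lhs => rw [jet_eq_sum H]
  simp [row, Fin.sum_univ_two, Fin.sum_univ_three]
  ring

/-- The symmetric matrix of the dispersion relation of a pair of linear forms. -/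
def symb (α β : Jet →L[ℝ] ℝ) : Matrix (Fin 3) (Fin 3) ℝ :=
  Matrix.of fun i j => (1 / 2 : ℝ) *
    (row α 0 i * row β 1 j + row α 0 j * row β 1 i
      - row α 1 i * row β 0 j - row α 1 j * row β 0 i)

lemma symbolForm_eq (F G : Jet → ℝ) (U : Jet) :
    symbolForm F G U = symb (fderiv ℝ F U) (fderiv ℝ G U) := rfl

/-- The coefficients of the characteristic covector `α(ξ, ·) × β(ξ, ·)`, a quadratic form
in `ξ`. -/
def conic (α β : Jet →L[ℝ] ℝ) : Fin 3 → Fin 3 → ℝ :=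
  ![row α 0 ⨯₃ row β 0, row α 0 ⨯₃ row β 1 + row α 1 ⨯₃ row β 0, row α 1 ⨯₃ row β 1]

/-- The characteristic covector `α(ξ, ·) × β(ξ, ·)` with `ξ = (x, y)`. -/
def charVec (α β : Jet →L[ℝ] ℝ) (x y : ℝ) : Fin 3 → ℝ :=
  x ^ 2 • conic α β 0 + (x * y) • conic α β 1 + y ^ 2 • conic α β 2

/-- The basis of the common kernel of `α` and `β` in which the matrices of rank one form a
twisted cubic. -/
def frame (α β : Jet →L[ℝ] ℝ) : Fin 4 → Jet :=
  ![![conic α β 0, 0], ![conic α β 1, conic α β 0], ![conic α β 2, conic α β 1],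
    ![0, conic α β 2]]

/-- The matrix of rank one with row space `charVec α β x y` and column space `(x, y)`. -/
def charDir (α β : Jet →L[ℝ] ℝ) (x y : ℝ) : Jet :=
  x ^ 3 • frame α β 0 + (x ^ 2 * y) • frame α β 1 + (x * y ^ 2) • frame α β 2
    + y ^ 3 • frame α β 3

lemma charDir_zero (α β : Jet →L[ℝ] ℝ) (x y : ℝ) : charDir α β x y 0 = x • charVec α β x y := by
  ext i
  simp [charDir, charVec, frame]
  ring

lemma charDir_one (α β : Jet →L[ℝ] ℝ) (x y : ℝ) : charDir α β x y 1 = y • charVec α β x y := by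
  ext i
  simp [charDir, charVec, frame]
  ring

/-- The determinant of the coefficients of the characteristic covector. -/
def conicDet (α β : Jet →L[ℝ] ℝ) : ℝ := conic α β 0 ⬝ᵥ (conic α β 1 ⨯₃ conic α β 2)

/-- Non-degeneracy enters all the linear algebra below in this form: the three coefficients of the
characteristic conic are a basis of ℝ³. -/
lemma conicDet_eq (α β : Jet →L[ℝ] ℝ) : conicDet α β = 4 * (symb α β).det := by
  simp only [conicDet, conic, symb, Matrix.det_fin_three, cross_apply, dotProduct,
    Fin.sum_univ_three, Matrix.of_apply, Matrix.cons_val, Pi.add_apply]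
  ring

lemma conicDet_ne_zero {α β : Jet →L[ℝ] ℝ} (h : (symb α β).det ≠ 0) : conicDet α β ≠ 0 := by
  rw [conicDet_eq]; positivity

/-- On `charDir α β x y` the form α equals the dot product of x α₀ + y α₁ with a cross product
having it as a factor. The resulting cubic in (x, y) is identically zero, and its four coefficients
are the values here. -/
lemma apply_frame_left (α β : Jet →L[ℝ] ℝ) (k : Fin 4) : α (frame α β k) = 0 := by
  rw [apply_eq_row]
  fin_cases k <;> simp [frame, conic, cross_apply] <;> ring

lemma apply_frame_right (α β : Jet →L[ℝ] ℝ) (k : Fin 4) : β (frame α β k) = 0 := by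
  rw [apply_eq_row]
  fin_cases k <;> simp [frame, conic, cross_apply] <;> ring

lemma apply_charDir_left (α β : Jet →L[ℝ] ℝ) (x y : ℝ) : α (charDir α β x y) = 0 := by
  simp [charDir, apply_frame_left]

lemma apply_charDir_right (α β : Jet →L[ℝ] ℝ) (x y : ℝ) : β (charDir α β x y) = 0 := by
  simp [charDir, apply_frame_right]

/-- Cramer's rule: the cross product of two basis vectors isolates the coefficient of the third. -/
lemma exists_conic_coord {α β : Jet →L[ℝ] ℝ} (h : conicDet α β ≠ 0) (v : Fin 3 → ℝ) :
    ∃ c : Fin 3 → ℝ, v = c 0 • conic α β 0 + c 1 • conic α β 1 + c 2 • conic α β 2 := by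
  refine ⟨fun k => ![v ⬝ᵥ (conic α β 1 ⨯₃ conic α β 2), v ⬝ᵥ (conic α β 2 ⨯₃ conic α β 0),
    v ⬝ᵥ (conic α β 0 ⨯₃ conic α β 1)] k / conicDet α β, ?_⟩
  have key : conicDet α β • v = (v ⬝ᵥ (conic α β 1 ⨯₃ conic α β 2)) • conic α β 0
      + (v ⬝ᵥ (conic α β 2 ⨯₃ conic α β 0)) • conic α β 1
      + (v ⬝ᵥ (conic α β 0 ⨯₃ conic α β 1)) • conic α β 2 := by
    unfold conicDet
    generalize conic α β 0 = A
    generalize conic α β 1 = B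
    generalize conic α β 2 = C
    ext i
    fin_cases i <;>
    · simp [cross_apply, dotProduct, Fin.sum_univ_three]
      ring
  have := congrArg (fun w => (conicDet α β)⁻¹ • w) key
  simp only [smul_smul, inv_mul_cancel₀ h, one_smul, smul_add] at this
  conv_lhs => rw [this]
  simp [div_eq_inv_mul]

/-- The two numbers `α(E₀ ⊗ conic 1)`, `α(E₀ ⊗ conic 2)`. -/
def coef (α β θ : Jet →L[ℝ] ℝ) (k : Fin 2) : ℝ := row θ 0 ⬝ᵥ conic α β k.succ

lemma coef_det (α β : Jet →L[ℝ] ℝ) :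
    coef α β α 0 * coef α β β 1 - coef α β α 1 * coef α β β 0 = conicDet α β := by
  simp only [coef, conicDet, conic, cross_apply, dotProduct, Fin.sum_univ_three, Pi.add_apply,
    Fin.succ_zero_eq_one, Fin.succ_one_eq_two, Matrix.cons_val]
  ring

/-- Once both rows are expanded in the conic basis, α and β see only the two numbers that measure
the failure of the coefficient array to be Hankel. Together with `coef_det` this identifies the
common kernel. -/
lemma apply_coord_left (α β : Jet →L[ℝ] ℝ) (c d : Fin 3 → ℝ) :
    α ![c 0 • conic α β 0 + c 1 • conic α β 1 + c 2 • conic α β 2,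
      d 0 • conic α β 0 + d 1 • conic α β 1 + d 2 • conic α β 2]
    = coef α β α 0 * (c 1 - d 0) + coef α β α 1 * (c 2 - d 1) := by
  rw [apply_eq_row]
  simp [coef, conic, cross_apply, dotProduct, Fin.sum_univ_three]
  ring

lemma apply_coord_right (α β : Jet →L[ℝ] ℝ) (c d : Fin 3 → ℝ) :
    β ![c 0 • conic α β 0 + c 1 • conic α β 1 + c 2 • conic α β 2,
      d 0 • conic α β 0 + d 1 • conic α β 1 + d 2 • conic α β 2]
    = coef α β β 0 * (c 1 - d 0) + coef α β β 1 * (c 2 - d 1) := by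
  rw [apply_eq_row]
  simp [coef, conic, cross_apply, dotProduct, Fin.sum_univ_three]
  ring

lemma exists_conic_coords {α β : Jet →L[ℝ] ℝ} (h : conicDet α β ≠ 0) (H : Jet) :
    ∃ c d : Fin 3 → ℝ, H = ![c 0 • conic α β 0 + c 1 • conic α β 1 + c 2 • conic α β 2,
      d 0 • conic α β 0 + d 1 • conic α β 1 + d 2 • conic α β 2] := by
  obtain ⟨c, hc⟩ := exists_conic_coord h (H 0)
  obtain ⟨d, hd⟩ := exists_conic_coord h (H 1)
  refine ⟨c, d, ?_⟩
  rw [← hc, ← hd]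
  ext a; fin_cases a <;> rfl

lemma coords_of_mem_ker {α β : Jet →L[ℝ] ℝ} (h : conicDet α β ≠ 0) {c d : Fin 3 → ℝ}
    (hα : coef α β α 0 * (c 1 - d 0) + coef α β α 1 * (c 2 - d 1) = 0)
    (hβ : coef α β β 0 * (c 1 - d 0) + coef α β β 1 * (c 2 - d 1) = 0) :
    c 1 = d 0 ∧ c 2 = d 1 := by
  have hd := coef_det α β
  constructor
  · have : conicDet α β * (c 1 - d 0) = 0 := by
      rw [← hd]; linear_combination coef α β β 1 * hα - coef α β α 1 * hβ
    exact sub_eq_zero.mp ((mul_eq_zero.mp this).resolve_left h)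
  · have : conicDet α β * (c 2 - d 1) = 0 := by
      rw [← hd]; linear_combination coef α β α 0 * hβ - coef α β β 0 * hα
    exact sub_eq_zero.mp ((mul_eq_zero.mp this).resolve_left h)

/-- The common kernel of a non-degenerate pair is spanned by `frame`. -/
lemma exists_frame_coord {α β : Jet →L[ℝ] ℝ} (h : conicDet α β ≠ 0) {H : Jet}
    (hα : α H = 0) (hβ : β H = 0) : ∃ c : Fin 4 → ℝ, H = ∑ k, c k • frame α β k := by
  obtain ⟨c, d, rfl⟩ := exists_conic_coords h H
  rw [apply_coord_left] at hα
  rw [apply_coord_right] at hβ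
  obtain ⟨h1, h2⟩ := coords_of_mem_ker h hα hβ
  refine ⟨![c 0, c 1, c 2, d 2], ?_⟩
  ext a i
  fin_cases a <;> simp [Fin.sum_univ_four, frame, ← h1, ← h2]

/-- A form that vanishes on the common kernel is a combination of `α` and `β`. -/
lemma eq_combination {α β θ : Jet →L[ℝ] ℝ} (h : conicDet α β ≠ 0)
    (hθ : ∀ k, θ (frame α β k) = 0) :
    θ = ((coef α β θ 0 * coef α β β 1 - coef α β θ 1 * coef α β β 0) / conicDet α β) • α
      + ((coef α β α 0 * coef α β θ 1 - coef α β α 1 * coef α β θ 0) / conicDet α β) • β := by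
  have hθ' : ∀ c d : Fin 3 → ℝ,
      θ ![c 0 • conic α β 0 + c 1 • conic α β 1 + c 2 • conic α β 2,
      d 0 • conic α β 0 + d 1 • conic α β 1 + d 2 • conic α β 2]
      = coef α β θ 0 * (c 1 - d 0) + coef α β θ 1 * (c 2 - d 1) := by
    intro c d
    have e1 : θ ![conic α β 1, 0] = coef α β θ 0 := by
      rw [apply_eq_row]; simp [coef, dotProduct, Fin.sum_univ_three]; ring
    have e2 : θ ![conic α β 2, 0] = coef α β θ 1 := by
      rw [apply_eq_row]; simp [coef, dotProduct, Fin.sum_univ_three]; ring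
    have : ![c 0 • conic α β 0 + c 1 • conic α β 1 + c 2 • conic α β 2,
      d 0 • conic α β 0 + d 1 • conic α β 1 + d 2 • conic α β 2]
      = c 0 • frame α β 0 + d 0 • frame α β 1 + d 1 • frame α β 2 + d 2 • frame α β 3
        + (c 1 - d 0) • ![conic α β 1, 0] + (c 2 - d 1) • ![conic α β 2, (0 : Fin 3 → ℝ)] := by
      ext a i
      fin_cases a
      · simp [frame]; ring
      · simp [frame]
    rw [this]
    simp only [map_add, map_smul, hθ, e1, e2]
    simp; ring
  have hd := coef_det α β
  ext H
  obtain ⟨c, d, rfl⟩ := exists_conic_coords h H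
  simp only [ContinuousLinearMap.add_apply, ContinuousLinearMap.smul_apply, smul_eq_mul]
  rw [hθ', apply_coord_left, apply_coord_right]
  field_simp
  rw [← hd]
  ring

lemma conicDet_smul (α β : Jet →L[ℝ] ℝ) (v : Fin 3 → ℝ) :
    conicDet α β • v = (v ⬝ᵥ (conic α β 1 ⨯₃ conic α β 2)) • conic α β 0
      + (v ⬝ᵥ (conic α β 2 ⨯₃ conic α β 0)) • conic α β 1
      + (v ⬝ᵥ (conic α β 0 ⨯₃ conic α β 1)) • conic α β 2 := by
  unfold conicDet
  generalize conic α β 0 = A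
  generalize conic α β 1 = B
  generalize conic α β 2 = C
  ext i
  fin_cases i <;>
  · simp [cross_apply, dotProduct, Fin.sum_univ_three]
    ring

lemma mem_ker_iff {α β : Jet →L[ℝ] ℝ} (h : conicDet α β ≠ 0) (c d : Fin 3 → ℝ) :
    (α ![c 0 • conic α β 0 + c 1 • conic α β 1 + c 2 • conic α β 2,
      d 0 • conic α β 0 + d 1 • conic α β 1 + d 2 • conic α β 2] = 0 ∧
    β ![c 0 • conic α β 0 + c 1 • conic α β 1 + c 2 • conic α β 2,
      d 0 • conic α β 0 + d 1 • conic α β 1 + d 2 • conic α β 2] = 0) ↔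
    c 1 = d 0 ∧ c 2 = d 1 := by
  rw [apply_coord_left, apply_coord_right]
  constructor
  · rintro ⟨h1, h2⟩
    exact coords_of_mem_ker h h1 h2
  · rintro ⟨h1, h2⟩
    simp [h1, h2]

lemma eq_zero_of_dot_conic {α β : Jet →L[ℝ] ℝ} (h : conicDet α β ≠ 0) {v : Fin 3 → ℝ}
    (hv : ∀ k, v ⬝ᵥ conic α β k = 0) : v = 0 := by
  obtain ⟨c, hc⟩ := exists_conic_coord h v
  have : v ⬝ᵥ (c 0 • conic α β 0 + c 1 • conic α β 1 + c 2 • conic α β 2) = 0 := by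
    simp [dotProduct_add, dotProduct_smul, hv]
  rw [← hc] at this
  exact dotProduct_self_eq_zero.mp this

/-! ## Combinations of the `2 × 2` minors -/

/-- The polarisation of `2 a ⬝ (H₀ × H₁)`. -/
def minorForm (a : Fin 3 → ℝ) (H K : Jet) : ℝ := a ⬝ᵥ (H 0 ⨯₃ K 1 + K 0 ⨯₃ H 1)

lemma minorForm_comm (a : Fin 3 → ℝ) (H K : Jet) : minorForm a H K = minorForm a K H := by
  simp [minorForm, add_comm]

lemma minorForm_add_right (a : Fin 3 → ℝ) (H K K' : Jet) :
    minorForm a H (K + K') = minorForm a H K + minorForm a H K' := by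
  simp [minorForm, cross_apply, dotProduct, Fin.sum_univ_three]; ring

lemma minorForm_smul_right (a : Fin 3 → ℝ) (c : ℝ) (H K : Jet) :
    minorForm a H (c • K) = c * minorForm a H K := by
  simp [minorForm, cross_apply, dotProduct, Fin.sum_univ_three]; ring

lemma minorForm_add_left (a : Fin 3 → ℝ) (H H' K : Jet) :
    minorForm a (H + H') K = minorForm a H K + minorForm a H' K := by
  simp [minorForm, cross_apply, dotProduct, Fin.sum_univ_three]; ring

lemma minorForm_smul_left (a : Fin 3 → ℝ) (c : ℝ) (H K : Jet) :
    minorForm a (c • H) K = c * minorForm a H K := by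
  simp [minorForm, cross_apply, dotProduct, Fin.sum_univ_three]; ring

lemma minorForm_add_coeff (a b : Fin 3 → ℝ) (H K : Jet) :
    minorForm (a + b) H K = minorForm a H K + minorForm b H K := by
  simp [minorForm, add_dotProduct]; ring

lemma minorForm_smul_coeff (c : ℝ) (a : Fin 3 → ℝ) (H K : Jet) :
    minorForm (c • a) H K = c * minorForm a H K := by
  simp [minorForm, smul_dotProduct]; ring

lemma minorForm_charDir (α β : Jet →L[ℝ] ℝ) (a : Fin 3 → ℝ) (x y : ℝ) :
    minorForm a (charDir α β x y) (charDir α β x y) = 0 := by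
  rw [minorForm, charDir_zero, charDir_one]
  simp

/-- A symmetric form on the span of the frame that vanishes on the twisted cubic. -/
def VanishesOnCubic (q : Fin 4 → Fin 4 → ℝ) : Prop :=
  q 0 0 = 0 ∧ q 0 1 = 0 ∧ 2 * q 0 2 + q 1 1 = 0 ∧ q 0 3 + q 1 2 = 0 ∧ 2 * q 1 3 + q 2 2 = 0 ∧
    q 2 3 = 0 ∧ q 3 3 = 0

/-- A binary sextic with seven distinct projective zeros is zero; it is sampled at (1 : 0), (0 : 1)
and five points (1 : t). -/
lemma vanishesOnCubic_of_poly {q : Fin 4 → Fin 4 → ℝ}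
    (h : ∀ x y : ℝ, x ^ 6 * q 0 0 + x ^ 5 * y * (2 * q 0 1) + x ^ 4 * y ^ 2 * (2 * q 0 2 + q 1 1)
      + x ^ 3 * y ^ 3 * (2 * (q 0 3 + q 1 2)) + x ^ 2 * y ^ 4 * (2 * q 1 3 + q 2 2)
      + x * y ^ 5 * (2 * q 2 3) + y ^ 6 * q 3 3 = 0) : VanishesOnCubic q := by
  have h1 := h 1 0
  have h2 := h 0 1
  have h3 := h 1 1
  have h4 := h 1 (-1)
  have h5 := h 1 2
  have h6 := h 1 (-2)
  have h7 := h 1 3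
  norm_num at h1 h2 h3 h4 h5 h6 h7
  refine ⟨?_, ?_, ?_, ?_, ?_, ?_, ?_⟩ <;> linarith

lemma vanishesOnCubic_of_bilin {α β : Jet →L[ℝ] ℝ} {B : Jet → Jet → ℝ}
    (hc : ∀ H K, B H K = B K H) (ha : ∀ H K K', B H (K + K') = B H K + B H K')
    (hs : ∀ (c : ℝ) H K, B H (c • K) = c * B H K)
    (h : ∀ x y, B (charDir α β x y) (charDir α β x y) = 0) :
    VanishesOnCubic fun j k => B (frame α β j) (frame α β k) := by
  have ha' : ∀ H H' K, B (H + H') K = B H K + B H' K := fun H H' K => by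
    rw [hc, ha, hc K, hc K]
  have hs' : ∀ (c : ℝ) H K, B (c • H) K = c * B H K := fun c H K => by rw [hc, hs, hc]
  apply vanishesOnCubic_of_poly
  intro x y
  rw [← h x y]
  simp only [charDir, ha, hs, ha', hs']
  rw [hc (frame α β 1) (frame α β 0), hc (frame α β 2) (frame α β 0),
    hc (frame α β 3) (frame α β 0), hc (frame α β 2) (frame α β 1),
    hc (frame α β 3) (frame α β 1), hc (frame α β 3) (frame α β 2)]
  ring

/-- Seven conditions on the ten coefficients of a quaternary quadratic form leave the
three-dimensional space of quadrics through the twisted cubic. The three entries assumed to vanish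
are coordinates on it. -/
lemma VanishesOnCubic.eq_zero {q : Fin 4 → Fin 4 → ℝ} (h : VanishesOnCubic q)
    (hs : ∀ j k, q j k = q k j) (h02 : q 0 2 = 0) (h03 : q 0 3 = 0) (h13 : q 1 3 = 0)
    (j k : Fin 4) : q j k = 0 := by
  obtain ⟨h1, h2, h3, h4, h5, h6, h7⟩ := h
  have s10 := hs 1 0
  have s20 := hs 2 0
  have s30 := hs 3 0
  have s21 := hs 2 1
  have s31 := hs 3 1
  have s32 := hs 3 2
  fin_cases j <;> fin_cases k <;> simp only [Fin.mk_zero, Fin.mk_one, Fin.reduceFinMk, Fin.zero_eta] <;> linarith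

/-- Geometrically, the cubic form is singular along the twisted cubic. Its restriction to a secant
line has two double zeros and so vanishes, and the secants fill the space. The proof is the
corresponding elimination on coefficients. -/
lemma VanishesOnCubic.trilinear_eq_zero {c : Fin 4 → Fin 4 → Fin 4 → ℝ}
    (h : ∀ i, VanishesOnCubic (c i)) (h1 : ∀ i j k, c i j k = c i k j)
    (h2 : ∀ i j k, c i j k = c j i k) (i j k : Fin 4) : c i j k = 0 := by
  have a00 := fun i => (h i).1
  have a01 := fun i => (h i).2.1
  have a02 := fun i => (h i).2.2.1
  have a03 := fun i => (h i).2.2.2.1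
  have a13 := fun i => (h i).2.2.2.2.1
  have a23 := fun i => (h i).2.2.2.2.2.1
  have a33 := fun i => (h i).2.2.2.2.2.2
  have c020 : c 0 0 2 = 0 := by rw [h1, h2]; exact a00 2
  have c012 : c 1 0 2 = 0 := by rw [h1, h2, h1]; exact a01 2
  have c023 : c 3 0 2 = 0 := by rw [h2, h1]; exact a23 0
  have c030 : c 0 0 3 = 0 := by rw [h1, h2]; exact a00 3
  have c031 : c 1 0 3 = 0 := by rw [h1, h2, h1]; exact a01 3
  have c033 : c 3 0 3 = 0 := by rw [h2]; exact a33 0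
  have c110 : c 0 1 1 = 0 := by linarith [a02 0]
  have c112 : c 1 1 2 = 0 := by linarith [a03 1]
  have c022 : c 2 0 2 = 0 := by
    have : c 2 1 1 = 0 := by rw [h2, h1]; exact c112
    linarith [a02 2]
  have c123 : c 3 1 2 = 0 := by linarith [a03 3]
  have c032 : c 2 0 3 = 0 := by rw [h2]; exact a23 0
  have c130 : c 0 1 3 = 0 := by rw [h2]; exact c031
  have c131 : c 1 1 3 = 0 := by
    have : c 3 1 1 = 0 := by linarith [a02 3]
    rw [h1, h2, this]
  have c132 : c 2 1 3 = 0 := by rw [h2]; exact a23 1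
  have c133 : c 3 1 3 = 0 := by rw [h2]; exact a33 1
  have q02 : ∀ i, c i 0 2 = 0 := by intro i; fin_cases i <;> assumption
  have q03 : ∀ i, c i 0 3 = 0 := by intro i; fin_cases i <;> assumption
  have q13 : ∀ i, c i 1 3 = 0 := by intro i; fin_cases i <;> assumption
  exact (h i).eq_zero (h1 i) (q02 i) (q03 i) (q13 i) j k

lemma minorForm_frame_02 (α β : Jet →L[ℝ] ℝ) (a : Fin 3 → ℝ) :
    minorForm a (frame α β 0) (frame α β 2) = a ⬝ᵥ (conic α β 0 ⨯₃ conic α β 1) := by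
  simp [minorForm, frame]

lemma minorForm_frame_03 (α β : Jet →L[ℝ] ℝ) (a : Fin 3 → ℝ) :
    minorForm a (frame α β 0) (frame α β 3) = a ⬝ᵥ (conic α β 0 ⨯₃ conic α β 2) := by
  simp [minorForm, frame]

lemma minorForm_frame_13 (α β : Jet →L[ℝ] ℝ) (a : Fin 3 → ℝ) :
    minorForm a (frame α β 1) (frame α β 3) = a ⬝ᵥ (conic α β 1 ⨯₃ conic α β 2) := by
  simp [minorForm, frame]

/-- The `2 × 2` minors are independent on the common kernel of `α` and `β`. -/
lemma minorForm_injective {α β : Jet →L[ℝ] ℝ} (h : conicDet α β ≠ 0) {a : Fin 3 → ℝ}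
    (ha : ∀ j k, minorForm a (frame α β j) (frame α β k) = 0) : a = 0 := by
  have h02 := minorForm_frame_02 α β a
  have h03 := minorForm_frame_03 α β a
  have h13 := minorForm_frame_13 α β a
  rw [ha] at h02 h03 h13
  have h03' : a ⬝ᵥ (conic α β 2 ⨯₃ conic α β 0) = 0 := by
    rw [← cross_anticomm, dotProduct_neg, ← h03, neg_zero]
  have := conicDet_smul α β a
  rw [← h02, ← h13, h03'] at this
  simpa [h] using this

/-- The coefficients of the combination of minors that agrees on the common kernel of `α` and
`β` with a symmetric form vanishing on matrices of rank one. -/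
def minorCoeff (α β : Jet →L[ℝ] ℝ) (B : Jet →L[ℝ] Jet →L[ℝ] ℝ) : Fin 3 → ℝ :=
  (conicDet α β)⁻¹ • (B (frame α β 1) (frame α β 3) • conic α β 0
    - B (frame α β 0) (frame α β 3) • conic α β 1 + B (frame α β 0) (frame α β 2) • conic α β 2)

/-- Both sides are quadrics through the twisted cubic, so it is enough to compare the three
coordinates of `VanishesOnCubic.eq_zero`; `minorCoeff` solves for them in the conic basis. -/
lemma minorForm_minorCoeff {α β : Jet →L[ℝ] ℝ} (h : conicDet α β ≠ 0)
    {B : Jet →L[ℝ] Jet →L[ℝ] ℝ} (hB : ∀ H K, B H K = B K H)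
    (hv : ∀ x y, B (charDir α β x y) (charDir α β x y) = 0) (j k : Fin 4) :
    minorForm (minorCoeff α β B) (frame α β j) (frame α β k) = B (frame α β j) (frame α β k) := by
  set a := minorCoeff α β B with ha
  have h1 : VanishesOnCubic fun j k => minorForm a (frame α β j) (frame α β k)
      - B (frame α β j) (frame α β k) := by
    apply vanishesOnCubic_of_bilin (α := α) (β := β) (B := fun H K => minorForm a H K - B H K)
    · intro H K; rw [minorForm_comm, hB]
    · intro H K K'; rw [minorForm_add_right, map_add]; ring
    · intro c H K; rw [minorForm_smul_right, map_smul, smul_eq_mul]; ring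
    · intro x y; rw [minorForm_charDir, hv, sub_zero]
  have aux : ∀ v : Fin 3 → ℝ, a ⬝ᵥ v = (conicDet α β)⁻¹ *
      (B (frame α β 1) (frame α β 3) * (conic α β 0 ⬝ᵥ v)
        - B (frame α β 0) (frame α β 3) * (conic α β 1 ⬝ᵥ v)
        + B (frame α β 0) (frame α β 2) * (conic α β 2 ⬝ᵥ v)) := by
    intro v
    simp [ha, minorCoeff, smul_dotProduct, add_dotProduct, sub_dotProduct]
    ring
  have d1 : conic α β 2 ⬝ᵥ (conic α β 0 ⨯₃ conic α β 1) = conicDet α β := by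
    rw [conicDet, triple_product_permutation, triple_product_permutation]
  have d2 : conic α β 1 ⬝ᵥ (conic α β 0 ⨯₃ conic α β 2) = - conicDet α β := by
    rw [conicDet, ← cross_anticomm, dotProduct_neg, triple_product_permutation,
      triple_product_permutation]
  refine sub_eq_zero.mp (h1.eq_zero ?_ ?_ ?_ ?_ j k)
  · intro j k; rw [minorForm_comm, hB]
  · rw [minorForm_frame_02, aux, d1]; simp [mul_comm _ (conicDet α β), inv_mul_cancel_left₀ h]
  · rw [minorForm_frame_03, aux, d2]; simp; field_simp; ring
  · rw [minorForm_frame_13, aux]; rw [← conicDet]; simp [mul_comm _ (conicDet α β), inv_mul_cancel_left₀ h]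

/-! ## Projective shifts -/

/-- The minors in the quadratic part of `α(H (1 + p H)⁻¹) det(1 + p H)`. -/
def shiftCoeff (α : Jet →L[ℝ] ℝ) (p : Fin 2 → Fin 3 → ℝ) : Fin 3 → ℝ :=
  row α 0 ⨯₃ p 1 - row α 1 ⨯₃ p 0

lemma shiftCoeff_dot (α β θ : Jet →L[ℝ] ℝ) (p : Fin 2 → Fin 3 → ℝ) (j k : Fin 3) :
    shiftCoeff θ p ⬝ᵥ (conic α β j ⨯₃ conic α β k)
      = (row θ 0 ⬝ᵥ conic α β j) * (p 1 ⬝ᵥ conic α β k)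
        - (row θ 0 ⬝ᵥ conic α β k) * (p 1 ⬝ᵥ conic α β j)
        - (row θ 1 ⬝ᵥ conic α β j) * (p 0 ⬝ᵥ conic α β k)
        + (row θ 1 ⬝ᵥ conic α β k) * (p 0 ⬝ᵥ conic α β j) := by
  rw [shiftCoeff, sub_dotProduct, cross_dot_cross, cross_dot_cross]
  ring

lemma row_dot_left (α β : Jet →L[ℝ] ℝ) :
    row α 0 ⬝ᵥ conic α β 0 = 0 ∧ row α 1 ⬝ᵥ conic α β 0 = - coef α β α 0 ∧
    row α 1 ⬝ᵥ conic α β 1 = - coef α β α 1 ∧ row α 1 ⬝ᵥ conic α β 2 = 0 := by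
  refine ⟨?_, ?_, ?_, ?_⟩ <;>
  · simp [coef, conic, cross_apply, dotProduct, Fin.sum_univ_three]
    try ring

lemma row_dot_right (α β : Jet →L[ℝ] ℝ) :
    row β 0 ⬝ᵥ conic α β 0 = 0 ∧ row β 1 ⬝ᵥ conic α β 0 = - coef α β β 0 ∧
    row β 1 ⬝ᵥ conic α β 1 = - coef α β β 1 ∧ row β 1 ⬝ᵥ conic α β 2 = 0 := by
  refine ⟨?_, ?_, ?_, ?_⟩ <;>
  · simp [coef, conic, cross_apply, dotProduct, Fin.sum_univ_three]
    try ring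

/-- By the Binet–Cauchy identity the equations become linear in the six numbers p_a ⬝ conic_k. They
group into three 2 × 2 systems, each with determinant `conicDet`. -/
lemma shiftCoeff_injective {α β : Jet →L[ℝ] ℝ} (h : conicDet α β ≠ 0)
    {p : Fin 2 → Fin 3 → ℝ} (hα : shiftCoeff α p = 0) (hβ : shiftCoeff β p = 0) : p = 0 := by
  have two : ∀ X Y : ℝ, coef α β α 0 * X + coef α β α 1 * Y = 0 →
      coef α β β 0 * X + coef α β β 1 * Y = 0 → X = 0 ∧ Y = 0 := by
    intro X Y h1 h2
    have := coords_of_mem_ker h (c := ![0, X, Y]) (d := 0) (by simpa using h1) (by simpa using h2)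
    simpa using this
  obtain ⟨a1, a2, a3, a4⟩ := row_dot_left α β
  obtain ⟨b1, b2, b3, b4⟩ := row_dot_right α β
  have c1 : ∀ θ, row θ 0 ⬝ᵥ conic α β 1 = coef α β θ 0 := fun _ => rfl
  have c2 : ∀ θ, row θ 0 ⬝ᵥ conic α β 2 = coef α β θ 1 := fun _ => rfl
  have e01 := shiftCoeff_dot α β α p 0 1
  have e02 := shiftCoeff_dot α β α p 0 2
  have e12 := shiftCoeff_dot α β α p 1 2
  have f01 := shiftCoeff_dot α β β p 0 1
  have f02 := shiftCoeff_dot α β β p 0 2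
  have f12 := shiftCoeff_dot α β β p 1 2
  simp only [hα, hβ, zero_dotProduct, a1, a2, a3, a4, b1, b2, b3, b4, c1, c2]
    at e01 e02 e12 f01 f02 f12
  obtain ⟨g1, g2⟩ := two (p 0 ⬝ᵥ conic α β 1 - p 1 ⬝ᵥ conic α β 0) (-(p 0 ⬝ᵥ conic α β 0))
    (by linarith) (by linarith)
  obtain ⟨g3, g4⟩ := two (p 0 ⬝ᵥ conic α β 2) (- (p 1 ⬝ᵥ conic α β 0)) (by linarith) (by linarith)
  obtain ⟨g5, g6⟩ := two (p 1 ⬝ᵥ conic α β 2) (p 0 ⬝ᵥ conic α β 2 - p 1 ⬝ᵥ conic α β 1)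
    (by linarith) (by linarith)
  ext a i
  have : p a = 0 := by
    apply eq_zero_of_dot_conic h
    intro k
    fin_cases a <;> fin_cases k <;> simp only [Fin.mk_zero, Fin.mk_one, Fin.reduceFinMk,
      Fin.zero_eta] <;> linarith
  simp [this]

/-- The shift has six parameters and the quadratic parts of a pair of minor combinations have six
coefficients, so injectivity suffices. Hence every pair of quadratic parts can be produced, and so
removed, by a shift. -/
lemma shiftCoeff_surjective {α β : Jet →L[ℝ] ℝ} (h : conicDet α β ≠ 0) (a b : Fin 3 → ℝ) :
    ∃ p : Fin 2 → Fin 3 → ℝ, shiftCoeff α p = a ∧ shiftCoeff β p = b := by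
  let f : Jet →ₗ[ℝ] Jet :=
    { toFun := fun p => ![shiftCoeff α p, shiftCoeff β p]
      map_add' := by
        intro p q
        ext i j
        fin_cases i <;> fin_cases j <;> simp [shiftCoeff, cross_apply] <;> ring
      map_smul' := by
        intro c p
        ext i j
        fin_cases i <;> fin_cases j <;> simp [shiftCoeff, cross_apply] <;> ring }
  have hf : Function.Injective f := by
    rw [← LinearMap.ker_eq_bot, LinearMap.ker_eq_bot']
    intro p hp
    exact shiftCoeff_injective h (congrFun hp 0) (congrFun hp 1)
  obtain ⟨p, hp⟩ := (LinearMap.injective_iff_surjective.mp hf) ![a, b]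
  exact ⟨p, congrFun hp 0, congrFun hp 1⟩

/-! ## The isotropy algebra -/

/-- The infinitesimal action `H ↦ a H - H d`. -/
def isotropy (a : Matrix (Fin 2) (Fin 2) ℝ) (d : Matrix (Fin 3) (Fin 3) ℝ) (H : Jet) : Jet :=
  Matrix.of.symm (a * Matrix.of H - Matrix.of H * d)

lemma isotropy_apply (a : Matrix (Fin 2) (Fin 2) ℝ) (d : Matrix (Fin 3) (Fin 3) ℝ) (H : Jet)
    (i : Fin 2) : isotropy a d H i = a i 0 • H 0 + a i 1 • H 1 - H i ᵥ* d := by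
  ext j
  simp [isotropy, Matrix.mul_apply, Matrix.vecMul, dotProduct, Fin.sum_univ_two]

lemma eq_scalar_of_conic {α β : Jet →L[ℝ] ℝ} (h : conicDet α β ≠ 0)
    {d : Matrix (Fin 3) (Fin 3) ℝ} {m : ℝ} (hd : ∀ k, conic α β k ᵥ* d = m • conic α β k) :
    d = m • (1 : Matrix (Fin 3) (Fin 3) ℝ) := by
  have : ∀ v : Fin 3 → ℝ, v ᵥ* d = v ᵥ* (m • (1 : Matrix (Fin 3) (Fin 3) ℝ)) := by
    intro v
    obtain ⟨c, rfl⟩ := exists_conic_coord h v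
    simp only [Matrix.add_vecMul, Matrix.smul_vecMul, hd, Matrix.vecMul_smul, Matrix.vecMul_one]
    module
  exact Matrix.ext_of_single_vecMul fun i => this _

/-- In the conic basis the four frame matrices give eight linear equations on the nine entries of d.
What survives is a diagonal matrix with equal entries. -/
lemma eq_scalar_of_isotropy {α β : Jet →L[ℝ] ℝ} (h : conicDet α β ≠ 0)
    {d : Matrix (Fin 3) (Fin 3) ℝ} (hα : ∀ k, α (isotropy 0 d (frame α β k)) = 0)
    (hβ : ∀ k, β (isotropy 0 d (frame α β k)) = 0) :
    ∃ m : ℝ, d = m • (1 : Matrix (Fin 3) (Fin 3) ℝ) := by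
  choose D hD using fun k => exists_conic_coord h (conic α β k ᵥ* d)
  have key : ∀ k (c e : Fin 3 → ℝ), frame α β k 0 ᵥ* d
        = c 0 • conic α β 0 + c 1 • conic α β 1 + c 2 • conic α β 2 →
      frame α β k 1 ᵥ* d
        = e 0 • conic α β 0 + e 1 • conic α β 1 + e 2 • conic α β 2 → c 1 = e 0 ∧ c 2 = e 1 := by
    intro k c e hc he
    rw [← mem_ker_iff h]
    have : isotropy 0 d (frame α β k)
        = - ![c 0 • conic α β 0 + c 1 • conic α β 1 + c 2 • conic α β 2,
      e 0 • conic α β 0 + e 1 • conic α β 1 + e 2 • conic α β 2] := by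
      rw [← hc, ← he]
      ext i j
      rw [isotropy_apply]
      fin_cases i <;> simp
    have h1 := hα k
    have h2 := hβ k
    rw [this, map_neg, neg_eq_zero] at h1 h2
    exact ⟨h1, h2⟩
  have k0 := key 0 (D 0) 0 (hD 0) (by simp [frame])
  have k1 := key 1 (D 1) (D 0) (hD 1) (hD 0)
  have k2 := key 2 (D 2) (D 1) (hD 2) (hD 1)
  have k3 := key 3 0 (D 2) (by simp [frame]) (hD 2)
  simp only [Pi.zero_apply] at k0 k3
  refine ⟨D 0 0, eq_scalar_of_conic h fun k => ?_⟩
  rw [hD k]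
  fin_cases k
  · simp [k0.1, k0.2]
  · simp [k1.1, k1.2, k0.1, ← k2.1, ← k3.2]
  · simp [k2.2, k1.1, ← k3.1, ← k3.2]

/-- Every `2 × 2` matrix extends to an infinitesimal isotropy of the common kernel. -/
lemma exists_isotropy {α β : Jet →L[ℝ] ℝ} (h : conicDet α β ≠ 0)
    (a : Matrix (Fin 2) (Fin 2) ℝ) : ∃ d : Matrix (Fin 3) (Fin 3) ℝ, d.trace = - a.trace ∧
      ∀ k, α (isotropy a d (frame α β k)) = 0 ∧ β (isotropy a d (frame α β k)) = 0 := by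
  let M : Matrix (Fin 3) (Fin 3) ℝ := Matrix.of (conic α β)
  have hM : M.det = conicDet α β := by
    simp [M, Matrix.det_fin_three, conicDet, cross_apply, dotProduct, Fin.sum_univ_three]; ring
  have hu : IsUnit M.det := by rw [hM]; exact h.isUnit
  -- The action of `a` on binary quadratics, with a minus sign: when `a` moves (x, y), this makes
  -- the characteristic covector move along the conic, so that the cone over the twisted cubic is
  -- preserved infinitesimally.
  let D : Matrix (Fin 3) (Fin 3) ℝ :=
    !![-(2 * a 0 0), -a 1 0, 0; -(2 * a 0 1), -(a 0 0 + a 1 1), -(2 * a 1 0); 0, -a 0 1, -(2 * a 1 1)]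
  -- A multiple of the identity preserves the kernel, and is spent on fixing the trace.
  let μ : ℝ := (- a.trace - (M⁻¹ * D * M).trace) / 3
  have hrow : ∀ k, conic α β k ᵥ* (M⁻¹ * D * M + μ • (1 : Matrix (Fin 3) (Fin 3) ℝ))
      = D k 0 • conic α β 0 + D k 1 • conic α β 1 + D k 2 • conic α β 2 + μ • conic α β k := by
    intro k
    have e : M * (M⁻¹ * D * M) = D * M := by
      rw [← mul_assoc, ← mul_assoc, Matrix.mul_nonsing_inv _ hu, one_mul]
    have e2 : conic α β k ᵥ* (M⁻¹ * D * M) = (M * (M⁻¹ * D * M)) k := by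
      rw [Matrix.mul_apply_eq_vecMul]; rfl
    rw [Matrix.vecMul_add, e2, e, Matrix.vecMul_smul, Matrix.vecMul_one]
    congr 1
    ext j
    simp [Matrix.mul_apply, Fin.sum_univ_three, M]
  refine ⟨M⁻¹ * D * M + μ • 1, ?_, ?_⟩
  · rw [Matrix.trace_add, Matrix.trace_smul, Matrix.trace_one]
    simp [μ]
  · intro k
    set d := M⁻¹ * D * M + μ • (1 : Matrix (Fin 3) (Fin 3) ℝ)
    have r0 := hrow 0
    have r1 := hrow 1
    have r2 := hrow 2
    simp only [D, Matrix.of_apply, Matrix.cons_val] at r0 r1 r2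
    have main : ∀ c e : Fin 3 → ℝ, isotropy a d (frame α β k)
        = ![c 0 • conic α β 0 + c 1 • conic α β 1 + c 2 • conic α β 2,
          e 0 • conic α β 0 + e 1 • conic α β 1 + e 2 • conic α β 2] → c 1 = e 0 → c 2 = e 1 →
        α (isotropy a d (frame α β k)) = 0 ∧ β (isotropy a d (frame α β k)) = 0 := by
      intro c e hce h1 h2
      rw [hce]
      exact (mem_ker_iff h c e).mpr ⟨h1, h2⟩
    fin_cases k
    · refine main ![3 * a 0 0 - μ, a 1 0, 0] ![a 1 0, 0, 0] ?_ (by simp) (by simp)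
      ext i j
      rw [isotropy_apply]
      fin_cases i
      · simp [frame, r0]; ring
      · simp [frame, r0]
    · refine main ![3 * a 0 1, 2 * a 0 0 + a 1 1 - μ, 2 * a 1 0]
        ![2 * a 0 0 + a 1 1 - μ, 2 * a 1 0, 0] ?_ (by simp) (by simp)
      ext i j
      rw [isotropy_apply]
      fin_cases i
      · simp [frame, r0, r1]; ring
      · simp [frame, r0, r1]; ring
    · refine main ![0, 2 * a 0 1, a 0 0 + 2 * a 1 1 - μ]
        ![2 * a 0 1, a 0 0 + 2 * a 1 1 - μ, 3 * a 1 0] ?_ (by simp) (by simp)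
      ext i j
      rw [isotropy_apply]
      fin_cases i
      · simp [frame, r1, r2]; ring
      · simp [frame, r1, r2]; ring
    · refine main ![0, 0, a 0 1] ![0, a 0 1, 3 * a 1 1 - μ] ?_ (by simp) (by simp)
      ext i j
      rw [isotropy_apply]
      fin_cases i
      · simp [frame, r2]
      · simp [frame, r2]; ring

/-! ### Regular systems and their characteristic directions -/

/-- The standing assumptions on a system. -/
structure IsRegular (Ω : Set Jet) (F G : Jet → ℝ) : Prop where
  isOpen : IsOpen Ω
  left : ContDiffOn ℝ ∞ F Ω
  right : ContDiffOn ℝ ∞ G Ω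
  nondeg : IsNondegenerate Ω F G

/-- The Hessian. -/
def hess (F : Jet → ℝ) (U : Jet) : Jet →L[ℝ] Jet →L[ℝ] ℝ := fderiv ℝ (fderiv ℝ F) U

/-- `frame` of the differentials of `F` and `G`. -/
def tframe (F G : Jet → ℝ) (k : Fin 4) (U : Jet) : Jet :=
  frame (fderiv ℝ F U) (fderiv ℝ G U) k

/-- The characteristic directions of the system. -/
def tchar (F G : Jet → ℝ) (x y : ℝ) (U : Jet) : Jet :=
  charDir (fderiv ℝ F U) (fderiv ℝ G U) x y

/-! ### Smooth dependence of the pencil constructions on the point -/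

section Smooth

variable {Ω : Set Jet} {F G : Jet → ℝ} {U : Jet}

lemma contDiffAt_fderiv {E E' : Type*} [NormedAddCommGroup E] [NormedSpace ℝ E]
    [NormedAddCommGroup E'] [NormedSpace ℝ E'] {f : E → E'} {x : E} (h : ContDiffAt ℝ ∞ f x) :
    ContDiffAt ℝ ∞ (fderiv ℝ f) x := h.fderiv_right (by simp)

lemma contDiffAt_row {n : ℕ∞ω} {E : Type*} [NormedAddCommGroup E] [NormedSpace ℝ E]
    {α : E → Jet →L[ℝ] ℝ} {x : E} (h : ContDiffAt ℝ n α x) (a : Fin 2) (i : Fin 3) :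
    ContDiffAt ℝ n (fun y => row (α y) a i) x := h.clm_apply contDiffAt_const

lemma contDiffAt_conic {n : ℕ∞ω} {E : Type*} [NormedAddCommGroup E] [NormedSpace ℝ E]
    {α β : E → Jet →L[ℝ] ℝ} {x : E} (hα : ContDiffAt ℝ n α x) (hβ : ContDiffAt ℝ n β x)
    (k : Fin 3) : ContDiffAt ℝ n (fun y => conic (α y) (β y) k) x := by
  rw [contDiffAt_pi]
  have hA := contDiffAt_row hα
  have hB := contDiffAt_row hβ
  intro i
  fin_cases k <;> fin_cases i <;>
  · simp [conic, cross_apply]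
    fun_prop (disch := assumption)

lemma contDiffAt_frame {n : ℕ∞ω} {E : Type*} [NormedAddCommGroup E] [NormedSpace ℝ E]
    {α β : E → Jet →L[ℝ] ℝ} {x : E} (hα : ContDiffAt ℝ n α x) (hβ : ContDiffAt ℝ n β x)
    (k : Fin 4) : ContDiffAt ℝ n (fun y => frame (α y) (β y) k) x := by
  rw [contDiffAt_pi]
  have h := contDiffAt_conic hα hβ
  intro i
  fin_cases k <;> fin_cases i <;> first
    | exact h 0
    | exact h 1
    | exact h 2
    | exact contDiffAt_const (c := (0 : Fin 3 → ℝ))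

lemma contDiffAt_conicDet {n : ℕ∞ω} {E : Type*} [NormedAddCommGroup E] [NormedSpace ℝ E]
    {α β : E → Jet →L[ℝ] ℝ} {x : E} (hα : ContDiffAt ℝ n α x) (hβ : ContDiffAt ℝ n β x) :
    ContDiffAt ℝ n (fun y => conicDet (α y) (β y)) x := by
  have h := fun k i => contDiffAt_pi.mp (contDiffAt_conic hα hβ k) i
  simp only [conicDet, cross_apply, dotProduct, Fin.sum_univ_three, Matrix.cons_val]
  fun_prop (disch := assumption)

lemma contDiffAt_minorCoeff {n : ℕ∞ω} {E : Type*} [NormedAddCommGroup E] [NormedSpace ℝ E]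
    {α β : E → Jet →L[ℝ] ℝ} {B : E → Jet →L[ℝ] Jet →L[ℝ] ℝ} {x : E}
    (hα : ContDiffAt ℝ n α x) (hβ : ContDiffAt ℝ n β x) (hB : ContDiffAt ℝ n B x)
    (h : conicDet (α x) (β x) ≠ 0) :
    ContDiffAt ℝ n (fun y => minorCoeff (α y) (β y) (B y)) x := by
  have h1 := contDiffAt_frame hα hβ
  have h2 := contDiffAt_conic hα hβ
  have h3 := (contDiffAt_conicDet hα hβ).inv h
  have h4 := fun j k => (hB.clm_apply (h1 j)).clm_apply (h1 k)
  exact h3.smul ((((h4 1 3).smul (h2 0)).sub ((h4 0 3).smul (h2 1))).add ((h4 0 2).smul (h2 2)))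

lemma contDiffAt_charDir {n : ℕ∞ω} {E : Type*} [NormedAddCommGroup E] [NormedSpace ℝ E]
    {α β : E → Jet →L[ℝ] ℝ} {x : E} (hα : ContDiffAt ℝ n α x) (hβ : ContDiffAt ℝ n β x)
    (s t : ℝ) : ContDiffAt ℝ n (fun y => charDir (α y) (β y) s t) x := by
  have h1 := contDiffAt_frame hα hβ
  exact ((((h1 0).const_smul _).add ((h1 1).const_smul _)).add ((h1 2).const_smul _)).add
    ((h1 3).const_smul _)

lemma hess_comm (h : ContDiffAt ℝ ∞ F U) (H K : Jet) : hess F U H K = hess F U K H :=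
  (h.isSymmSndFDerivAt (by
    simp only [minSmoothness_of_isRCLikeNormedField]
    exact WithTop.coe_le_coe.mpr (le_top : (2 : ℕ∞) ≤ ⊤))).eq H K

end Smooth

/-! ### The fourfold as a submanifold: charts, tangent vectors, paths -/

section Regular

variable {Ω : Set Jet} {F G : Jet → ℝ} {U : Jet}

lemma IsRegular.contDiffAt_left (hR : IsRegular Ω F G) (hU : U ∈ Ω) : ContDiffAt ℝ ∞ F U :=
  hR.left.contDiffAt (hR.isOpen.mem_nhds hU)

lemma IsRegular.contDiffAt_right (hR : IsRegular Ω F G) (hU : U ∈ Ω) : ContDiffAt ℝ ∞ G U :=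
  hR.right.contDiffAt (hR.isOpen.mem_nhds hU)

lemma IsRegular.conicDet_ne_zero (hR : IsRegular Ω F G) (hU : U ∈ fourfold Ω F G) :
    conicDet (fderiv ℝ F U) (fderiv ℝ G U) ≠ 0 :=
  GrassmannSystem.conicDet_ne_zero (hR.nondeg U hU)

/-- Surjectivity of (α, β), which is the regular-value condition of the implicit function theorem.
The witness has zero second row and is found by Cramer's rule from `coef_det`. -/
lemma exists_dual {α β : Jet →L[ℝ] ℝ} (h : conicDet α β ≠ 0) (a b : ℝ) :
    ∃ H : Jet, α H = a ∧ β H = b := by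
  refine ⟨((a * coef α β β 1 - b * coef α β α 1) / conicDet α β) • ![conic α β 1, 0]
    + ((b * coef α β α 0 - a * coef α β β 0) / conicDet α β) • ![conic α β 2, 0], ?_, ?_⟩
  all_goals
    have e : ∀ (θ : Jet →L[ℝ] ℝ), θ ![conic α β 1, 0] = coef α β θ 0 ∧
        θ ![conic α β 2, 0] = coef α β θ 1 := by
      intro θ
      constructor
      · rw [apply_eq_row]; simp [coef, dotProduct, Fin.sum_univ_three]; ring
      · rw [apply_eq_row]; simp [coef, dotProduct, Fin.sum_univ_three]; ring
    rw [map_add, map_smul, map_smul, (e _).1, (e _).2]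
    have hd := coef_det α β
    simp only [smul_eq_mul]
    field_simp
    rw [← hd]
    ring

/-- The pair of left hand sides of the system. -/
def pairFun (F G : Jet → ℝ) (U : Jet) : ℝ × ℝ := (F U, G U)

/-- The tangent space of the fourfold. -/
abbrev tangent (F G : Jet → ℝ) (U : Jet) : Submodule ℝ Jet :=
  LinearMap.ker ((fderiv ℝ F U).prod (fderiv ℝ G U) : Jet →L[ℝ] ℝ × ℝ).toLinearMap

/-- Near each of its points the fourfold is parametrised by its tangent space. -/
lemma IsRegular.exists_chart (hR : IsRegular Ω F G) (hU : U ∈ fourfold Ω F G) :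
    ∃ (σ : tangent F G U → Jet) (π : Jet →L[ℝ] tangent F G U), ContDiffAt ℝ 1 σ 0 ∧ σ 0 = U ∧
      (∀ y : tangent F G U, π y = y) ∧
      (∀ᶠ y in 𝓝 0, σ y ∈ fourfold Ω F G ∧ π (σ y - U) = y) ∧
      HasFDerivAt σ (tangent F G U).subtypeL 0 ∧
      ∀ N ∈ 𝓝 (0 : tangent F G U), ∀ᶠ V in 𝓝 U, V ∈ fourfold Ω F G → ∃ y ∈ N, σ y = V := by
  have hF := hR.contDiffAt_left hU.1
  have hG := hR.contDiffAt_right hU.1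
  have hs : HasStrictFDerivAt (pairFun F G) ((fderiv ℝ F U).prod (fderiv ℝ G U)) U :=
    (hF.hasStrictFDerivAt (by simp)).prodMk (hG.hasStrictFDerivAt (by simp))
  have hsurj : ((fderiv ℝ F U).prod (fderiv ℝ G U)).range = ⊤ := by
    rw [LinearMap.range_eq_top]
    rintro ⟨a, b⟩
    obtain ⟨H, h1, h2⟩ := exists_dual (hR.conicDet_ne_zero hU) a b
    exact ⟨H, by simp [h1, h2]⟩
  have h0 : pairFun F G U = (0, 0) := by simp [pairFun, hU.2.1, hU.2.2]
  let ψ := hs.implicitFunction _ _ hsurj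
  have hψ0 : ψ (pairFun F G U) 0 = U := hs.implicitFunction_apply_image hsurj
  have hψd : HasStrictFDerivAt (ψ (pairFun F G U)) (tangent F G U).subtypeL 0 :=
    hs.to_implicitFunction hsurj
  -- This choice of projection onto the tangent space is shared with the implicit function, so that
  -- the chart satisfies π (σ y - U) = y.
  have hker := ContinuousLinearMap.ker_closedComplemented_of_finiteDimensional_range
    ((fderiv ℝ F U).prod (fderiv ℝ G U))
  refine ⟨ψ (pairFun F G U), Classical.choose hker, ?_, hψ0, Classical.choose_spec hker, ?_,
    hψd.hasFDerivAt, ?_⟩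
  · let D := HasStrictFDerivAt.implicitFunctionDataOfComplemented (pairFun F G) _ hs hsurj
      (ContinuousLinearMap.ker_closedComplemented_of_finiteDimensional_range _)
    have h1 : ContDiffAt ℝ 1 D.implicitFunction.uncurry (D.prodFun D.pt) := by
      apply ImplicitFunctionData.contDiffAt_implicitFunction
      · exact (hF.prodMk hG).of_le (by simp)
      · exact ((ContinuousLinearMap.contDiff _).comp (contDiff_id.sub contDiff_const)).contDiffAt
      · simp
    have h2 : D.prodFun D.pt = (pairFun F G U, 0) := by
      simp only [D, ImplicitFunctionData.prodFun,
        HasStrictFDerivAt.implicitFunctionDataOfComplemented, sub_self]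
      rw [map_zero]
    rw [h2] at h1
    exact h1.comp (0 : tangent F G U) (contDiffAt_const.prodMk contDiffAt_id)
  · have h1 := hs.map_implicitFunction_eq hsurj
    have h2 : ∀ᶠ y : tangent F G U in 𝓝 0, pairFun F G (ψ (pairFun F G U) y) = pairFun F G U := by
      have hc : Filter.Tendsto (fun y : tangent F G U => (pairFun F G U, y)) (𝓝 0)
          (𝓝 (pairFun F G U, 0)) := by
        exact (Continuous.prodMk_right _).tendsto _
      exact hc.eventually h1
    have h3 : ∀ᶠ y : tangent F G U in 𝓝 0, ψ (pairFun F G U) y ∈ Ω := by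
      have := hψd.hasFDerivAt.continuousAt
      exact this.eventually (by rw [hψ0]; exact hR.isOpen.mem_nhds hU.1)
    have h5 : ∀ᶠ y : tangent F G U in 𝓝 0,
        Classical.choose hker (ψ (pairFun F G U) y - U) = y := by
      let D := HasStrictFDerivAt.implicitFunctionDataOfComplemented (pairFun F G) _ hs hsurj hker
      have e1 := D.rightFun_implicitFunction
      have e2 : D.prodFun D.pt = (pairFun F G U, 0) := by
        simp only [D, ImplicitFunctionData.prodFun,
          HasStrictFDerivAt.implicitFunctionDataOfComplemented, sub_self]
        rw [map_zero]
      rw [e2] at e1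
      have hc : Filter.Tendsto (fun y : tangent F G U => (pairFun F G U, y)) (𝓝 0)
          (𝓝 (pairFun F G U, 0)) := by
        exact (Continuous.prodMk_right _).tendsto _
      exact hc.eventually e1
    filter_upwards [h2, h3, h5] with y h2 h3 h5
    refine ⟨?_, h5⟩
    have h4 := h2.trans h0
    exact ⟨h3, congrArg Prod.fst h4, congrArg Prod.snd h4⟩
  · intro N hN
    have h1 := hs.eq_implicitFunction hsurj
    have h2 : ∀ᶠ V in 𝓝 U,
        (hs.implicitToOpenPartialHomeomorph (pairFun F G) _ hsurj V).2 ∈ N := by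
      have hc : ContinuousAt
          (fun V => (hs.implicitToOpenPartialHomeomorph (pairFun F G) _ hsurj V).2) U :=
        continuousAt_snd.comp ((hs.implicitToOpenPartialHomeomorph (pairFun F G) _
          hsurj).continuousAt (hs.mem_implicitToOpenPartialHomeomorph_source hsurj))
      apply hc.eventually
      simp only [hs.implicitToOpenPartialHomeomorph_self hsurj]
      exact hN
    filter_upwards [h1, h2] with V h1 h2 hV
    refine ⟨_, h2, ?_⟩
    rw [h0]
    have : pairFun F G V = (0, 0) := by simp [pairFun, hV.2.1, hV.2.2]
    rw [this] at h1
    exact h1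

lemma mem_tangent {H : Jet} : H ∈ tangent F G U ↔ fderiv ℝ F U H = 0 ∧ fderiv ℝ G U H = 0 := by
  simp [tangent, LinearMap.mem_ker]

/-- A function that vanishes on the fourfold has derivative zero along it. -/
lemma IsRegular.fderiv_eq_zero {E : Type*} [NormedAddCommGroup E] [NormedSpace ℝ E]
    (hR : IsRegular Ω F G) (hU : U ∈ fourfold Ω F G) {f : Jet → E}
    {f' : Jet →L[ℝ] E} (hf : HasFDerivAt f f' U) (h : ∀ᶠ V in 𝓝 U, V ∈ fourfold Ω F G → f V = 0)
    {H : Jet} (hα : fderiv ℝ F U H = 0) (hβ : fderiv ℝ G U H = 0) : f' H = 0 := by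
  obtain ⟨σ, _, -, h0, -, h1, h2, -⟩ := hR.exists_chart hU
  have hc : HasFDerivAt (f ∘ σ) (f'.comp (tangent F G U).subtypeL) 0 :=
    HasFDerivAt.comp 0 (by rwa [h0]) h2
  have hz : f ∘ σ =ᶠ[𝓝 0] fun _ => (0 : E) := by
    have := h2.continuousAt.eventually (by rw [h0]; exact h)
    filter_upwards [h1, this] with y hy1 hy2 using hy2 hy1.1
  have := hc.unique ((hasFDerivAt_const (0 : E) (0 : tangent F G U)).congr_of_eventuallyEq hz)
  have := congrArg (fun g => g ⟨H, mem_tangent.mpr ⟨hα, hβ⟩⟩) this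
  simpa using this

/-- The restriction to a tangent line of a function that vanishes on the fourfold. -/
lemma IsRegular.hasDerivAt_line {E : Type*} [NormedAddCommGroup E] [NormedSpace ℝ E]
    (hR : IsRegular Ω F G) (hU : U ∈ fourfold Ω F G) {f : Jet → E}
    (hf : DifferentiableAt ℝ f U) (h : ∀ᶠ V in 𝓝 U, V ∈ fourfold Ω F G → f V = 0)
    {H : Jet} (hα : fderiv ℝ F U H = 0) (hβ : fderiv ℝ G U H = 0) :
    HasDerivAt (fun s : ℝ => f (U + s • H)) 0 0 := by
  have h1 := hR.fderiv_eq_zero hU hf.hasFDerivAt h hα hβ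
  have h2 : HasDerivAt (fun s : ℝ => U + s • H) H 0 := by
    simpa using ((hasDerivAt_id (0 : ℝ)).smul_const H).const_add U
  have h3 : HasFDerivAt f (fderiv ℝ f U) (U + (0 : ℝ) • H) := by simpa using hf.hasFDerivAt
  have := h3.comp_hasDerivAt (0 : ℝ) h2
  rw [h1] at this
  exact this

/-- Nearby points of the fourfold are joined by curves on it. -/
lemma IsRegular.exists_path (hR : IsRegular Ω F G) (hU : U ∈ fourfold Ω F G) {N : Set Jet}
    (hN : N ∈ 𝓝 U) : ∀ᶠ V in 𝓝 U, V ∈ fourfold Ω F G → ∃ γ γ' : ℝ → Jet, γ 0 = V ∧ γ 1 = U ∧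
      ContinuousOn γ' (Set.Icc 0 1) ∧ ∀ s ∈ Set.Icc (0 : ℝ) 1, γ s ∈ fourfold Ω F G ∧ γ s ∈ N ∧
        HasDerivAt γ (γ' s) s ∧ fderiv ℝ F (γ s) (γ' s) = 0 ∧ fderiv ℝ G (γ s) (γ' s) = 0 := by
  obtain ⟨σ, _, hc, h0, -, h1, h2, h3⟩ := hR.exists_chart hU
  have hN' : ∀ᶠ y in 𝓝 0, σ y ∈ N := h2.continuousAt.eventually (by rw [h0]; exact hN)
  obtain ⟨u, hu, hcu⟩ := hc.contDiffOn (m := 1) le_rfl (by simp)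
  obtain ⟨r, hr, hball⟩ := Metric.mem_nhds_iff.mp
    (Filter.inter_mem (Filter.inter_mem (h1.mono fun y hy => hy.1) hN') (by simpa using hu))
  have hcb : ContDiffOn ℝ 1 σ (Metric.ball 0 r) := hcu.mono fun y hy => (hball hy).2
  filter_upwards [h3 _ (Metric.ball_mem_nhds 0 hr)] with V hV hVX
  obtain ⟨y, hy, rfl⟩ := hV hVX
  -- A radial segment in the chart; it starts at the parameter of V and ends at the origin, which is
  -- the parameter of U.
  let l : ℝ → tangent F G U := fun s => (1 - s) • y
  have hl : ∀ s ∈ Set.Icc (0 : ℝ) 1, l s ∈ Metric.ball 0 r := by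
    intro s hs
    simp only [l, mem_ball_zero_iff, norm_smul] at hy ⊢
    have : ‖1 - s‖ ≤ 1 := by rw [Real.norm_eq_abs, abs_le]; constructor <;> linarith [hs.1, hs.2]
    calc _ ≤ 1 * ‖y‖ := by gcongr
      _ < r := by simpa using hy
  have hlc : Continuous l := by fun_prop
  have hld : ∀ s, HasDerivAt l (-y) s := by
    intro s
    simpa using ((hasDerivAt_id s).const_sub 1).smul_const y
  have hσd : ∀ z ∈ Metric.ball 0 r, HasFDerivAt σ (fderiv ℝ σ z) z := fun z hz =>
    ((hcb.contDiffAt (Metric.isOpen_ball.mem_nhds hz)).differentiableAt (by simp)).hasFDerivAt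
  have hvan : ∀ (K : Jet → ℝ), (∀ W ∈ fourfold Ω F G, K W = 0) → ∀ z ∈ Metric.ball 0 r,
      DifferentiableAt ℝ K (σ z) → ∀ w, fderiv ℝ K (σ z) (fderiv ℝ σ z w) = 0 := by
    intro K hK z hz hKd w
    have hc : HasFDerivAt (K ∘ σ) ((fderiv ℝ K (σ z)).comp (fderiv ℝ σ z)) z :=
      hKd.hasFDerivAt.comp z (hσd z hz)
    have hz' : K ∘ σ =ᶠ[𝓝 z] fun _ => (0 : ℝ) := by
      filter_upwards [Metric.isOpen_ball.mem_nhds hz] with y hy using hK _ (hball hy).1.1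
    have := hc.unique ((hasFDerivAt_const (0 : ℝ) z).congr_of_eventuallyEq hz')
    have := congrArg (fun g => g w) this
    simpa using this
  refine ⟨σ ∘ l, fun s => fderiv ℝ σ (l s) (-y), by simp [l], by simp [l, h0], ?_, ?_⟩
  · have : ContinuousOn (fun s => fderiv ℝ σ (l s)) (Set.Icc 0 1) :=
      (hcb.continuousOn_fderiv_of_isOpen Metric.isOpen_ball (by simp)).comp hlc.continuousOn hl
    exact this.clm_apply continuousOn_const
  · intro s hs
    have hX := (hball (hl s hs)).1.1
    refine ⟨hX, (hball (hl s hs)).1.2, (hσd _ (hl s hs)).comp_hasDerivAt s (hld s), ?_, ?_⟩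
    · exact hvan F (fun W hW => hW.2.1) _ (hl s hs)
        ((hR.contDiffAt_left hX.1).differentiableAt (by simp)) _
    · exact hvan G (fun W hW => hW.2.2) _ (hl s hs)
        ((hR.contDiffAt_right hX.1).differentiableAt (by simp)) _

/-- Two functions that vanish on the fourfold and have the same differentials as `F` and `G` at
one of its points define it near that point. -/
lemma IsRegular.eventually_iff (hR : IsRegular Ω F G) (hU : U ∈ fourfold Ω F G) {Φ Ψ : Jet → ℝ}
    (hΦ : HasStrictFDerivAt Φ (fderiv ℝ F U) U) (hΨ : HasStrictFDerivAt Ψ (fderiv ℝ G U) U)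
    (h : ∀ᶠ V in 𝓝 U, V ∈ fourfold Ω F G → Φ V = 0 ∧ Ψ V = 0) :
    ∀ᶠ V in 𝓝 U, V ∈ fourfold Ω F G ↔ Φ V = 0 ∧ Ψ V = 0 := by
  obtain ⟨σ, π, -, h0, hπ, h1, h2, -⟩ := hR.exists_chart hU
  -- Adjoining the tangential coordinate π to (Φ, Ψ) makes the differential injective.
  let g' : Jet →L[ℝ] (ℝ × ℝ) × tangent F G U :=
    ((fderiv ℝ F U).prod (fderiv ℝ G U)).prod π
  have hg : HasStrictFDerivAt (fun V => ((Φ V, Ψ V), π V)) g' U :=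
    (hΦ.prodMk hΨ).prodMk π.hasStrictFDerivAt
  have hinj : LinearMap.ker g'.toLinearMap = ⊥ := by
    rw [LinearMap.ker_eq_bot']
    intro H hH
    have e1 : fderiv ℝ F U H = 0 := congrArg (fun p => p.1.1) hH
    have e2 : fderiv ℝ G U H = 0 := congrArg (fun p => p.1.2) hH
    have e3 : π H = 0 := congrArg (fun p => p.2) hH
    have := hπ ⟨H, mem_tangent.mpr ⟨e1, e2⟩⟩
    rw [e3] at this
    exact (congrArg Subtype.val this).symm
  obtain ⟨c, hc, hanti⟩ := LinearMap.exists_antilipschitzWith g'.toLinearMap hinj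
  -- An error of at most half the lower bound for the differential turns strict differentiability
  -- into injectivity near U.
  have hlo := (hg.isLittleO.def (c := (2 * (c : ℝ))⁻¹) (by positivity))
  have hlo : ∀ᶠ p : Jet × Jet in 𝓝 (U, U), ((Φ p.1, Ψ p.1), π p.1) = ((Φ p.2, Ψ p.2), π p.2) →
      p.1 = p.2 := by
    filter_upwards [hlo] with p hp he
    have h3 := hanti.le_mul_dist p.1 p.2
    have e1 : dist (g'.toLinearMap p.1) (g'.toLinearMap p.2) = ‖g' (p.1 - p.2)‖ := by
      rw [dist_eq_norm, map_sub]; rfl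
    rw [he, sub_self, zero_sub, norm_neg] at hp
    rw [e1, dist_eq_norm] at h3
    have hc' : (0 : ℝ) < c := hc
    have h4 : ‖p.1 - p.2‖ ≤ c * ((2 * (c : ℝ))⁻¹ * ‖p.1 - p.2‖) :=
      h3.trans (by gcongr)
    have h5 : c * ((2 * (c : ℝ))⁻¹ * ‖p.1 - p.2‖) = ‖p.1 - p.2‖ / 2 := by field_simp
    rw [h5] at h4
    have : ‖p.1 - p.2‖ = 0 := by linarith [norm_nonneg (p.1 - p.2)]
    exact sub_eq_zero.mp (norm_eq_zero.mp this)
  have hy : Filter.Tendsto (fun V => π (V - U)) (𝓝 U) (𝓝 0) := by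
    have : Continuous fun V => π (V - U) := by fun_prop
    simpa using this.tendsto U
  have hσ : Filter.Tendsto (fun V => σ (π (V - U))) (𝓝 U) (𝓝 U) := by
    have := h2.continuousAt.tendsto
    rw [h0] at this
    exact this.comp hy
  filter_upwards [h, hy.eventually h1, hσ.eventually h,
    (Filter.tendsto_id.prodMk_nhds hσ).eventually hlo] with V a1 a2 a3 a4
  refine ⟨a1, fun hV => ?_⟩
  have b := a3 a2.1
  -- A common zero V of Φ and Ψ and the point of the fourfold with the same tangential coordinate
  -- have the same image under (Φ, Ψ, π).
  have : V = σ (π (V - U)) := by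
    apply a4
    simp only [id, hV.1, hV.2, b.1, b.2]
    have e := a2.2
    rw [map_sub, map_sub, sub_left_inj] at e
    rw [map_sub, e]
  rw [this]
  exact a2.1

end Regular

/-- The second fundamental form of the fourfold vanishes on characteristic directions. -/
def IsRankOneFlat (Ω : Set Jet) (F G : Jet → ℝ) : Prop :=
  ∀ U ∈ fourfold Ω F G, ∀ x y : ℝ, hess F U (tchar F G x y U) (tchar F G x y U) = 0 ∧
    hess G U (tchar F G x y U) (tchar F G x y U) = 0

/-- `minorForm` with one argument fixed, as a continuous linear form. -/
def minorFormL (a : Fin 3 → ℝ) (H : Jet) : Jet →L[ℝ] ℝ :=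
  LinearMap.toContinuousLinearMap
    { toFun := minorForm a H
      map_add' := minorForm_add_right a H
      map_smul' := fun c K => minorForm_smul_right a c H K }

@[simp] lemma minorFormL_apply (a : Fin 3 → ℝ) (H K : Jet) : minorFormL a H K = minorForm a H K :=
  rfl

lemma hasDerivAt_minorForm {a a' : ℝ → Fin 3 → ℝ} {H H' K K' : ℝ → Jet} {s : ℝ}
    (ha : HasDerivAt a (a' s) s) (hH : HasDerivAt H (H' s) s) (hK : HasDerivAt K (K' s) s) :
    HasDerivAt (fun t => minorForm (a t) (H t) (K t))
      (minorForm (a' s) (H s) (K s) + minorForm (a s) (H' s) (K s)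
        + minorForm (a s) (H s) (K' s)) s := by
  have ha := hasDerivAt_pi.mp ha
  have hH := fun b i => hasDerivAt_pi.mp (hasDerivAt_pi.mp hH b) i
  have hK := fun b i => hasDerivAt_pi.mp (hasDerivAt_pi.mp hK b) i
  have t := fun i j k => (ha i).mul (((hH 0 j).mul (hK 1 k)).add ((hK 0 j).mul (hH 1 k)))
  have := ((((((t 0 1 2).sub (t 0 2 1)).add (t 1 2 0)).sub (t 1 0 2)).add (t 2 0 1)).sub (t 2 1 0))
  refine (this.congr_of_eventuallyEq (Filter.Eventually.of_forall fun r => ?_)).congr_deriv ?_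
  · simp [minorForm, cross_apply, dotProduct, Fin.sum_univ_three]; ring
  · simp [minorForm, cross_apply, dotProduct, Fin.sum_univ_three]; ring

/-- The coefficient of `α` in a combination of `α` and `β`. -/
def combLeft (α β θ : Jet →L[ℝ] ℝ) : ℝ :=
  (coef α β θ 0 * coef α β β 1 - coef α β θ 1 * coef α β β 0) / conicDet α β

/-- The coefficient of `β` in a combination of `α` and `β`. -/
def combRight (α β θ : Jet →L[ℝ] ℝ) : ℝ :=
  (coef α β α 0 * coef α β θ 1 - coef α β α 1 * coef α β θ 0) / conicDet α β

/-! ### Osculating combinations of minors and their variation along the fourfold -/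

section Osculation

variable {Ω : Set Jet} {F G K : Jet → ℝ} {U : Jet}

/-- Coefficients of the minors in the osculating combination of minors. -/
def oscCoeff (F G K : Jet → ℝ) (U : Jet) : Fin 3 → ℝ :=
  minorCoeff (fderiv ℝ F U) (fderiv ℝ G U) (hess K U)

/-- The combination of minors that osculates `K` along the fourfold at `U`. -/
def osc (F G K : Jet → ℝ) (U V : Jet) : ℝ :=
  fderiv ℝ K U (V - U) + 1 / 2 * minorForm (oscCoeff F G K U) (V - U) (V - U)

/-- The difference of the Hessians of `K` and of its osculating combination of minors. -/
def hessDev (F G K : Jet → ℝ) (U H : Jet) : Jet →L[ℝ] ℝ :=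
  hess K U H - minorFormL (oscCoeff F G K U) H

/-- The properties of `F` and `G` in which they enter symmetrically. -/
structure IsDefining (Ω : Set Jet) (F G K : Jet → ℝ) : Prop where
  smooth : ∀ U ∈ Ω, ContDiffAt ℝ ∞ K U
  tangent : ∀ U ∈ Ω, ∀ k, fderiv ℝ K U (tframe F G k U) = 0
  flat : ∀ U ∈ fourfold Ω F G, ∀ x y : ℝ, hess K U (tchar F G x y U) (tchar F G x y U) = 0

lemma IsRankOneFlat.left (h : IsRankOneFlat Ω F G) (hR : IsRegular Ω F G) :
    IsDefining Ω F G F :=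
  ⟨fun _ hU => hR.contDiffAt_left hU, fun _ _ _ => apply_frame_left _ _ _,
    fun U hU x y => (h U hU x y).1⟩

lemma IsRankOneFlat.right (h : IsRankOneFlat Ω F G) (hR : IsRegular Ω F G) :
    IsDefining Ω F G G :=
  ⟨fun _ hU => hR.contDiffAt_right hU, fun _ _ _ => apply_frame_right _ _ _,
    fun U hU x y => (h U hU x y).2⟩

lemma IsRegular.exists_tframe_coord (hR : IsRegular Ω F G) (hU : U ∈ fourfold Ω F G) {H : Jet}
    (hα : fderiv ℝ F U H = 0) (hβ : fderiv ℝ G U H = 0) :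
    ∃ c : Fin 4 → ℝ, H = ∑ k, c k • tframe F G k U :=
  exists_frame_coord (hR.conicDet_ne_zero hU) hα hβ

lemma IsDefining.minorForm_oscCoeff (hK : IsDefining Ω F G K) (hR : IsRegular Ω F G)
    (hU : U ∈ fourfold Ω F G) (j k : Fin 4) :
    minorForm (oscCoeff F G K U) (tframe F G j U) (tframe F G k U)
      = hess K U (tframe F G j U) (tframe F G k U) :=
  minorForm_minorCoeff (hR.conicDet_ne_zero hU) (hess_comm (hK.smooth U hU.1)) (hK.flat U hU) j k

lemma minorForm_sum_left (a : Fin 3 → ℝ) (c : Fin 4 → ℝ) (e : Fin 4 → Jet) (K : Jet) :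
    minorForm a (∑ k, c k • e k) K = ∑ k, c k * minorForm a (e k) K := by
  simp only [Fin.sum_univ_four, minorForm_add_left, minorForm_smul_left]

lemma hessDev_tframe (hK : IsDefining Ω F G K) (hR : IsRegular Ω F G)
    (hU : U ∈ fourfold Ω F G) {H : Jet}
    (hα : fderiv ℝ F U H = 0) (hβ : fderiv ℝ G U H = 0) (k : Fin 4) :
    hessDev F G K U H (tframe F G k U) = 0 := by
  obtain ⟨c, rfl⟩ := hR.exists_tframe_coord hU hα hβ
  simp only [hessDev, ContinuousLinearMap.sub_apply, minorFormL_apply, minorForm_sum_left,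
    hK.minorForm_oscCoeff hR hU]
  simp [map_sum, map_smul]

/-- The deviation kills the tangent space, because the osculating minors were fitted to the Hessian
there. It is therefore a conormal vector, and its two coefficients drive the differential equation
for the osculating functions. -/
lemma hessDev_eq (hK : IsDefining Ω F G K) (hR : IsRegular Ω F G)
    (hU : U ∈ fourfold Ω F G) {H : Jet}
    (hα : fderiv ℝ F U H = 0) (hβ : fderiv ℝ G U H = 0) :
    hessDev F G K U H = combLeft (fderiv ℝ F U) (fderiv ℝ G U) (hessDev F G K U H) • fderiv ℝ F U
      + combRight (fderiv ℝ F U) (fderiv ℝ G U) (hessDev F G K U H) • fderiv ℝ G U :=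
  eq_combination (hR.conicDet_ne_zero hU) (hessDev_tframe hK hR hU hα hβ)

lemma IsRegular.tframe_left (k : Fin 4) : fderiv ℝ F U (tframe F G k U) = 0 :=
  apply_frame_left _ _ _

lemma IsRegular.tframe_right (k : Fin 4) : fderiv ℝ G U (tframe F G k U) = 0 :=
  apply_frame_right _ _ _

lemma IsRegular.contDiffAt_tframe (hR : IsRegular Ω F G) (hU : U ∈ Ω) (k : Fin 4) :
    ContDiffAt ℝ ∞ (tframe F G k) U :=
  contDiffAt_frame (contDiffAt_fderiv (hR.contDiffAt_left hU))
    (contDiffAt_fderiv (hR.contDiffAt_right hU)) k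

lemma IsDefining.contDiffAt_oscCoeff (hK : IsDefining Ω F G K) (hR : IsRegular Ω F G)
    (hU : U ∈ fourfold Ω F G) : ContDiffAt ℝ ∞ (oscCoeff F G K) U :=
  contDiffAt_minorCoeff (contDiffAt_fderiv (hR.contDiffAt_left hU.1))
    (contDiffAt_fderiv (hR.contDiffAt_right hU.1))
    (contDiffAt_fderiv (contDiffAt_fderiv (hK.smooth U hU.1))) (hR.conicDet_ne_zero hU)

lemma hasDerivAt_add_smul (U H : Jet) : HasDerivAt (fun s : ℝ => U + s • H) H 0 := by
  simpa using ((hasDerivAt_id (0 : ℝ)).smul_const H).const_add U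

lemma hasDerivAt_comp_line {E : Type*} [NormedAddCommGroup E] [NormedSpace ℝ E] {f : Jet → E}
    (hf : DifferentiableAt ℝ f U) (H : Jet) :
    HasDerivAt (fun s : ℝ => f (U + s • H)) (fderiv ℝ f U H) 0 := by
  have h3 : HasFDerivAt f (fderiv ℝ f U) (U + (0 : ℝ) • H) := by simpa using hf.hasFDerivAt
  exact h3.comp_hasDerivAt (0 : ℝ) (hasDerivAt_add_smul U H)

/-- The derivative along the fourfold of the identity defining `oscCoeff`. -/
lemma IsDefining.third_order (hK : IsDefining Ω F G K) (hR : IsRegular Ω F G)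
    (hU : U ∈ fourfold Ω F G) {H : Jet} (hα : fderiv ℝ F U H = 0) (hβ : fderiv ℝ G U H = 0)
    (j k : Fin 4) :
    fderiv ℝ (hess K) U H (tframe F G j U) (tframe F G k U)
      + hessDev F G K U (tframe F G k U) (fderiv ℝ (tframe F G j) U H)
      + hessDev F G K U (tframe F G j U) (fderiv ℝ (tframe F G k) U H)
      = minorForm (fderiv ℝ (oscCoeff F G K) U H) (tframe F G j U) (tframe F G k U) := by
  have d1 : HasDerivAt (fun s : ℝ => hess K (U + s • H)) (fderiv ℝ (hess K) U H) 0 :=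
    hasDerivAt_comp_line
    ((contDiffAt_fderiv (contDiffAt_fderiv (hK.smooth U hU.1))).differentiableAt (by simp)) H
  have de := fun k => hasDerivAt_comp_line
    ((hR.contDiffAt_tframe hU.1 k).differentiableAt (by simp)) H
  have da := hasDerivAt_comp_line ((hK.contDiffAt_oscCoeff hR hU).differentiableAt (by simp)) H
  have e1 := (d1.clm_apply (de j)).clm_apply (de k)
  have e2 := hasDerivAt_minorForm (a' := fun _ => _) (H' := fun _ => _) (K' := fun _ => _)
    da (de j) (de k)
  have e3 := e1.sub e2
  have hdiff : DifferentiableAt ℝ (fun V => hess K V (tframe F G j V) (tframe F G k V)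
      - minorForm (oscCoeff F G K V) (tframe F G j V) (tframe F G k V)) U := by
    have a1 := fun i => contDiffAt_pi.mp (hK.contDiffAt_oscCoeff hR hU) i
    have a2 := fun k b i =>
      contDiffAt_pi.mp (contDiffAt_pi.mp (hR.contDiffAt_tframe hU.1 k) b) i
    refine ContDiffAt.differentiableAt (n := ∞) ?_ (by simp)
    apply ContDiffAt.sub
    · exact ((contDiffAt_fderiv (contDiffAt_fderiv (hK.smooth U hU.1))).clm_apply
        (hR.contDiffAt_tframe hU.1 j)).clm_apply (hR.contDiffAt_tframe hU.1 k)
    · simp only [minorForm, cross_apply, dotProduct, Fin.sum_univ_three, Pi.add_apply,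
        Matrix.cons_val]
      fun_prop (disch := assumption)
  -- The fitted identity holds on the fourfold only, which is enough for its derivative in the
  -- tangent direction H to vanish.
  have e4 := hR.hasDerivAt_line hU hdiff (Filter.Eventually.of_forall fun V hV => by
    rw [hK.minorForm_oscCoeff hR hV, sub_self]) hα hβ
  have e5 := e3.unique e4
  simp only [zero_smul, add_zero, ContinuousLinearMap.add_apply] at e5
  simp only [hessDev, ContinuousLinearMap.sub_apply, minorFormL_apply]
  rw [minorForm_comm _ (tframe F G k U)] 
  have c1 := hess_comm (hK.smooth U hU.1) (tframe F G k U) (fderiv ℝ (tframe F G j) U H)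
  change (fderiv ℝ (hess K) U H (tframe F G j U) + hess K U (fderiv ℝ (tframe F G j) U H))
    (tframe F G k U) + _ - _ = 0 at e5
  rw [ContinuousLinearMap.add_apply] at e5
  linarith

/-- The frame is tangent to the level sets of `F` and `G`. -/
lemma IsDefining.fderiv_tframe (hK : IsDefining Ω F G K) (hR : IsRegular Ω F G)
    (hU : U ∈ Ω) (H : Jet) (k : Fin 4) :
    fderiv ℝ K U (fderiv ℝ (tframe F G k) U H) = - hess K U H (tframe F G k U) := by
  have d1 := hasDerivAt_comp_line
    ((contDiffAt_fderiv (hK.smooth U hU)).differentiableAt (by simp)) H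
  have de := hasDerivAt_comp_line ((hR.contDiffAt_tframe hU k).differentiableAt (by simp)) H
  have e1 := d1.clm_apply de
  have hz : (fun s : ℝ => fderiv ℝ K (U + s • H) (tframe F G k (U + s • H)))
      =ᶠ[𝓝 0] fun _ => 0 := by
    have : ∀ᶠ s : ℝ in 𝓝 0, U + s • H ∈ Ω :=
      (hasDerivAt_add_smul U H).continuousAt.eventually
        (by simpa using hR.isOpen.mem_nhds hU)
    filter_upwards [this] with s hs using hK.tangent _ hs k
  have e2 := e1.unique ((hasDerivAt_const (0 : ℝ) (0 : ℝ)).congr_of_eventuallyEq hz)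
  simp only [zero_smul, add_zero] at e2
  change hess K U H (tframe F G k U) + _ = 0 at e2
  linarith

lemma fderiv_hess_comm (hK : ∀ᶠ V in 𝓝 U, ContDiffAt ℝ ∞ K V) (H₁ H₂ H₃ : Jet) :
    fderiv ℝ (hess K) U H₁ H₂ H₃ = fderiv ℝ (hess K) U H₁ H₃ H₂ := by
  have hd : DifferentiableAt ℝ (hess K) U :=
    (contDiffAt_fderiv (contDiffAt_fderiv hK.self_of_nhds)).differentiableAt (by simp)
  have d := hasDerivAt_comp_line (E := Jet →L[ℝ] Jet →L[ℝ] ℝ) hd H₁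
  have d1 := (d.clm_apply (hasDerivAt_const (0 : ℝ) H₂)).clm_apply (hasDerivAt_const (0 : ℝ) H₃)
  have d2 := (d.clm_apply (hasDerivAt_const (0 : ℝ) H₃)).clm_apply (hasDerivAt_const (0 : ℝ) H₂)
  have hz : (fun s : ℝ => hess K (U + s • H₁) H₂ H₃)
      =ᶠ[𝓝 0] fun s : ℝ => hess K (U + s • H₁) H₃ H₂ := by
    have := (hasDerivAt_add_smul U H₁).continuousAt.eventually (by simpa using hK)
    filter_upwards [this] with s hs using hess_comm hs _ _
  have := d1.unique (d2.congr_of_eventuallyEq hz)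
  simpa using this

lemma fderiv_hess_comm' (hK : ContDiffAt ℝ ∞ K U) (H₁ H₂ : Jet) :
    fderiv ℝ (hess K) U H₁ H₂ = fderiv ℝ (hess K) U H₂ H₁ :=
  ((contDiffAt_fderiv hK).isSymmSndFDerivAt (by
    simp only [minSmoothness_of_isRCLikeNormedField]
    exact WithTop.coe_le_coe.mpr (le_top : (2 : ℕ∞) ≤ ⊤))).eq H₁ H₂

/-- The osculating combination of minors varies in its own span along the fourfold. -/
lemma IsDefining.fderiv_oscCoeff (hK : IsDefining Ω F G K) (hR : IsRegular Ω F G)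
    (h : IsRankOneFlat Ω F G) (hU : U ∈ fourfold Ω F G) {H : Jet}
    (hα : fderiv ℝ F U H = 0) (hβ : fderiv ℝ G U H = 0) :
    fderiv ℝ (oscCoeff F G K) U H
      = combLeft (fderiv ℝ F U) (fderiv ℝ G U) (hessDev F G K U H) • oscCoeff F G F U
      + combRight (fderiv ℝ F U) (fderiv ℝ G U) (hessDev F G K U H) • oscCoeff F G G U := by
  set e := fun k => tframe F G k U with he
  set P := fun H => combLeft (fderiv ℝ F U) (fderiv ℝ G U) (hessDev F G K U H) with hP
  set Q := fun H => combRight (fderiv ℝ F U) (fderiv ℝ G U) (hessDev F G K U H) with hQ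
  have hdev : ∀ k H', hessDev F G K U (e k) H'
      = P (e k) * fderiv ℝ F U H' + Q (e k) * fderiv ℝ G U H' := by
    intro k H'
    conv_lhs => rw [hessDev_eq hK hR hU (IsRegular.tframe_left k) (IsRegular.tframe_right k)]
    simp [P, Q, e]
  have hF := h.left hR
  have hG := h.right hR
  have third : ∀ H', fderiv ℝ F U H' = 0 → fderiv ℝ G U H' = 0 → ∀ j k,
      minorForm (fderiv ℝ (oscCoeff F G K) U H') (e j) (e k)
        = fderiv ℝ (hess K) U H' (e j) (e k)
          - (P (e k) * hess F U H' (e j) + Q (e k) * hess G U H' (e j))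
          - (P (e j) * hess F U H' (e k) + Q (e j) * hess G U H' (e k)) := by
    intro H' h1 h2 j k
    have := hK.third_order hR hU h1 h2 j k
    rw [hdev, hdev, hF.fderiv_tframe hR hU.1, hG.fderiv_tframe hR hU.1,
      hF.fderiv_tframe hR hU.1, hG.fderiv_tframe hR hU.1] at this
    rw [← this]
    ring
  -- By its definition, for fixed i this is a combination of quadrics through the twisted cubic. By
  -- `c_eq` it is a third derivative minus a sum symmetrised over the three indices, hence totally
  -- symmetric. The two facts together force it to vanish.
  let c : Fin 4 → Fin 4 → Fin 4 → ℝ := fun i j k =>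
    minorForm (fderiv ℝ (oscCoeff F G K) U (e i)) (e j) (e k)
      - P (e i) * hess F U (e j) (e k) - Q (e i) * hess G U (e j) (e k)
  have c_eq : ∀ i j k, c i j k = fderiv ℝ (hess K) U (e i) (e j) (e k)
          - (P (e k) * hess F U (e i) (e j) + Q (e k) * hess G U (e i) (e j))
          - (P (e j) * hess F U (e i) (e k) + Q (e j) * hess G U (e i) (e k))
          - (P (e i) * hess F U (e j) (e k) + Q (e i) * hess G U (e j) (e k)) := by
    intro i j k
    simp only [c]
    rw [third (e i) (IsRegular.tframe_left i) (IsRegular.tframe_right i)]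
    ring
  have hKe : ∀ᶠ V in 𝓝 U, ContDiffAt ℝ ∞ K V := by
    filter_upwards [hR.isOpen.mem_nhds hU.1] with V hV using hK.smooth V hV
  have cF := hess_comm (hF.smooth U hU.1)
  have cG := hess_comm (hG.smooth U hU.1)
  have hc : ∀ i j k, c i j k = 0 := by
    apply VanishesOnCubic.trilinear_eq_zero
    · intro i
      apply vanishesOnCubic_of_bilin (α := fderiv ℝ F U) (β := fderiv ℝ G U)
        (B := fun H K' => minorForm (fderiv ℝ (oscCoeff F G K) U (e i)) H K'
          - P (e i) * hess F U H K' - Q (e i) * hess G U H K')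
      · intro H K'
        rw [minorForm_comm, cF, cG]
      · intro H K' K''
        rw [minorForm_add_right, map_add, map_add]; ring
      · intro r H K'
        rw [minorForm_smul_right, map_smul, map_smul, smul_eq_mul, smul_eq_mul]; ring
      · intro x y
        have := h U hU x y
        rw [tchar] at this
        rw [minorForm_charDir, this.1, this.2]
        simp
    · intro i j k
      rw [c_eq, c_eq, fderiv_hess_comm hKe, cF (e j) (e k), cG (e j) (e k)]
      ring
    · intro i j k
      rw [c_eq, c_eq, fderiv_hess_comm' hKe.self_of_nhds (e i) (e j), cF (e j) (e i),
        cG (e j) (e i)]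
      ring
  have basis : ∀ i, fderiv ℝ (oscCoeff F G K) U (e i)
      = P (e i) • oscCoeff F G F U + Q (e i) • oscCoeff F G G U := by
    intro i
    rw [← sub_eq_zero]
    apply minorForm_injective (hR.conicDet_ne_zero hU)
    intro j k
    have h1 := hF.minorForm_oscCoeff hR hU j k
    have h2 := hG.minorForm_oscCoeff hR hU j k
    have h3 := hc i j k
    simp only [c] at h3
    rw [sub_eq_add_neg, ← neg_one_smul ℝ (_ + _), minorForm_add_coeff, minorForm_smul_coeff,
      minorForm_add_coeff, minorForm_smul_coeff, minorForm_smul_coeff]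
    simp only [tframe] at h1 h2
    rw [h1, h2]
    simp only [e, tframe] at h3 ⊢
    linarith
  -- The relation is now known on the frame; both coefficients are linear in the direction, so it
  -- extends to every tangent vector.
  obtain ⟨w, rfl⟩ := hR.exists_tframe_coord hU hα hβ
  have hdl : hessDev F G K U (∑ k, w k • tframe F G k U) = ∑ k, w k • hessDev F G K U (e k) := by
    ext H'
    simp only [hessDev, ContinuousLinearMap.sub_apply, minorFormL_apply, minorForm_sum_left,
      map_sum, map_smul, ContinuousLinearMap.sum_apply, ContinuousLinearMap.smul_apply]
    simp only [Fin.sum_univ_four, smul_eq_mul, e]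
    ring
  have hPl : P (∑ k, w k • tframe F G k U) = ∑ k, w k * P (e k) := by
    simp only [P]
    rw [hdl]
    simp only [combLeft, coef, row, Fin.sum_univ_four, ContinuousLinearMap.add_apply,
      ContinuousLinearMap.smul_apply, dotProduct, Fin.sum_univ_three, smul_eq_mul]
    ring
  have hQl : Q (∑ k, w k • tframe F G k U) = ∑ k, w k * Q (e k) := by
    simp only [Q]
    rw [hdl]
    simp only [combRight, coef, row, Fin.sum_univ_four, ContinuousLinearMap.add_apply,
      ContinuousLinearMap.smul_apply, dotProduct, Fin.sum_univ_three, smul_eq_mul]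
    ring
  change _ = P _ • _ + Q _ • _
  rw [hPl, hQl, map_sum]
  simp only [map_smul]
  have basis' : ∀ i, fderiv ℝ (oscCoeff F G K) U (tframe F G i U)
      = P (e i) • oscCoeff F G F U + Q (e i) • oscCoeff F G G U := basis
  simp only [basis', Fin.sum_univ_four]
  module

end Osculation

/-! ## Combinations of minors -/

section Minors

variable {Ω : Set Jet} {F G K : Jet → ℝ} {U : Jet}

lemma isMinorCombination_of_taylor {Φ : Jet → ℝ} (a : Fin 3 → ℝ) (l : Jet →L[ℝ] ℝ) (U : Jet)
    (m : ℝ) (h : ∀ V, Φ V = m + l (V - U) + 1 / 2 * minorForm a (V - U) (V - U)) :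
    IsMinorCombination Φ := by
  let l' : Jet →L[ℝ] ℝ := l - minorFormL a U
  -- One entry for each of the index pairs (0,1), (1,2), (2,0), which carry the components of the
  -- cross product of the two rows.
  refine ⟨!![0, a 2, 0; 0, 0, a 0; a 1, 0, 0], row l' 0, row l' 1,
    m - l U + 1 / 2 * minorForm a U U, fun V => ?_⟩
  have e : V - U = V + (-1 : ℝ) • U := by simp [sub_eq_add_neg]
  have h1 : l' V = ∑ i, row l' 0 i * V 0 i + ∑ i, row l' 1 i * V 1 i := by
    rw [apply_eq_row]; simp [Fin.sum_univ_three]; ring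
  rw [h V, map_sub, e]
  simp only [minorForm_add_right, minorForm_add_left, minorForm_smul_left, minorForm_smul_right]
  rw [add_assoc (∑ i, ∑ j, _), ← h1]
  simp only [l', ContinuousLinearMap.sub_apply, minorFormL_apply]
  rw [minorForm_comm a V U]
  have h2 : minorForm a V V = 2 * ∑ i, ∑ j, !![0, a 2, 0; 0, 0, a 0; a 1, 0, 0] i j
      * (V 0 i * V 1 j - V 0 j * V 1 i) := by
    simp [minorForm, cross_apply, dotProduct, Fin.sum_univ_three]; ring
  rw [h2]
  ring

lemma hasStrictFDerivAt_taylor (a : Fin 3 → ℝ) (l : Jet →L[ℝ] ℝ) (U : Jet) (m : ℝ) (W : Jet) :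
    HasStrictFDerivAt (fun V => m + l (V - U) + 1 / 2 * minorForm a (V - U) (V - U))
      (l + minorFormL a (W - U)) W := by
  have hs : ContDiff ℝ ∞ fun V : Jet => m + l (V - U) + 1 / 2 * minorForm a (V - U) (V - U) := by
    simp only [minorForm, cross_apply, dotProduct, Fin.sum_univ_three, Pi.add_apply,
      Matrix.cons_val]
    fun_prop
  have h1 := hs.contDiffAt.hasStrictFDerivAt (x := W) (by simp)
  suffices e : l + minorFormL a (W - U) = fderiv ℝ
      (fun V : Jet => m + l (V - U) + 1 / 2 * minorForm a (V - U) (V - U)) W by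
    rw [e]; exact h1
  refine ContinuousLinearMap.ext fun H => ?_
  have d := hasDerivAt_comp_line h1.hasFDerivAt.differentiableAt H
  have dl := ((hasDerivAt_add_smul W H).sub_const U)
  have d2 := (((hasDerivAt_const (0 : ℝ) m).add
    (l.hasFDerivAt.comp_hasDerivAt (0 : ℝ) dl)).add
    ((hasDerivAt_minorForm (a' := fun _ => _) (H' := fun _ => _) (K' := fun _ => _)
      (hasDerivAt_const (0 : ℝ) a) dl dl).const_mul (1 / 2)))
  have := d.unique d2
  rw [this]
  have e0 : minorForm 0 (W - U) (W - U) = 0 := by simp [minorForm]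
  simp only [zero_smul, add_zero, ContinuousLinearMap.add_apply, minorFormL_apply, zero_add, e0]
  rw [minorForm_comm a H]
  ring

/-- Taylor's formula for a combination of minors. -/
lemma IsMinorCombination.exists_taylor {Φ : Jet → ℝ} (h : IsMinorCombination Φ) :
    ∃ a : Fin 3 → ℝ, ∀ U, ∃ l : Jet →L[ℝ] ℝ,
      ∀ V, Φ V = Φ U + l (V - U) + 1 / 2 * minorForm a (V - U) (V - U) := by
  obtain ⟨A, b, c, m, h⟩ := h
  let a : Fin 3 → ℝ := ![A 1 2 - A 2 1, A 2 0 - A 0 2, A 0 1 - A 1 0]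
  let l₀ : Jet →L[ℝ] ℝ := LinearMap.toContinuousLinearMap
    { toFun := fun V => ∑ i, b i * V 0 i + ∑ i, c i * V 1 i
      map_add' := by intro V W; simp [Fin.sum_univ_three]; ring
      map_smul' := by intro r V; simp [Fin.sum_univ_three]; ring }
  have hl : ∀ V, l₀ V = ∑ i, b i * V 0 i + ∑ i, c i * V 1 i := fun _ => rfl
  refine ⟨a, fun U => ⟨l₀ + minorFormL a U, fun V => ?_⟩⟩
  rw [ContinuousLinearMap.add_apply, hl, h, h]
  simp [minorForm, cross_apply, dotProduct, Fin.sum_univ_three, a]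
  ring

lemma IsMinorCombination.contDiff {Φ : Jet → ℝ} (h : IsMinorCombination Φ) : ContDiff ℝ ∞ Φ := by
  obtain ⟨A, b, c, m, h⟩ := h
  rw [funext h]
  fun_prop

lemma IsMinorCombination.taylor {Φ : Jet → ℝ} (h : IsMinorCombination Φ) :
    ∃ a : Fin 3 → ℝ, ∀ U V, Φ V = Φ U + fderiv ℝ Φ U (V - U)
      + 1 / 2 * minorForm a (V - U) (V - U) := by
  obtain ⟨a, ha⟩ := h.exists_taylor
  refine ⟨a, fun U V => ?_⟩
  obtain ⟨l, hl⟩ := ha U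
  have h1 := hasStrictFDerivAt_taylor a l U (Φ U) U
  rw [← funext hl] at h1
  rw [h1.hasFDerivAt.fderiv, hl V]
  simp [minorForm]

lemma IsMinorCombination.comb {Φ Ψ : Jet → ℝ} (hΦ : IsMinorCombination Φ)
    (hΨ : IsMinorCombination Ψ) (p q : ℝ) : IsMinorCombination (p • Φ + q • Ψ) := by
  obtain ⟨a, b, c, m, h⟩ := hΦ
  obtain ⟨a', b', c', m', h'⟩ := hΨ
  refine ⟨p • a + q • a', p • b + q • b', p • c + q • c', p * m + q * m', fun U => ?_⟩
  simp [h, h', Fin.sum_univ_three]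
  ring

lemma isMinorCombination_osc : IsMinorCombination (osc F G K U) :=
  isMinorCombination_of_taylor (oscCoeff F G K U) (fderiv ℝ K U) U 0 fun V => by
    simp [osc]

lemma hasStrictFDerivAt_osc : HasStrictFDerivAt (osc F G K U) (fderiv ℝ K U) U := by
  have h := hasStrictFDerivAt_taylor (oscCoeff F G K U) (fderiv ℝ K U) U 0 U
  have e1 : osc F G K U = fun V => 0 + fderiv ℝ K U (V - U)
      + 1 / 2 * minorForm (oscCoeff F G K U) (V - U) (V - U) := by
    ext V; simp [osc]
  have e2 : fderiv ℝ K U + minorFormL (oscCoeff F G K U) (U - U) = fderiv ℝ K U := by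
    refine ContinuousLinearMap.ext fun H => ?_
    simp [minorForm]
  rw [e1]
  rwa [e2] at h

/-- A combination of minors that vanishes on the fourfold to second order is zero. -/
lemma IsMinorCombination.eq_zero {Φ : Jet → ℝ} (h : IsMinorCombination Φ) (hR : IsRegular Ω F G)
    (hU : U ∈ fourfold Ω F G) (hv : ∀ᶠ V in 𝓝 U, V ∈ fourfold Ω F G → Φ V = 0)
    (hd : fderiv ℝ Φ U = 0) : Φ = 0 := by
  obtain ⟨a, ha⟩ := h.taylor
  have h0 : Φ U = 0 := hv.self_of_nhds hU
  have hΦ : ∀ V, Φ V = 0 + (0 : Jet →L[ℝ] ℝ) (V - U) + 1 / 2 * minorForm a (V - U) (V - U) := by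
    intro V; rw [ha U V, h0, hd]
  have h1 : ∀ W, fderiv ℝ Φ W = minorFormL a (W - U) := by
    intro W
    have := hasStrictFDerivAt_taylor a 0 U 0 W
    rw [← funext hΦ, zero_add] at this
    exact this.hasFDerivAt.fderiv
  -- Near U the differential of Φ at W is `minorForm a (W - U)`, and it kills the tangent space at
  -- W. A further derivative at U shows that the minors with coefficients a vanish on the tangent
  -- space, so that a = 0.
  have h2 : ∀ k, ∀ᶠ W in 𝓝 U, W ∈ fourfold Ω F G → minorForm a (W - U) (tframe F G k W) = 0 := by
    intro k
    filter_upwards [hv.eventually_nhds] with W hW hWX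
    have := hR.fderiv_eq_zero hWX (h.contDiff.differentiable (by simp) W).hasFDerivAt hW
      (IsRegular.tframe_left k) (IsRegular.tframe_right k)
    rwa [h1] at this
  have h3 : a = 0 := by
    apply minorForm_injective (hR.conicDet_ne_zero hU)
    intro j k
    have hk := (hR.contDiffAt_tframe hU.1 k).differentiableAt (by simp)
    have hdiff : DifferentiableAt ℝ (fun W => minorForm a (W - U) (tframe F G k W)) U := by
      have a2 := fun b i => differentiableAt_pi.mp (differentiableAt_pi.mp hk b) i
      simp only [minorForm, cross_apply, dotProduct, Fin.sum_univ_three, Pi.add_apply,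
        Matrix.cons_val]
      fun_prop (disch := assumption)
    have d1 := hR.hasDerivAt_line hU hdiff (h2 k) (H := tframe F G j U)
      (IsRegular.tframe_left j) (IsRegular.tframe_right j)
    have d2 := hasDerivAt_minorForm (a' := fun _ => _) (H' := fun _ => _) (K' := fun _ => _)
      (hasDerivAt_const (0 : ℝ) a) ((hasDerivAt_add_smul U (tframe F G j U)).sub_const U)
      (hasDerivAt_comp_line hk (tframe F G j U))
    have := d2.unique d1
    simp only [zero_smul, add_zero, sub_self] at this
    have e0 : ∀ H, minorForm 0 0 H = 0 := by simp [minorForm]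
    have e1 : ∀ H, minorForm a 0 H = 0 := by simp [minorForm]
    rw [e0, e1, zero_add, add_zero] at this
    exact this
  ext V
  rw [hΦ V, h3]
  simp [minorForm]

lemma IsRegular.fderiv_comb (hR : IsRegular Ω F G) (hU : U ∈ fourfold Ω F G) {Φ : Jet → ℝ}
    (hΦ : DifferentiableAt ℝ Φ U) (hv : ∀ᶠ V in 𝓝 U, V ∈ fourfold Ω F G → Φ V = 0) :
    ∃ p q : ℝ, fderiv ℝ Φ U = p • fderiv ℝ F U + q • fderiv ℝ G U :=
  ⟨_, _, eq_combination (hR.conicDet_ne_zero hU) fun k =>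
    hR.fderiv_eq_zero hU hΦ.hasFDerivAt hv (IsRegular.tframe_left k) (IsRegular.tframe_right k)⟩

lemma fderiv_comb_fun {Φ Ψ : Jet → ℝ} (hΦ : DifferentiableAt ℝ Φ U)
    (hΨ : DifferentiableAt ℝ Ψ U) (p q : ℝ) :
    fderiv ℝ (p • Φ + q • Ψ) U = p • fderiv ℝ Φ U + q • fderiv ℝ Ψ U :=
  ((hΦ.hasFDerivAt.const_smul p).add (hΨ.hasFDerivAt.const_smul q)).fderiv

/-- Normalisation of a pair of combinations of minors that vanish on the fourfold. -/
lemma IsRegular.exists_normalised (hR : IsRegular Ω F G) (hU : U ∈ fourfold Ω F G)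
    {Φ Ψ : Jet → ℝ} (hΦ : IsMinorCombination Φ) (hΨ : IsMinorCombination Ψ)
    (hli : LinearIndependent ℝ ![Φ, Ψ])
    (hv : ∀ᶠ V in 𝓝 U, V ∈ fourfold Ω F G → Φ V = 0 ∧ Ψ V = 0) :
    ∃ a b c d : ℝ, a * d - b * c ≠ 0 ∧ fderiv ℝ (a • Φ + b • Ψ) U = fderiv ℝ F U ∧
      fderiv ℝ (c • Φ + d • Ψ) U = fderiv ℝ G U := by
  have dΦ := hΦ.contDiff.differentiable (by simp) U
  have dΨ := hΨ.contDiff.differentiable (by simp) U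
  obtain ⟨p₁, q₁, h1⟩ := hR.fderiv_comb hU dΦ (hv.mono fun V h hV => (h hV).1)
  obtain ⟨p₂, q₂, h2⟩ := hR.fderiv_comb hU dΨ (hv.mono fun V h hV => (h hV).2)
  -- By `IsMinorCombination.eq_zero` no non-trivial combination of Φ and Ψ has zero differential at
  -- U. The matrix expressing their differentials through those of F and G is therefore invertible.
  have hz : ∀ x y : ℝ, x * p₁ + y * p₂ = 0 → x * q₁ + y * q₂ = 0 → x = 0 ∧ y = 0 := by
    intro x y e1 e2
    have : x • Φ + y • Ψ = 0 := by
      apply (hΦ.comb hΨ x y).eq_zero hR hU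
      · filter_upwards [hv] with V h hV
        simp [h hV]
      · rw [fderiv_comb_fun dΦ dΨ, h1, h2]
        calc _ = (x * p₁ + y * p₂) • fderiv ℝ F U + (x * q₁ + y * q₂) • fderiv ℝ G U := by module
          _ = 0 := by rw [e1, e2]; simp
    exact LinearIndependent.pair_iff.mp hli x y this
  have hD : p₁ * q₂ - p₂ * q₁ ≠ 0 := by
    intro h0
    have e1 := hz q₂ (-q₁) (by linarith) (by ring)
    have e2 := hz p₂ (-p₁) (by ring) (by linarith)
    have e3 := hz 1 0 (by linarith) (by linarith)
    exact one_ne_zero e3.1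
  set D := p₁ * q₂ - p₂ * q₁ with hDdef
  refine ⟨q₂ / D, - q₁ / D, - p₂ / D, p₁ / D, ?_, ?_, ?_⟩
  · have : q₂ / D * (p₁ / D) - -q₁ / D * (-p₂ / D) = 1 / D := by
      field_simp; rw [hDdef]; ring
    rw [this]
    positivity
  · rw [fderiv_comb_fun dΦ dΨ, h1, h2]
    calc _ = ((p₁ * q₂ - p₂ * q₁) / D) • fderiv ℝ F U := by module
      _ = _ := by rw [← hDdef, div_self hD, one_smul]
  · rw [fderiv_comb_fun dΦ dΨ, h1, h2]
    calc _ = ((p₁ * q₂ - p₂ * q₁) / D) • fderiv ℝ G U := by module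
      _ = _ := by rw [← hDdef, div_self hD, one_smul]

/-- Combinations of minors vanishing on the fourfold form a two-dimensional space. -/
lemma IsRegular.mem_span (hR : IsRegular Ω F G) (hU : U ∈ fourfold Ω F G)
    {Φ Ψ Θ : Jet → ℝ} (hΦ : IsMinorCombination Φ) (hΨ : IsMinorCombination Ψ)
    (hΘ : IsMinorCombination Θ) (hli : LinearIndependent ℝ ![Φ, Ψ])
    (hv : ∀ᶠ V in 𝓝 U, V ∈ fourfold Ω F G → Φ V = 0 ∧ Ψ V = 0)
    (hv' : ∀ᶠ V in 𝓝 U, V ∈ fourfold Ω F G → Θ V = 0) : ∃ p q : ℝ, Θ = p • Φ + q • Ψ := by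
  obtain ⟨a, b, c, d, -, h1, h2⟩ := hR.exists_normalised hU hΦ hΨ hli hv
  obtain ⟨p, q, h3⟩ := hR.fderiv_comb hU (hΘ.contDiff.differentiable (by simp) U) hv'
  refine ⟨p * a + q * c, p * b + q * d, ?_⟩
  have dΦ := hΦ.contDiff.differentiable (by simp) U
  have dΨ := hΨ.contDiff.differentiable (by simp) U
  have hc := hΦ.comb hΨ (p * a + q * c) (p * b + q * d)
  have h4 := (hΘ.comb hc 1 (-1)).eq_zero hR hU
    (by filter_upwards [hv, hv'] with V e1 e2 hV; simp [e1 hV, e2 hV])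
    (by
      rw [fderiv_comb_fun (hΘ.contDiff.differentiable (by simp) U)
        (hc.contDiff.differentiable (by simp) U), fderiv_comb_fun dΦ dΨ, h3, ← h1, ← h2,
        fderiv_comb_fun dΦ dΨ, fderiv_comb_fun dΦ dΨ]
      module)
  rw [one_smul, neg_one_smul, ← sub_eq_add_neg, sub_eq_zero] at h4
  exact h4

lemma linearIndependent_of_fderiv {Φ Ψ : Jet → ℝ} (hR : IsRegular Ω F G)
    (hU : U ∈ fourfold Ω F G) (hΦ : HasFDerivAt Φ (fderiv ℝ F U) U)
    (hΨ : HasFDerivAt Ψ (fderiv ℝ G U) U) : LinearIndependent ℝ ![Φ, Ψ] := by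
  rw [LinearIndependent.pair_iff]
  intro s t hst
  have h1 := (hΦ.const_smul s).add (hΨ.const_smul t)
  have h2 : HasFDerivAt (s • Φ + t • Ψ) (0 : Jet →L[ℝ] ℝ) U := by
    rw [hst]; exact hasFDerivAt_const _ _
  have h3 := h1.unique h2
  obtain ⟨H, e1, e2⟩ := exists_dual (hR.conicDet_ne_zero hU) 1 0
  obtain ⟨H', e1', e2'⟩ := exists_dual (hR.conicDet_ne_zero hU) 0 1
  constructor
  · simpa [e1, e2] using congrArg (fun g => g H) h3
  · simpa [e1', e2'] using congrArg (fun g => g H') h3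

end Minors

/-! ## Vanishing second fundamental form implies the Monge–Ampère property -/

section

variable {Ω : Set Jet} {F G K : Jet → ℝ} {U : Jet}

/-- The derivative of `osc F G K (γ s) V` with respect to `s`, for a curve in the fourfold. -/
lemma IsDefining.hasDerivAt_osc (hK : IsDefining Ω F G K) (hR : IsRegular Ω F G)
    (h : IsRankOneFlat Ω F G) {γ γ' : ℝ → Jet} {s : ℝ} (hγ : HasDerivAt γ (γ' s) s)
    (hX : γ s ∈ fourfold Ω F G) (hα : fderiv ℝ F (γ s) (γ' s) = 0)
    (hβ : fderiv ℝ G (γ s) (γ' s) = 0) (V : Jet) :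
    HasDerivAt (fun t => osc F G K (γ t) V)
      (combLeft (fderiv ℝ F (γ s)) (fderiv ℝ G (γ s)) (hessDev F G K (γ s) (γ' s))
          * osc F G F (γ s) V
        + combRight (fderiv ℝ F (γ s)) (fderiv ℝ G (γ s)) (hessDev F G K (γ s) (γ' s))
          * osc F G G (γ s) V) s := by
  have d1 : HasDerivAt (fun t => fderiv ℝ K (γ t)) (hess K (γ s) (γ' s)) s :=
    ((contDiffAt_fderiv (hK.smooth _ hX.1)).differentiableAt
      (by simp)).hasFDerivAt.comp_hasDerivAt s hγ
  have d2 : HasDerivAt (fun t => oscCoeff F G K (γ t))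
      (fderiv ℝ (oscCoeff F G K) (γ s) (γ' s)) s :=
    ((hK.contDiffAt_oscCoeff hR hX).differentiableAt
      (by simp)).hasFDerivAt.comp_hasDerivAt s hγ
  have d3 : HasDerivAt (fun t => V - γ t) (- γ' s) s := by simpa using hγ.const_sub V
  have d4 := (d1.clm_apply d3).add ((hasDerivAt_minorForm (a' := fun _ => _) (H' := fun _ => _)
    (K' := fun _ => _) d2 d3 d3).const_mul (1 / 2))
  refine d4.congr_deriv ?_
  have e1 : fderiv ℝ K (γ s) (γ' s) = 0 := by
    obtain ⟨c, hc⟩ := hR.exists_tframe_coord hX hα hβ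
    rw [hc, map_sum]
    simp [hK.tangent _ hX.1]
  have e2 := congrArg (fun θ => θ (V - γ s)) (hessDev_eq hK hR hX hα hβ)
  simp only [ContinuousLinearMap.add_apply, ContinuousLinearMap.smul_apply, smul_eq_mul] at e2
  have e3 : hess K (γ s) (γ' s) (V - γ s) = hessDev F G K (γ s) (γ' s) (V - γ s)
      + minorForm (oscCoeff F G K (γ s)) (γ' s) (V - γ s) := by
    simp [hessDev]
  have e4 : - γ' s = (-1 : ℝ) • γ' s := by simp
  -- The minor part of the Hessian cancels the derivative of the quadratic factor V - γ. The
  -- conormal part and the variation of the coefficients have the same two multipliers, and combine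
  -- into the osculating functions of F and G.
  rw [hK.fderiv_oscCoeff hR h hX hα hβ, map_neg, e1, e3, e2]
  simp only [osc, minorForm_add_coeff, minorForm_smul_coeff, e4, minorForm_smul_left,
    minorForm_smul_right]
  rw [minorForm_comm _ (V - γ s) (γ' s)]
  ring

/-- This bounds the coefficients of the linear differential equation on a compact interval, as
Grönwall's inequality requires. -/
lemma continuousOn_comb_hessDev (hK : IsDefining Ω F G K) (hR : IsRegular Ω F G)
    {γ γ' : ℝ → Jet} {S : Set ℝ} (hγ : ContinuousOn γ S) (hγ' : ContinuousOn γ' S)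
    (hX : ∀ s ∈ S, γ s ∈ fourfold Ω F G) :
    ContinuousOn (fun s => combLeft (fderiv ℝ F (γ s)) (fderiv ℝ G (γ s))
      (hessDev F G K (γ s) (γ' s))) S ∧
    ContinuousOn (fun s => combRight (fderiv ℝ F (γ s)) (fderiv ℝ G (γ s))
      (hessDev F G K (γ s) (γ' s))) S := by
  have c1 : ∀ {E : Type} [TopologicalSpace E] (f : Jet → E),
      (∀ s ∈ S, ContinuousAt f (γ s)) → ContinuousOn (fun s => f (γ s)) S := by
    intro E _ f hf s hs
    exact (hf s hs).comp_continuousWithinAt (hγ s hs)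
  have cα := c1 (fderiv ℝ F) fun s hs =>
    (contDiffAt_fderiv (hR.contDiffAt_left (hX s hs).1)).continuousAt
  have cβ := c1 (fderiv ℝ G) fun s hs =>
    (contDiffAt_fderiv (hR.contDiffAt_right (hX s hs).1)).continuousAt
  have cH := c1 (hess K) fun s hs =>
    (contDiffAt_fderiv (contDiffAt_fderiv (hK.smooth _ (hX s hs).1))).continuousAt
  have ca := c1 (oscCoeff F G K) fun s hs => (hK.contDiffAt_oscCoeff hR (hX s hs)).continuousAt
  have cc : ∀ k, ContinuousOn (fun s => conic (fderiv ℝ F (γ s)) (fderiv ℝ G (γ s)) k) S := by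
    intro k
    refine c1 (fun U => conic (fderiv ℝ F U) (fderiv ℝ G U) k) fun s hs => ?_
    exact (contDiffAt_conic (contDiffAt_fderiv (hR.contDiffAt_left (hX s hs).1))
      (contDiffAt_fderiv (hR.contDiffAt_right (hX s hs).1)) k).continuousAt
  have cd : ContinuousOn (fun s => conicDet (fderiv ℝ F (γ s)) (fderiv ℝ G (γ s))) S := by
    refine c1 (fun U => conicDet (fderiv ℝ F U) (fderiv ℝ G U)) fun s hs => ?_
    exact (contDiffAt_conicDet (contDiffAt_fderiv (hR.contDiffAt_left (hX s hs).1))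
      (contDiffAt_fderiv (hR.contDiffAt_right (hX s hs).1))).continuousAt
  have cdev : ∀ H, ContinuousOn (fun s => hessDev F G K (γ s) (γ' s) H) S := by
    intro H
    have e : (fun s => hessDev F G K (γ s) (γ' s) H) = fun s => hess K (γ s) (γ' s) H
        - minorForm (oscCoeff F G K (γ s)) (γ' s) H := by
      ext s; simp [hessDev]
    rw [e]
    have ca' := fun i => continuousOn_pi.mp ca i
    have cg := fun b i => continuousOn_pi.mp (continuousOn_pi.mp hγ' b) i
    refine ((cH.clm_apply hγ').clm_apply continuousOn_const).sub ?_
    simp only [minorForm, cross_apply, dotProduct, Fin.sum_univ_three, Pi.add_apply,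
      Matrix.cons_val]
    fun_prop (disch := assumption)
  have crow : ∀ (α : ℝ → Jet →L[ℝ] ℝ), (∀ H, ContinuousOn (fun s => α s H) S) → ∀ k,
      ContinuousOn (fun s => coef (fderiv ℝ F (γ s)) (fderiv ℝ G (γ s)) (α s) k) S := by
    intro α hα k
    simp only [coef, dotProduct, Fin.sum_univ_three, row]
    have := fun i => continuousOn_pi.mp (cc k.succ) i
    exact (((hα _).mul (this 0)).add ((hα _).mul (this 1))).add ((hα _).mul (this 2))
  have hne : ∀ s ∈ S, conicDet (fderiv ℝ F (γ s)) (fderiv ℝ G (γ s)) ≠ 0 := fun s hs =>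
    hR.conicDet_ne_zero (hX s hs)
  have k1 := crow _ cdev
  have k2 := crow _ fun H => cα.clm_apply (continuousOn_const (c := H))
  have k3 := crow _ fun H => cβ.clm_apply (continuousOn_const (c := H))
  exact ⟨(((k1 0).mul (k3 1)).sub ((k1 1).mul (k3 0))).div cd hne,
    (((k2 0).mul (k1 1)).sub ((k2 1).mul (k1 0))).div cd hne⟩

/-- The osculating combinations of minors vanish on the fourfold. -/
lemma IsRegular.osc_eq_zero (hR : IsRegular Ω F G) (h : IsRankOneFlat Ω F G)
    (hU : U ∈ fourfold Ω F G) :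
    ∀ᶠ V in 𝓝 U, V ∈ fourfold Ω F G → osc F G F U V = 0 ∧ osc F G G U V = 0 := by
  filter_upwards [hR.exists_path hU Filter.univ_mem] with V hV hVX
  obtain ⟨γ, γ', h0, h1, hc, hγ⟩ := hV hVX
  have hcγ : ContinuousOn γ (Set.Icc 0 1) := fun s hs =>
    (hγ s hs).2.2.1.continuousAt.continuousWithinAt
  have hF := h.left hR
  have hG := h.right hR
  let f : ℝ → ℝ × ℝ := fun s => (osc F G F (γ s) V, osc F G G (γ s) V)
  obtain ⟨c1, c2⟩ := continuousOn_comb_hessDev hF hR hcγ hc fun s hs => (hγ s hs).1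
  obtain ⟨c3, c4⟩ := continuousOn_comb_hessDev hG hR hcγ hc fun s hs => (hγ s hs).1
  obtain ⟨C1, hC1⟩ := isCompact_Icc.exists_bound_of_continuousOn c1
  obtain ⟨C2, hC2⟩ := isCompact_Icc.exists_bound_of_continuousOn c2
  obtain ⟨C3, hC3⟩ := isCompact_Icc.exists_bound_of_continuousOn c3
  obtain ⟨C4, hC4⟩ := isCompact_Icc.exists_bound_of_continuousOn c4
  have hd : ∀ s ∈ Set.Icc (0 : ℝ) 1, HasDerivAt f _ s := fun s hs =>
    (hF.hasDerivAt_osc hR h (hγ s hs).2.2.1 (hγ s hs).1 (hγ s hs).2.2.2.1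
      (hγ s hs).2.2.2.2 V).prodMk
    (hG.hasDerivAt_osc hR h (hγ s hs).2.2.1 (hγ s hs).1 (hγ s hs).2.2.2.1
      (hγ s hs).2.2.2.2 V)
  have hbound : ∀ (p q C C' : ℝ) (z : ℝ × ℝ), ‖p‖ ≤ C → ‖q‖ ≤ C' →
      ‖p * z.1 + q * z.2‖ ≤ (C + C') * ‖z‖ := by
    intro p q C C' z hp hq
    calc ‖p * z.1 + q * z.2‖ ≤ ‖p‖ * ‖z.1‖ + ‖q‖ * ‖z.2‖ := by
          refine (norm_add_le _ _).trans ?_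
          rw [norm_mul, norm_mul]
      _ ≤ C * ‖z‖ + C' * ‖z‖ := by
          have := norm_nonneg p
          have := norm_nonneg q
          gcongr
          · linarith
          · exact norm_fst_le z
          · linarith
          · exact norm_snd_le z
      _ = _ := by ring
  -- Grönwall's inequality: the path starts at V, where a function osculating at V vanishes, so the
  -- solution stays zero up to U.
  have hz := eq_zero_of_abs_deriv_le_mul_abs_self_of_eq_zero_right (f := f)
    (K := max (C1 + C2) (C3 + C4)) (a := 0) (b := 1)
    (fun s hs => (hd s hs).continuousAt.continuousWithinAt)
    (fun s hs => (hd s ⟨hs.1, hs.2.le⟩).hasDerivWithinAt)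
    (by simp [f, h0, osc, minorForm])
    (by
      intro s hs
      have hs' : s ∈ Set.Icc (0 : ℝ) 1 := ⟨hs.1, hs.2.le⟩
      rw [Prod.norm_def]
      apply max_le
      · refine (hbound _ _ _ _ (f s) (hC1 s hs') (hC2 s hs')).trans ?_
        gcongr
        exact le_max_left _ _
      · refine (hbound _ _ _ _ (f s) (hC3 s hs') (hC4 s hs')).trans ?_
        gcongr
        exact le_max_right _ _) 1 ⟨zero_le_one, le_rfl⟩
  simp only [f, h1] at hz
  exact ⟨congrArg Prod.fst hz, congrArg Prod.snd hz⟩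

/-- Each point has its own osculating pair cutting out the fourfold nearby. Two such pairs that both
cut it out near a common point span the same plane, by `IsRegular.mem_span`; connectedness then
makes a single pair work everywhere. -/
theorem IsRegular.isMongeAmpere_of_isRankOneFlat (hR : IsRegular Ω F G)
    (hconn : IsConnected (fourfold Ω F G)) (h : IsRankOneFlat Ω F G) : IsMongeAmpere Ω F G := by
  have loc : ∀ U ∈ fourfold Ω F G, ∀ᶠ V in 𝓝 U,
      V ∈ fourfold Ω F G ↔ osc F G F U V = 0 ∧ osc F G G U V = 0 := fun U hU =>
    hR.eventually_iff hU hasStrictFDerivAt_osc hasStrictFDerivAt_osc (hR.osc_eq_zero h hU)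
  have li : ∀ U ∈ fourfold Ω F G, LinearIndependent ℝ ![osc F G F U, osc F G G U] := fun U hU =>
    linearIndependent_of_fderiv hR hU hasStrictFDerivAt_osc.hasFDerivAt
      hasStrictFDerivAt_osc.hasFDerivAt
  obtain ⟨⟨U₀, hU₀⟩, hpre⟩ := hconn
  set Φ := osc F G F U₀
  set Ψ := osc F G G U₀
  refine ⟨Φ, Ψ, isMinorCombination_osc, isMinorCombination_osc, li U₀ hU₀, ?_⟩
  -- A collects the points near which the pair from `U₀` works, B those with no points of the
  -- fourfold from A nearby; both are open.
  let A : Set Jet := {W | ∀ᶠ V in 𝓝 W, V ∈ fourfold Ω F G ↔ Φ V = 0 ∧ Ψ V = 0}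
  let B : Set Jet := {W | ∀ᶠ V in 𝓝 W, V ∈ fourfold Ω F G → V ∉ A}
  have hA : IsOpen A := isOpen_iff_mem_nhds.mpr fun W hW => hW.eventually_nhds
  have hB : IsOpen B := isOpen_iff_mem_nhds.mpr fun W hW => hW.eventually_nhds
  have hAB : fourfold Ω F G ⊆ A ∪ B := by
    intro U₁ hU₁
    by_contra hcon
    rw [Set.mem_union, not_or] at hcon
    have hB' : ∃ᶠ W in 𝓝 U₁, ¬ (W ∈ fourfold Ω F G → W ∉ A) :=
      Filter.not_eventually.mp hcon.2
    obtain ⟨W, hW1, hW2⟩ := (hB'.and_eventually (loc U₁ hU₁).eventually_nhds).exists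
    push Not at hW1
    obtain ⟨hWX, hWA⟩ := hW1
    have hv1 : ∀ᶠ V in 𝓝 W, V ∈ fourfold Ω F G → Φ V = 0 ∧ Ψ V = 0 :=
      Filter.Eventually.mono hWA fun V hV => hV.mp
    have hv2 : ∀ᶠ V in 𝓝 W, V ∈ fourfold Ω F G →
        osc F G F U₁ V = 0 ∧ osc F G G U₁ V = 0 := hW2.mono fun V hV => hV.mp
    have mem := fun {Θ : Jet → ℝ} (hΘ : IsMinorCombination Θ) => hR.mem_span hWX
      isMinorCombination_osc isMinorCombination_osc hΘ (li U₀ hU₀) hv1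
    have mem' := fun {Θ : Jet → ℝ} (hΘ : IsMinorCombination Θ) => hR.mem_span hWX
      isMinorCombination_osc isMinorCombination_osc hΘ (li U₁ hU₁) hv2
    obtain ⟨p1, q1, e1⟩ := mem (Θ := osc F G F U₁) isMinorCombination_osc
      (hv2.mono fun V hV h => (hV h).1)
    obtain ⟨p2, q2, e2⟩ := mem (Θ := osc F G G U₁) isMinorCombination_osc
      (hv2.mono fun V hV h => (hV h).2)
    obtain ⟨p3, q3, e3⟩ := mem' (Θ := Φ) isMinorCombination_osc
      (hv1.mono fun V hV h => (hV h).1)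
    obtain ⟨p4, q4, e4⟩ := mem' (Θ := Ψ) isMinorCombination_osc
      (hv1.mono fun V hV h => (hV h).2)
    apply hcon.1
    change ∀ᶠ V in 𝓝 U₁, V ∈ fourfold Ω F G ↔ Φ V = 0 ∧ Ψ V = 0
    filter_upwards [loc U₁ hU₁] with V hV
    rw [hV]
    constructor
    · rintro ⟨a1, a2⟩
      rw [e3, e4]
      simp [a1, a2]
    · rintro ⟨a1, a2⟩
      have a1' : osc F G F U₀ V = 0 := a1
      have a2' : osc F G G U₀ V = 0 := a2
      rw [e1, e2]
      simp [a1', a2']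
  intro U hU
  by_contra hcon
  have hUB : U ∈ B := (hAB hU).resolve_left hcon
  obtain ⟨W, hWX, hWA, hWB⟩ := hpre A B hA hB hAB ⟨U₀, hU₀, loc U₀ hU₀⟩ ⟨U, hU, hUB⟩
  exact Filter.Eventually.self_of_nhds hWB hWX hWA

end

/-! ## The Monge–Ampère property and linearisability imply that the second fundamental form
vanishes on characteristic directions -/

section

variable {Ω : Set Jet} {F G K : Jet → ℝ} {U : Jet}

lemma hess_eq_zero_of_line (hK : ContDiffAt ℝ ∞ K U) {H : Jet}
    (h : ∀ᶠ ε : ℝ in 𝓝 0, K (U + ε • H) = 0) : hess K U H H = 0 := by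
  have h1 : ∀ᶠ V in 𝓝 U, DifferentiableAt ℝ K V :=
    ((hK.of_le (by simp : (1 : ℕ∞ω) ≤ ∞)).eventually (by simp)).mono fun V hV =>
      hV.differentiableAt (by simp)
  have hc : Filter.Tendsto (fun ε : ℝ => U + ε • H) (𝓝 0) (𝓝 U) := by
    have : ContinuousAt (fun ε : ℝ => U + ε • H) 0 := by fun_prop
    simpa [ContinuousAt] using this
  have h2 : (fun ε : ℝ => fderiv ℝ K (U + ε • H) H) =ᶠ[𝓝 0] fun _ => 0 := by
    filter_upwards [h.eventually_nhds, hc.eventually h1] with ε he hd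
    have d1 : HasDerivAt (fun s : ℝ => U + s • H) H ε := by
      simpa using ((hasDerivAt_id ε).smul_const H).const_add U
    have d2 := hd.hasFDerivAt.comp_hasDerivAt ε d1
    have d3 : HasDerivAt (fun s : ℝ => K (U + s • H)) 0 ε :=
      (hasDerivAt_const ε (0 : ℝ)).congr_of_eventuallyEq he
    exact d2.unique d3
  have d1 := (hasDerivAt_comp_line ((contDiffAt_fderiv hK).differentiableAt (by simp)) H).clm_apply
    (hasDerivAt_const (0 : ℝ) H)
  have d2 : HasDerivAt (fun ε : ℝ => fderiv ℝ K (U + ε • H) H) 0 0 :=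
    (hasDerivAt_const (0 : ℝ) (0 : ℝ)).congr_of_eventuallyEq h2
  have := d1.unique d2
  simpa [hess] using this

/-- The 2 × 2 minors vanish on matrices of rank one, so a combination of minors is affine along a
characteristic line. If it vanishes on the fourfold, its slope there is zero. -/
lemma IsMinorCombination.line {Φ : Jet → ℝ} (h : IsMinorCombination Φ) (hR : IsRegular Ω F G)
    (hU : U ∈ fourfold Ω F G) (hv : ∀ᶠ V in 𝓝 U, V ∈ fourfold Ω F G → Φ V = 0) (x y ε : ℝ) :
    Φ (U + ε • tchar F G x y U) = 0 := by
  obtain ⟨a, ha⟩ := h.taylor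
  have h1 := hR.fderiv_eq_zero hU (h.contDiff.differentiable (by simp) U).hasFDerivAt hv
    (apply_charDir_left _ _ x y) (apply_charDir_right _ _ x y)
  rw [ha U, hv.self_of_nhds hU, add_sub_cancel_left, map_smul, minorForm_smul_left,
    minorForm_smul_right, tchar, h1, minorForm_charDir]
  simp

/-- Near U the characteristic lines through U stay in the fourfold, so F and G vanish along them to
all orders. -/
lemma IsRegular.hess_eq_zero (hR : IsRegular Ω F G) (hU : U ∈ fourfold Ω F G) {Φ Ψ : Jet → ℝ}
    (hΦ : IsMinorCombination Φ) (hΨ : IsMinorCombination Ψ)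
    (h : ∀ᶠ V in 𝓝 U, V ∈ fourfold Ω F G ↔ (Φ V = 0 ∧ Ψ V = 0)) (x y : ℝ) :
    hess F U (tchar F G x y U) (tchar F G x y U) = 0 ∧
      hess G U (tchar F G x y U) (tchar F G x y U) = 0 := by
  have hc : Filter.Tendsto (fun ε : ℝ => U + ε • tchar F G x y U) (𝓝 0) (𝓝 U) := by
    have : ContinuousAt (fun ε : ℝ => U + ε • tchar F G x y U) 0 := by fun_prop
    simpa [ContinuousAt] using this
  have hX : ∀ᶠ ε : ℝ in 𝓝 0, U + ε • tchar F G x y U ∈ fourfold Ω F G := by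
    filter_upwards [hc.eventually h] with ε hε
    exact hε.mpr ⟨hΦ.line hR hU (h.mono fun V hV hX => (hV.mp hX).1) x y ε,
      hΨ.line hR hU (h.mono fun V hV hX => (hV.mp hX).2) x y ε⟩
  exact ⟨hess_eq_zero_of_line (hR.contDiffAt_left hU.1) (hX.mono fun ε hε => hε.2.1),
    hess_eq_zero_of_line (hR.contDiffAt_right hU.1) (hX.mono fun ε hε => hε.2.2)⟩

lemma isMinorCombination_zero : IsMinorCombination 0 :=
  ⟨0, 0, 0, 0, fun U => by simp⟩

lemma IsMinorCombination.sum {ι : Type*} (s : Finset ι) {f : ι → Jet → ℝ} (c : ι → ℝ)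
    (h : ∀ i, IsMinorCombination (f i)) : IsMinorCombination (∑ i ∈ s, c i • f i) := by
  classical
  induction s using Finset.induction_on with
  | empty => simpa using isMinorCombination_zero
  | insert i s hi ih =>
    rw [Finset.sum_insert hi]
    simpa using (h i).comb ih (c i) 1

/-- Minors of order three of `U` extended by three constant columns. -/
lemma isMinorCombination_det
    (p q : Fin 3 → ℝ) (b : Fin 3 → Fin 3 → ℝ) :
    IsMinorCombination fun U => (Matrix.of fun k i => p k * U 0 i + q k * U 1 i + b k i).det := by
  let w : Fin 3 → ℝ := (p 1 * q 2 - q 1 * p 2) • b 0 + (p 2 * q 0 - q 2 * p 0) • b 1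
    + (p 0 * q 1 - q 0 * p 1) • b 2
  refine ⟨!![0, w 2, 0; 0, 0, w 0; w 1, 0, 0],
    p 0 • (b 1 ⨯₃ b 2) + p 1 • (b 2 ⨯₃ b 0) + p 2 • (b 0 ⨯₃ b 1),
    q 0 • (b 1 ⨯₃ b 2) + q 1 • (b 2 ⨯₃ b 0) + q 2 • (b 0 ⨯₃ b 1),
    b 0 ⬝ᵥ (b 1 ⨯₃ b 2), fun U => ?_⟩
  beta_reduce
  rw [Matrix.det_fin_three]
  simp [cross_apply, dotProduct, Fin.sum_univ_three, w]
  ring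

lemma denom_apply (M : Matrix Ix Ix ℝ) (U : Jet) (k i : Fin 3) :
    denom M U k i = M (Sum.inr k) (Sum.inl 0) * U 0 i + M (Sum.inr k) (Sum.inl 1) * U 1 i
      + M (Sum.inr k) (Sum.inr i) := by
  simp [denom, Matrix.mul_apply, Fin.sum_univ_two, Matrix.toBlocks₂₁, Matrix.toBlocks₂₂]

lemma isMinorCombination_det_denom (M : Matrix Ix Ix ℝ) :
    IsMinorCombination fun U => (denom M U).det := by
  have := isMinorCombination_det (fun k => M (Sum.inr k) (Sum.inl 0))
    (fun k => M (Sum.inr k) (Sum.inl 1)) (fun k i => M (Sum.inr k) (Sum.inr i))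
  convert this using 3 with U
  ext k i
  exact denom_apply M U k i

/-- The matrix `A U + B`. -/
def numer (M : Matrix Ix Ix ℝ) (U : Jet) : Matrix (Fin 2) (Fin 3) ℝ :=
  M.toBlocks₁₁ * Matrix.of U + M.toBlocks₁₂

lemma act_eq (M : Matrix Ix Ix ℝ) (U : Jet) :
    act M U = Matrix.of.symm (numer M U * (denom M U)⁻¹) := rfl

/-- `act` cleared of denominators. -/
def clearedAct (M : Matrix Ix Ix ℝ) (U : Jet) : Jet :=
  Matrix.of.symm (numer M U * (denom M U).adjugate)

/-- By Cramer's rule this entry is the determinant of the denominator with row j replaced by row a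
of the numerator. It is thus a maximal minor of a 5 × 3 matrix, and M mixes such minors linearly. -/
lemma isMinorCombination_num (M : Matrix Ix Ix ℝ) (a : Fin 2) (j : Fin 3) :
    IsMinorCombination fun U => clearedAct M U a j := by
  let r : Fin 3 → Ix := Function.update Sum.inr j (Sum.inl a)
  have := isMinorCombination_det (fun k => M (r k) (Sum.inl 0))
    (fun k => M (r k) (Sum.inl 1)) (fun k i => M (r k) (Sum.inr i))
  convert this using 2 with U
  have e : (Matrix.of fun k i => M (r k) (Sum.inl 0) * U 0 i + M (r k) (Sum.inl 1) * U 1 i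
      + M (r k) (Sum.inr i)) = (denom M U).updateRow j
        (numer M U a) := by
    ext k i
    by_cases hk : k = j
    · subst hk
      simp [r, numer, Matrix.mul_apply, Fin.sum_univ_two, Matrix.toBlocks₁₁, Matrix.toBlocks₁₂]
    · rw [Matrix.updateRow_ne hk, denom_apply]
      simp [r, hk]
  change (numer M U * (denom M U).adjugate) a j = _
  rw [e, ← Matrix.cramer_transpose_apply, Matrix.cramer_eq_adjugate_mulVec,
    ← Matrix.adjugate_transpose, Matrix.mul_apply]
  simp only [Matrix.mulVec, dotProduct, Matrix.transpose_apply]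
  exact Finset.sum_congr rfl fun i _ => mul_comm _ _

lemma clearedAct_eq (M : Matrix Ix Ix ℝ) {U : Jet} (h : (denom M U).det ≠ 0) :
    clearedAct M U = (denom M U).det • act M U := by
  rw [act_eq, Matrix.inv_def, Ring.inverse_eq_inv', Matrix.mul_smul]
  ext a j
  change _ = (denom M U).det * ((denom M U).det⁻¹ * _)
  rw [mul_inv_cancel_left₀ h]
  rfl

lemma isMinorCombination_clearedAct (M : Matrix Ix Ix ℝ) (l : Jet →ₗ[ℝ] ℝ) :
    IsMinorCombination fun V => l (clearedAct M V) := by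
  have h := IsMinorCombination.sum Finset.univ (fun k : Fin 2 × Fin 3 => l (jetDir k.1 k.2))
    fun k => isMinorCombination_num M k.1 k.2
  convert h using 2 with V
  rw [jet_eq_sum (clearedAct M V)]
  simp only [map_sum, map_smul, smul_eq_mul, Fintype.sum_prod_type, Finset.sum_apply,
    Pi.smul_apply]
  exact Finset.sum_congr rfl fun a _ => Finset.sum_congr rfl fun i _ => by rw [mul_comm]

lemma apply_clearedAct_eq_zero_iff (M : Matrix Ix Ix ℝ) (l : Jet →ₗ[ℝ] ℝ) {U : Jet}
    (h : (denom M U).det ≠ 0) : l (clearedAct M U) = 0 ↔ l (act M U) = 0 := by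
  rw [clearedAct_eq M h, map_smul, smul_eq_mul, mul_eq_zero, or_iff_right h]

theorem IsRegular.isRankOneFlat_of_isLinearisable (hR : IsRegular Ω F G)
    (h : IsLinearisable Ω F G) : IsRankOneFlat Ω F G := by
  obtain ⟨S, l₁, l₂, -, hd, hX⟩ := h
  intro U hU x y
  have key : ∀ V ∈ fourfold Ω F G, (denom S.1 V).det ≠ 0 →
      hess F V (tchar F G x y V) (tchar F G x y V) = 0 ∧
      hess G V (tchar F G x y V) (tchar F G x y V) = 0 := by
    intro V hV hdet
    refine hR.hess_eq_zero hV (isMinorCombination_clearedAct S.1 l₁)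
      (isMinorCombination_clearedAct S.1 l₂) ?_ x y
    have hc := (isMinorCombination_det_denom S.1).contDiff.continuous
    filter_upwards [hX V hV hdet, hc.continuousAt.eventually_ne hdet] with W hW hne
    rw [hW, apply_clearedAct_eq_zero_iff S.1 l₁ hne, apply_clearedAct_eq_zero_iff S.1 l₂ hne]
  have ht : ContDiffAt ℝ ∞ (tchar F G x y) U :=
    contDiffAt_charDir (contDiffAt_fderiv (hR.contDiffAt_left hU.1))
      (contDiffAt_fderiv (hR.contDiffAt_right hU.1)) x y
  -- Points sent to infinity are limits of points of the fourfold that are not, and the condition is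
  -- closed.
  have hcl : ∀ K, ContDiffAt ℝ ∞ K U → (∀ V ∈ fourfold Ω F G, (denom S.1 V).det ≠ 0 →
      hess K V (tchar F G x y V) (tchar F G x y V) = 0) →
      hess K U (tchar F G x y U) (tchar F G x y U) = 0 := by
    intro K hK hz
    by_contra hne
    have hcont : ContinuousAt (fun V => hess K V (tchar F G x y V) (tchar F G x y V)) U :=
      ((contDiffAt_fderiv (contDiffAt_fderiv hK)).continuousAt.clm_apply
        ht.continuousAt).clm_apply ht.continuousAt
    obtain ⟨V, ⟨hV, hV'⟩, hV2⟩ := ((mem_closure_iff_frequently.mp (hd hU)).and_eventually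
      (hcont.eventually_ne hne)).exists
    exact hV2 (hz V hV hV')
  exact ⟨hcl F (hR.contDiffAt_left hU.1) fun V hV hV' => (key V hV hV').1,
    hcl G (hR.contDiffAt_right hU.1) fun V hV hV' => (key V hV hV').2⟩

end

/-! ## Normal form of Monge–Ampère systems; linearisation -/

section

variable {Ω : Set Jet} {F G K : Jet → ℝ} {U : Jet}

/-- Numerator and denominator are the two blocks of M applied to the 5 × 3 matrix with blocks U and
1, so composition is matrix multiplication once the result is renormalised by the denominator of N.
-/
lemma numer_mul (M N : Matrix Ix Ix ℝ) {U : Jet} (h : (denom N U).det ≠ 0) :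
    numer (M * N) U = numer M (act N U) * denom N U := by
  have hu : IsUnit (denom N U).det := isUnit_iff_ne_zero.mpr h
  have e : Matrix.of (act N U) * denom N U = numer N U := by
    change numer N U * (denom N U)⁻¹ * denom N U = _
    rw [Matrix.mul_assoc, Matrix.nonsing_inv_mul _ hu, Matrix.mul_one]
  rw [numer, numer, Matrix.add_mul, Matrix.mul_assoc, e]
  conv_lhs => rw [← Matrix.fromBlocks_toBlocks M, ← Matrix.fromBlocks_toBlocks N,
    Matrix.fromBlocks_multiply]
  simp only [numer, denom, Matrix.toBlocks_fromBlocks₁₁, Matrix.toBlocks_fromBlocks₁₂,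
    Matrix.add_mul, Matrix.mul_add, Matrix.mul_assoc]
  abel

lemma denom_mul (M N : Matrix Ix Ix ℝ) {U : Jet} (h : (denom N U).det ≠ 0) :
    denom (M * N) U = denom M (act N U) * denom N U := by
  have hu : IsUnit (denom N U).det := isUnit_iff_ne_zero.mpr h
  have e : Matrix.of (act N U) * denom N U = numer N U := by
    change numer N U * (denom N U)⁻¹ * denom N U = _
    rw [Matrix.mul_assoc, Matrix.nonsing_inv_mul _ hu, Matrix.mul_one]
  rw [denom, denom, Matrix.add_mul, Matrix.mul_assoc, e]
  conv_lhs => rw [← Matrix.fromBlocks_toBlocks M, ← Matrix.fromBlocks_toBlocks N,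
    Matrix.fromBlocks_multiply]
  simp only [numer, denom, Matrix.toBlocks_fromBlocks₂₁, Matrix.toBlocks_fromBlocks₂₂,
    Matrix.add_mul, Matrix.mul_add, Matrix.mul_assoc]
  abel

lemma act_mul (M N : Matrix Ix Ix ℝ) {U : Jet} (h : (denom N U).det ≠ 0) :
    act (M * N) U = act M (act N U) := by
  have hu : IsUnit (denom N U).det := isUnit_iff_ne_zero.mpr h
  rw [act_eq, act_eq, numer_mul M N h, denom_mul M N h, Matrix.mul_inv_rev, Matrix.mul_assoc,
    Matrix.mul_nonsing_inv_cancel_left _ _ hu]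

/-- The cleared action is multiplicative up to a determinant, and it requires invertibility only of
the inner denominator. This allows arguments at points which M N sends to infinity. -/
lemma clearedAct_mul (M N : Matrix Ix Ix ℝ) {U : Jet} (h : (denom N U).det ≠ 0) :
    clearedAct (M * N) U = (denom N U).det • clearedAct M (act N U) := by
  rw [clearedAct, clearedAct, numer_mul M N h, denom_mul M N h, Matrix.adjugate_mul_distrib,
    Matrix.mul_assoc, ← Matrix.mul_assoc (denom N U), Matrix.mul_adjugate, Matrix.smul_mul,
    Matrix.one_mul, Matrix.mul_smul]
  rfl

/-- The projective transformation taking `U₀` to the origin with derivative one there. -/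
def shift (U₀ : Jet) (P : Matrix (Fin 3) (Fin 2) ℝ) : Matrix Ix Ix ℝ :=
  Matrix.fromBlocks 1 (- Matrix.of U₀) P (1 - P * Matrix.of U₀)

lemma det_shift (U₀ : Jet) (P : Matrix (Fin 3) (Fin 2) ℝ) : (shift U₀ P).det = 1 := by
  rw [shift, Matrix.det_fromBlocks_one₁₁, Matrix.mul_neg, sub_neg_eq_add, sub_add_cancel,
    Matrix.det_one]

lemma numer_shift (U₀ : Jet) (P : Matrix (Fin 3) (Fin 2) ℝ) (V : Jet) :
    numer (shift U₀ P) V = Matrix.of (V - U₀) := by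
  rw [numer, shift, Matrix.toBlocks_fromBlocks₁₁, Matrix.toBlocks_fromBlocks₁₂, Matrix.one_mul,
    ← sub_eq_add_neg]
  rfl

lemma denom_shift (U₀ : Jet) (P : Matrix (Fin 3) (Fin 2) ℝ) (V : Jet) :
    denom (shift U₀ P) V = 1 + P * Matrix.of (V - U₀) := by
  have e : Matrix.of (V - U₀) = Matrix.of V - Matrix.of U₀ := rfl
  rw [denom, shift, Matrix.toBlocks_fromBlocks₂₁, Matrix.toBlocks_fromBlocks₂₂, e, Matrix.mul_sub]
  abel

/-- Expand H · adj(1 + P H) in powers of H. The quadratic part consists of minors, and the cubic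
part H · adj(P H) vanishes because P H has rank at most two. -/
lemma apply_clearedAct_shift (θ : Jet →L[ℝ] ℝ) (U₀ : Jet) (p : Fin 2 → Fin 3 → ℝ) (V : Jet) :
    θ (clearedAct (shift U₀ (Matrix.of p)ᵀ) V)
      = θ (V - U₀) + 1 / 2 * minorForm (shiftCoeff θ p) (V - U₀) (V - U₀) := by
  rw [clearedAct, numer_shift, denom_shift]
  generalize V - U₀ = H
  rw [apply_eq_row θ (Matrix.of.symm _), apply_eq_row θ H]
  simp [Matrix.adjugate_fin_three, Matrix.mul_apply, Fin.sum_univ_three, Fin.sum_univ_two,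
    minorForm, shiftCoeff, cross_apply, dotProduct]
  ring

/-- Normal form of a Monge–Ampère system at one of its points. -/
lemma IsRegular.exists_shift (hR : IsRegular Ω F G) (h : IsMongeAmpere Ω F G) {U₀ : Jet}
    (hU₀ : U₀ ∈ fourfold Ω F G) : ∃ P : Matrix (Fin 3) (Fin 2) ℝ, ∀ U ∈ fourfold Ω F G,
      ∀ᶠ V in 𝓝 U, V ∈ fourfold Ω F G ↔ (fderiv ℝ F U₀ (clearedAct (shift U₀ P) V) = 0 ∧
        fderiv ℝ G U₀ (clearedAct (shift U₀ P) V) = 0) := by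
  obtain ⟨Φ, Ψ, hΦ, hΨ, hli, hX⟩ := h
  obtain ⟨a, b, c, d, hdet, h1, h2⟩ := hR.exists_normalised hU₀ hΦ hΨ hli
    ((hX U₀ hU₀).mono fun V hV h => hV.mp h)
  obtain ⟨e1, e2⟩ := (hX U₀ hU₀).self_of_nhds.mp hU₀
  obtain ⟨A, hA⟩ := (hΦ.comb hΨ a b).taylor
  obtain ⟨B, hB⟩ := (hΦ.comb hΨ c d).taylor
  -- The pair has been normalised to have the differentials of F and G at `U₀`; this shift matches
  -- its quadratic parts as well, so the cleared linear forms equal the pair identically.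
  obtain ⟨p, hp1, hp2⟩ := shiftCoeff_surjective (hR.conicDet_ne_zero hU₀) A B
  refine ⟨(Matrix.of p)ᵀ, fun U hU => ?_⟩
  filter_upwards [hX U hU] with V hV
  have k1 := hA U₀ V
  have k2 := hB U₀ V
  rw [h1, ← hp1] at k1
  rw [h2, ← hp2] at k2
  rw [apply_clearedAct_shift, apply_clearedAct_shift, hV]
  simp only [Pi.add_apply, Pi.smul_apply, smul_eq_mul, e1, e2, mul_zero, add_zero, zero_add]
    at k1 k2
  rw [← k1, ← k2]
  constructor
  · rintro ⟨f1, f2⟩; simp [f1, f2]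
  · rintro ⟨f1, f2⟩
    have g1 : (a * d - b * c) * Φ V = 0 := by linear_combination d * f1 - b * f2
    have g2 : (a * d - b * c) * Ψ V = 0 := by linear_combination a * f2 - c * f1
    exact ⟨(mul_eq_zero.mp g1).resolve_left hdet, (mul_eq_zero.mp g2).resolve_left hdet⟩

lemma denom_shift_self (U₀ : Jet) (P : Matrix (Fin 3) (Fin 2) ℝ) :
    denom (shift U₀ P) U₀ = 1 := by
  rw [denom_shift, sub_self]
  change 1 + P * (0 : Matrix (Fin 2) (Fin 3) ℝ) = 1
  rw [Matrix.mul_zero, add_zero]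

lemma hasFDerivAt_clearedAct_shift (θ : Jet →L[ℝ] ℝ) (U₀ : Jet) (P : Matrix (Fin 3) (Fin 2) ℝ) :
    HasFDerivAt (fun V => θ (clearedAct (shift U₀ P) V)) θ U₀ := by
  have h := hasStrictFDerivAt_taylor (shiftCoeff θ (Matrix.of.symm Pᵀ)) θ U₀ 0 U₀
  have e : θ + minorFormL (shiftCoeff θ (Matrix.of.symm Pᵀ)) (U₀ - U₀) = θ := by
    refine ContinuousLinearMap.ext fun H => ?_
    simp [minorForm]
  rw [e] at h
  refine h.hasFDerivAt.congr_of_eventuallyEq (Filter.Eventually.of_forall fun V => ?_)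
  have := apply_clearedAct_shift θ U₀ (Matrix.of.symm Pᵀ) V
  beta_reduce
  rw [zero_add, ← this]
  rfl

lemma IsRegular.linearIndependent_shift (hR : IsRegular Ω F G) {U₀ : Jet}
    (hU₀ : U₀ ∈ fourfold Ω F G) (P : Matrix (Fin 3) (Fin 2) ℝ) :
    LinearIndependent ℝ ![fun V => fderiv ℝ F U₀ (clearedAct (shift U₀ P) V),
      fun V => fderiv ℝ G U₀ (clearedAct (shift U₀ P) V)] :=
  linearIndependent_of_fderiv hR hU₀ (hasFDerivAt_clearedAct_shift _ _ _)
    (hasFDerivAt_clearedAct_shift _ _ _)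

lemma linearIndependent_of_conicDet {α β : Jet →L[ℝ] ℝ} (h : conicDet α β ≠ 0) :
    LinearIndependent ℝ ![(α : Jet →ₗ[ℝ] ℝ), (β : Jet →ₗ[ℝ] ℝ)] := by
  rw [LinearIndependent.pair_iff]
  intro s t hst
  obtain ⟨H, e1, e2⟩ := exists_dual h 1 0
  obtain ⟨H', e1', e2'⟩ := exists_dual h 0 1
  constructor
  · simpa [e1, e2] using congrArg (fun g => g H) hst
  · simpa [e1', e2'] using congrArg (fun g => g H') hst

/-- A combination of minors that vanishes on a piece of a Monge–Ampère fourfold vanishes on all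
of it. -/
lemma IsRegular.eq_zero_of_eventually (hR : IsRegular Ω F G) {U₀ : Jet}
    (hU₀ : U₀ ∈ fourfold Ω F G) {P : Matrix (Fin 3) (Fin 2) ℝ}
    (hP : ∀ U ∈ fourfold Ω F G,
      ∀ᶠ V in 𝓝 U, V ∈ fourfold Ω F G ↔ (fderiv ℝ F U₀ (clearedAct (shift U₀ P) V) = 0 ∧
        fderiv ℝ G U₀ (clearedAct (shift U₀ P) V) = 0)) {Θ : Jet → ℝ} (hΘ : IsMinorCombination Θ)
    (hU : U ∈ fourfold Ω F G) (hv : ∀ᶠ V in 𝓝 U, V ∈ fourfold Ω F G → Θ V = 0) :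
    ∀ V ∈ fourfold Ω F G, Θ V = 0 := by
  obtain ⟨p, q, rfl⟩ := hR.mem_span hU
    (isMinorCombination_clearedAct (shift U₀ P) (fderiv ℝ F U₀ : Jet →ₗ[ℝ] ℝ))
    (isMinorCombination_clearedAct (shift U₀ P) (fderiv ℝ G U₀ : Jet →ₗ[ℝ] ℝ)) hΘ
    (hR.linearIndependent_shift hU₀ P) ((hP U hU).mono fun V hV h => hV.mp h) hv
  intro V hV
  obtain ⟨e1, e2⟩ := (hP V hV).self_of_nhds.mp hV
  simp [e1, e2]

theorem IsRegular.isLinearisable_of_isMongeAmpere (hR : IsRegular Ω F G)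
    (hne : (fourfold Ω F G).Nonempty) (h : IsMongeAmpere Ω F G) : IsLinearisable Ω F G := by
  obtain ⟨U₀, hU₀⟩ := hne
  obtain ⟨P, hP⟩ := hR.exists_shift h hU₀
  refine ⟨⟨shift U₀ P, det_shift U₀ P⟩, fderiv ℝ F U₀, fderiv ℝ G U₀,
    linearIndependent_of_conicDet (hR.conicDet_ne_zero hU₀), fun U hU => ?_, fun U hU hdet => ?_⟩
  -- Otherwise the determinant of the denominator, a combination of minors, would vanish on a piece
  -- of the fourfold, hence on all of it. At `U₀` it equals one.
  · by_contra hcl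
    rw [mem_closure_iff_frequently, Filter.not_frequently] at hcl
    have hv : ∀ᶠ V in 𝓝 U, V ∈ fourfold Ω F G → (denom (shift U₀ P) V).det = 0 := by
      filter_upwards [hcl] with V hV hVX
      by_contra hne
      exact hV ⟨hVX, hne⟩
    have := hR.eq_zero_of_eventually hU₀ hP (isMinorCombination_det_denom (shift U₀ P)) hU hv U₀ hU₀
    rw [denom_shift_self, Matrix.det_one] at this
    exact one_ne_zero this
  · have hc := (isMinorCombination_det_denom (shift U₀ P)).contDiff.continuous
    filter_upwards [hP U hU, hc.continuousAt.eventually_ne hdet] with V hV hne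
    rw [hV]
    exact and_congr (apply_clearedAct_eq_zero_iff _ (fderiv ℝ F U₀ : Jet →ₗ[ℝ] ℝ) hne)
      (apply_clearedAct_eq_zero_iff _ (fderiv ℝ G U₀ : Jet →ₗ[ℝ] ℝ) hne)

end

/-! ## One-parameter subgroups -/

section

attribute [local instance] Matrix.linftyOpNormedAddCommGroup Matrix.linftyOpNormedSpace
  Matrix.linftyOpNormedRing Matrix.linftyOpNormedAlgebra

lemma hasDerivAt_exp_entry (A : Matrix Ix Ix ℝ) (i j : Ix) :
    HasDerivAt (fun t : ℝ => NormedSpace.exp (t • A) i j) (A i j) 0 := by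
  have h := hasDerivAt_exp_smul_const (𝕂 := ℝ) A (0 : ℝ)
  rw [zero_smul, NormedSpace.exp_zero, one_mul] at h
  exact hasDerivAt_pi.mp (hasDerivAt_pi.mp h i) j

lemma hasDerivAt_inv_entry {E : ℝ → Matrix (Fin 3) (Fin 3) ℝ} {E' : Matrix (Fin 3) (Fin 3) ℝ}
    (h : ∀ i j, HasDerivAt (fun t => E t i j) (E' i j) 0) (h0 : E 0 = 1) (i j : Fin 3) :
    HasDerivAt (fun t => (E t)⁻¹ i j) (- E' i j) 0 := by
  have hE : HasDerivAt E E' 0 := hasDerivAt_pi.mpr fun i => hasDerivAt_pi.mpr fun j => h i j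
  have h1 := hasFDerivAt_ringInverse (𝕜 := ℝ) (1 : (Matrix (Fin 3) (Fin 3) ℝ)ˣ)
  rw [Units.val_one, ← h0] at h1
  have := h1.comp_hasDerivAt 0 hE
  simp only [Function.comp_def, ← Matrix.nonsing_inv_eq_ringInverse] at this
  have := hasDerivAt_pi.mp (hasDerivAt_pi.mp this i) j
  simpa using this

lemma hasDerivAt_det_one {n : Type*} [Fintype n] [DecidableEq n] {E : ℝ → Matrix n n ℝ}
    {E' : Matrix n n ℝ}
    (h : ∀ i j, HasDerivAt (fun t => E t i j) (E' i j) 0) (h0 : E 0 = 1) :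
    HasDerivAt (fun t => (E t).det) E'.trace 0 := by
  have hE : HasDerivAt E E' 0 := hasDerivAt_pi.mpr fun i => hasDerivAt_pi.mpr fun j => h i j
  have hd : DifferentiableAt ℝ (fun M : Matrix n n ℝ => M.det) 1 := by
    simp only [Matrix.det_apply]
    have : ∀ i j : n, DifferentiableAt ℝ (fun M : Matrix n n ℝ => M i j) 1 := fun i j =>
      (differentiableAt_pi (𝕜 := ℝ) (Φ := fun M : Matrix n n ℝ => M i)).mp
        ((differentiableAt_pi (𝕜 := ℝ) (Φ := fun M : Matrix n n ℝ => M)).mp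
          differentiableAt_id i) j
    fun_prop (disch := assumption)
  have hl : HasDerivAt (fun t : ℝ => (1 : Matrix n n ℝ) + t • E') E' 0 := by
    have := ((hasDerivAt_id (0 : ℝ)).smul_const E').const_add (1 : Matrix n n ℝ)
    rwa [one_smul] at this
  have h1 := hd.hasFDerivAt.comp_hasDerivAt_of_eq (0 : ℝ) hE h0.symm
  have h2 := hd.hasFDerivAt.comp_hasDerivAt_of_eq (0 : ℝ) hl (by simp)
  have h3 : HasDerivAt (fun t : ℝ => (1 + t • E').det) E'.trace 0 := by
    rw [funext fun t : ℝ => det_one_add_smul t E']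
    generalize (1 + (Polynomial.X : Polynomial ℝ) • E'.map ⇑Polynomial.C).det.divX.divX = p
    have := (((hasDerivAt_id (0 : ℝ)).const_mul E'.trace).const_add 1).add
      ((p.hasDerivAt 0).mul (hasDerivAt_pow 2 (0 : ℝ)))
    exact this.congr_deriv (by norm_num)
  rw [h3.unique h2]
  exact h1

lemma trace_eq_zero_of_det_exp {A : Matrix Ix Ix ℝ}
    (h : ∀ t : ℝ, (NormedSpace.exp (t • A)).det = 1) : A.trace = 0 := by
  have h1 := hasDerivAt_det_one (E := fun t => NormedSpace.exp (t • A))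
    (hasDerivAt_exp_entry A) (by simp [NormedSpace.exp_zero])
  simp only [h] at h1
  exact h1.unique (hasDerivAt_const _ _)

lemma exp_add_smul (A : Matrix Ix Ix ℝ) (s t : ℝ) :
    NormedSpace.exp ((s + t) • A) = NormedSpace.exp (s • A) * NormedSpace.exp (t • A) := by
  rw [add_smul, Matrix.exp_add_of_commute]
  exact (Commute.refl A).smul_left s |>.smul_right t

/-- The one-parameter group law carries the vanishing derivative at zero to every t;
`hasDerivAt_act` transports the flow equation in the same way. -/
lemma det_exp_of_trace_eq_zero {A : Matrix Ix Ix ℝ} (h : A.trace = 0) (t : ℝ) :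
    (NormedSpace.exp (t • A)).det = 1 := by
  have h1 : ∀ t, HasDerivAt (fun t : ℝ => (NormedSpace.exp (t • A)).det) 0 t := by
    intro t
    have h1 := hasDerivAt_det_one (E := fun t => NormedSpace.exp (t • A))
      (hasDerivAt_exp_entry A) (by simp [NormedSpace.exp_zero])
    rw [h, ← sub_self t] at h1
    have h2 := (h1.comp_sub_const t t).mul_const (NormedSpace.exp (t • A)).det
    rw [sub_self, zero_mul] at h2
    refine h2.congr_of_eventuallyEq (Filter.Eventually.of_forall fun s => ?_)
    beta_reduce
    rw [← Matrix.det_mul, ← exp_add_smul, sub_add_cancel]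
  have h2 := is_const_of_deriv_eq_zero (fun t => (h1 t).differentiableAt) (fun t => (h1 t).deriv)
    t 0
  simpa [NormedSpace.exp_zero] using h2

lemma tendsto_exp_zero :
    Filter.Tendsto (fun A : Matrix Ix Ix ℝ => NormedSpace.exp A) (𝓝 0) (𝓝 1) := by
  have := (NormedSpace.exp_continuous (𝔸 := Matrix Ix Ix ℝ)).tendsto 0
  rwa [NormedSpace.exp_zero] at this

end

/-! ### The projective vector fields and their flows -/

/-- The vector field on the affine chart that generates `exp (t A)`. -/
def vf (A : Matrix Ix Ix ℝ) (U : Jet) : Jet := Matrix.of.symm (numer A U - Matrix.of U * denom A U)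

lemma numer_apply (M : Matrix Ix Ix ℝ) (U : Jet) (k : Fin 2) (i : Fin 3) :
    numer M U k i = M (Sum.inl k) (Sum.inl 0) * U 0 i + M (Sum.inl k) (Sum.inl 1) * U 1 i
      + M (Sum.inl k) (Sum.inr i) := by
  simp [numer, Matrix.mul_apply, Fin.sum_univ_two, Matrix.toBlocks₁₁, Matrix.toBlocks₁₂]

lemma numer_one (U : Jet) : numer 1 U = Matrix.of U := by
  ext k i
  fin_cases k <;> simp [numer_apply]

lemma denom_one (U : Jet) : denom 1 U = 1 := by
  ext k i
  simp [denom_apply, Matrix.one_apply]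

lemma act_one (U : Jet) : act 1 U = U := by
  rw [act_eq, numer_one, denom_one, inv_one, Matrix.mul_one]
  rfl

lemma hasDerivAt_act_zero (A : Matrix Ix Ix ℝ) (U : Jet) :
    HasDerivAt (fun t : ℝ => act (NormedSpace.exp (t • A)) U) (vf A U) 0 := by
  have hn : ∀ k i, HasDerivAt (fun t : ℝ => numer (NormedSpace.exp (t • A)) U k i)
      (numer A U k i) 0 := by
    intro k i
    simp only [numer_apply]
    exact (((hasDerivAt_exp_entry A _ _).mul_const _).add
      ((hasDerivAt_exp_entry A _ _).mul_const _)).add (hasDerivAt_exp_entry A _ _)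
  have hd : ∀ k i, HasDerivAt (fun t : ℝ => denom (NormedSpace.exp (t • A)) U k i)
      (denom A U k i) 0 := by
    intro k i
    simp only [denom_apply]
    exact (((hasDerivAt_exp_entry A _ _).mul_const _).add
      ((hasDerivAt_exp_entry A _ _).mul_const _)).add (hasDerivAt_exp_entry A _ _)
  have hi := hasDerivAt_inv_entry hd (by simp [NormedSpace.exp_zero, denom_one])
  refine hasDerivAt_pi.mpr fun k => hasDerivAt_pi.mpr fun i => ?_
  have h := HasDerivAt.fun_sum (u := Finset.univ) fun j _ => (hn k j).mul (hi j i)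
  refine HasDerivAt.congr_deriv (f := fun t => ∑ j, numer (NormedSpace.exp (t • A)) U k j *
    (denom (NormedSpace.exp (t • A)) U)⁻¹ j i) h ?_
  simp only [zero_smul, NormedSpace.exp_zero, denom_one, numer_one, inv_one, mul_neg,
    Finset.sum_add_distrib, Finset.sum_neg_distrib]
  rw [← sub_eq_add_neg]
  change _ = numer A U k i - (Matrix.of U * denom A U) k i
  rw [Matrix.mul_apply]
  congr 1
  simp [Matrix.one_apply]

lemma hasDerivAt_act (A : Matrix Ix Ix ℝ) (U : Jet) (t : ℝ)
    (h : (denom (NormedSpace.exp (t • A)) U).det ≠ 0) :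
    HasDerivAt (fun t : ℝ => act (NormedSpace.exp (t • A)) U)
      (vf A (act (NormedSpace.exp (t • A)) U)) t := by
  have h1 := hasDerivAt_act_zero A (act (NormedSpace.exp (t • A)) U)
  rw [← sub_self t] at h1
  have h2 := h1.comp_sub_const t t
  refine h2.congr_of_eventuallyEq (Filter.Eventually.of_forall fun s => ?_)
  beta_reduce
  rw [← act_mul _ _ h, ← exp_add_smul, sub_add_cancel]

lemma continuousAt_act {M : Matrix Ix Ix ℝ} {U : Jet} (h : (denom M U).det ≠ 0) :
    ContinuousAt (fun M => act M U) M := by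
  have hn : Continuous fun M : Matrix Ix Ix ℝ => numer M U := by
    refine continuous_matrix fun k i => ?_
    simp only [numer_apply]
    fun_prop
  have hd : Continuous fun M : Matrix Ix Ix ℝ => denom M U := by
    refine continuous_matrix fun k i => ?_
    simp only [denom_apply]
    fun_prop
  have h1 : ContinuousAt (fun M => ((denom M U).det)⁻¹ • (numer M U * (denom M U).adjugate)) M :=
    (hd.matrix_det.continuousAt.inv₀ h).smul (hn.matrix_mul hd.matrix_adjugate).continuousAt
  have e : (fun M => act M U) = fun M => Matrix.of.symm
      (((denom M U).det)⁻¹ • (numer M U * (denom M U).adjugate)) := by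
    ext1 M
    rw [act_eq, Matrix.inv_def, Ring.inverse_eq_inv', Matrix.mul_smul]
  rw [e]
  exact h1

lemma continuousAt_det_denom {M : Matrix Ix Ix ℝ} {U : Jet} :
    ContinuousAt (fun M => (denom M U).det) M := by
  have hd : Continuous fun M : Matrix Ix Ix ℝ => denom M U := by
    refine continuous_matrix fun k i => ?_
    simp only [denom_apply]
    fun_prop
  exact hd.matrix_det.continuousAt

/-! ## The stabiliser of a pencil of linear forms -/

section Stabiliser

variable {α β : Jet →L[ℝ] ℝ}

lemma vf_add (A B : Matrix Ix Ix ℝ) (U : Jet) : vf (A + B) U = vf A U + vf B U := by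
  ext k i
  change (numer (A + B) U - Matrix.of U * denom (A + B) U) k i
    = (numer A U - Matrix.of U * denom A U) k i + (numer B U - Matrix.of U * denom B U) k i
  simp [numer_apply, denom_apply, Matrix.mul_apply, Fin.sum_univ_three]
  ring

lemma vf_smul (r : ℝ) (A : Matrix Ix Ix ℝ) (U : Jet) : vf (r • A) U = r • vf A U := by
  ext k i
  change (numer (r • A) U - Matrix.of U * denom (r • A) U) k i
    = r * (numer A U - Matrix.of U * denom A U) k i
  simp [numer_apply, denom_apply, Matrix.mul_apply, Fin.sum_univ_three]
  ring

/-- The traceless block upper triangular matrices whose vector fields are tangent to the common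
kernel of `α` and `β`. -/
def stabAlg (α β : Jet →L[ℝ] ℝ) : Submodule ℝ (Matrix Ix Ix ℝ) where
  carrier := {A | A.toBlocks₂₁ = 0 ∧ A.trace = 0 ∧
    ∀ W, α W = 0 → β W = 0 → α (vf A W) = 0 ∧ β (vf A W) = 0}
  add_mem' := by
    rintro A B ⟨h1, h2, h3⟩ ⟨k1, k2, k3⟩
    refine ⟨?_, by rw [Matrix.trace_add, h2, k2, add_zero], fun W e1 e2 => ?_⟩
    · change A.toBlocks₂₁ + B.toBlocks₂₁ = 0
      rw [h1, k1, add_zero]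
    · rw [vf_add, map_add, map_add, (h3 W e1 e2).1, (h3 W e1 e2).2, (k3 W e1 e2).1,
        (k3 W e1 e2).2, add_zero]
      exact ⟨rfl, rfl⟩
  zero_mem' := by
    refine ⟨rfl, Matrix.trace_zero _ _, fun W _ _ => ?_⟩
    have := vf_smul 0 0 W
    rw [zero_smul, zero_smul] at this
    rw [this, map_zero, map_zero]
    exact ⟨rfl, rfl⟩
  smul_mem' := by
    rintro r A ⟨h1, h2, h3⟩
    refine ⟨?_, by rw [Matrix.trace_smul, h2, smul_zero], fun W e1 e2 => ?_⟩
    · change r • A.toBlocks₂₁ = 0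
      rw [h1, smul_zero]
    · rw [vf_smul, map_smul, map_smul, (h3 W e1 e2).1, (h3 W e1 e2).2, smul_zero]
      exact ⟨rfl, rfl⟩

lemma vf_eq_of_blocks {A : Matrix Ix Ix ℝ} (h : A.toBlocks₂₁ = 0) (W : Jet) :
    vf A W = isotropy A.toBlocks₁₁ A.toBlocks₂₂ W + Matrix.of.symm A.toBlocks₁₂ := by
  have e : vf A W = Matrix.of.symm (A.toBlocks₁₁ * Matrix.of W - Matrix.of W * A.toBlocks₂₂
      + A.toBlocks₁₂) := by
    rw [vf, numer, denom, h, Matrix.zero_mul, zero_add]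
    congr 1
    abel
  rw [e]
  rfl

/-- `isotropy a d` as a linear map. -/
def isotropyL (a : Matrix (Fin 2) (Fin 2) ℝ) (d : Matrix (Fin 3) (Fin 3) ℝ) : Jet →L[ℝ] Jet :=
  LinearMap.toContinuousLinearMap
    { toFun := isotropy a d
      map_add' := by
        intro H K
        ext i j
        simp only [isotropy_apply, Pi.add_apply, Pi.sub_apply, Pi.smul_apply, Matrix.add_vecMul,
          smul_eq_mul]
        ring
      map_smul' := by
        intro r H
        ext i j
        simp only [isotropy_apply, Pi.add_apply, Pi.sub_apply, Pi.smul_apply, Matrix.smul_vecMul,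
          smul_eq_mul, RingHom.id_apply]
        ring }

lemma isotropyL_apply (a : Matrix (Fin 2) (Fin 2) ℝ) (d : Matrix (Fin 3) (Fin 3) ℝ) (H : Jet) :
    isotropyL a d H = isotropy a d H := rfl

lemma apply_isotropy_of_mem {A : Matrix Ix Ix ℝ} (hA : A ∈ stabAlg α β) :
    (α (Matrix.of.symm A.toBlocks₁₂) = 0 ∧ β (Matrix.of.symm A.toBlocks₁₂) = 0) ∧
    ∀ W, α W = 0 → β W = 0 → α (isotropy A.toBlocks₁₁ A.toBlocks₂₂ W) = 0 ∧
      β (isotropy A.toBlocks₁₁ A.toBlocks₂₂ W) = 0 := by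
  obtain ⟨h1, -, h3⟩ := hA
  simp only [vf_eq_of_blocks h1, map_add] at h3
  have h0 := h3 0 (map_zero α) (map_zero β)
  rw [← isotropyL_apply, map_zero, map_zero, map_zero, zero_add, zero_add] at h0
  refine ⟨h0, fun W e1 e2 => ?_⟩
  have := h3 W e1 e2
  rwa [h0.1, h0.2, add_zero, add_zero] at this

/-- The vector field is affine because the lower left block vanishes, and it preserves the common
kernel. Hence the values of α and β along its flow solve a homogeneous linear system. -/
lemma exists_comb_vf (h : conicDet α β ≠ 0) {A : Matrix Ix Ix ℝ} (hA : A ∈ stabAlg α β) :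
    ∃ p q r s : ℝ, ∀ W, α (vf A W) = p * α W + q * β W ∧ β (vf A W) = r * α W + s * β W := by
  obtain ⟨⟨e1, e2⟩, h3⟩ := apply_isotropy_of_mem hA
  obtain ⟨p, q, k1⟩ : ∃ p q : ℝ, α.comp (isotropyL A.toBlocks₁₁ A.toBlocks₂₂)
      = p • α + q • β := ⟨_, _, eq_combination h fun k =>
    (h3 _ (apply_frame_left _ _ k) (apply_frame_right _ _ k)).1⟩
  obtain ⟨r, s, k2⟩ : ∃ r s : ℝ, β.comp (isotropyL A.toBlocks₁₁ A.toBlocks₂₂)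
      = r • α + s • β := ⟨_, _, eq_combination h fun k =>
    (h3 _ (apply_frame_left _ _ k) (apply_frame_right _ _ k)).2⟩
  refine ⟨p, q, r, s, fun W => ?_⟩
  rw [vf_eq_of_blocks hA.1, map_add, map_add, e1, e2, add_zero, add_zero]
  exact ⟨congrArg (fun θ => θ W) k1, congrArg (fun θ => θ W) k2⟩

lemma toBlocks₂₁_exp {A : Matrix Ix Ix ℝ} (h : A.toBlocks₂₁ = 0) :
    (NormedSpace.exp A).toBlocks₂₁ = 0 := by
  have hb : BlockTriangular A (Sum.elim (fun _ => 0) (fun _ => 1) : Ix → ℕ) := by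
    rintro (i | i) (j | j) hij
    · simp at hij
    · simp at hij
    · exact congrFun (congrFun h i) j
    · simp at hij
  ext i j
  exact hb.exp (by simp)

lemma denom_of_blocks {M : Matrix Ix Ix ℝ} (h : M.toBlocks₂₁ = 0) (U : Jet) :
    denom M U = M.toBlocks₂₂ := by
  rw [denom, h, Matrix.zero_mul, zero_add]

/-- Block triangular elements act by affine maps of the chart, so no point goes to infinity. -/
lemma det_denom_ne_zero {M : Matrix Ix Ix ℝ} (h : M.toBlocks₂₁ = 0) (hd : M.det = 1) (U : Jet) :
    (denom M U).det ≠ 0 := by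
  rw [denom_of_blocks h]
  intro h0
  have := Matrix.det_fromBlocks_zero₂₁ M.toBlocks₁₁ M.toBlocks₁₂ M.toBlocks₂₂
  rw [← h, Matrix.fromBlocks_toBlocks, hd, h0, mul_zero] at this
  exact one_ne_zero this

/-- The flow of an element of `stabAlg` preserves the common kernel. -/
lemma act_exp_mem (h : conicDet α β ≠ 0) {A : Matrix Ix Ix ℝ} (hA : A ∈ stabAlg α β) {W : Jet}
    (hα : α W = 0) (hβ : β W = 0) :
    α (act (NormedSpace.exp A) W) = 0 ∧ β (act (NormedSpace.exp A) W) = 0 := by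
  obtain ⟨p, q, r, s, hc⟩ := exists_comb_vf h hA
  let φ : ℝ → Jet := fun t => act (NormedSpace.exp (t • A)) W
  have hφ : ∀ t, HasDerivAt φ (vf A (φ t)) t := fun t => by
    refine hasDerivAt_act A W t (det_denom_ne_zero ?_ (det_exp_of_trace_eq_zero hA.2.1 t) W)
    exact toBlocks₂₁_exp ((stabAlg α β).smul_mem t hA).1
  let f : ℝ → ℝ × ℝ := fun t => (α (φ t), β (φ t))
  have hf : ∀ t, HasDerivAt f (p * α (φ t) + q * β (φ t), r * α (φ t) + s * β (φ t)) t := by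
    intro t
    rw [← (hc _).1, ← (hc _).2]
    exact (α.hasFDerivAt.comp_hasDerivAt t (hφ t)).prodMk (β.hasFDerivAt.comp_hasDerivAt t (hφ t))
  have hbound : ∀ (p q : ℝ) (z : ℝ × ℝ), ‖p * z.1 + q * z.2‖ ≤ (|p| + |q|) * ‖z‖ := by
    intro p q z
    calc ‖p * z.1 + q * z.2‖ ≤ |p| * ‖z.1‖ + |q| * ‖z.2‖ := by
          refine (norm_add_le _ _).trans ?_
          rw [norm_mul, norm_mul, Real.norm_eq_abs p, Real.norm_eq_abs q]
      _ ≤ |p| * ‖z‖ + |q| * ‖z‖ := by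
          gcongr
          · exact norm_fst_le z
          · exact norm_snd_le z
      _ = _ := by ring
  have hz := eq_zero_of_abs_deriv_le_mul_abs_self_of_eq_zero_right (f := f)
    (K := max (|p| + |q|) (|r| + |s|)) (a := 0) (b := 1)
    (fun s _ => (hf s).continuousAt.continuousWithinAt)
    (fun s _ => (hf s).hasDerivWithinAt)
    (by simp [f, φ, NormedSpace.exp_zero, act_one, hα, hβ])
    (by
      intro t _
      rw [Prod.norm_def]
      apply max_le
      · refine (hbound p q (f t)).trans ?_
        gcongr
        exact le_max_left _ _
      · refine (hbound r s (f t)).trans ?_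
        gcongr
        exact le_max_right _ _) 1 ⟨zero_le_one, le_rfl⟩
  simp only [f, φ, one_smul] at hz
  exact ⟨congrArg Prod.fst hz, congrArg Prod.snd hz⟩

lemma toBlocks₂₁_mul {M N : Matrix Ix Ix ℝ} (hM : M.toBlocks₂₁ = 0) (hN : N.toBlocks₂₁ = 0) :
    (M * N).toBlocks₂₁ = 0 := by
  rw [← Matrix.fromBlocks_toBlocks M, ← Matrix.fromBlocks_toBlocks N, hM, hN,
    Matrix.fromBlocks_multiply]
  simp

lemma toBlocks₂₁_of_mul_eq_one {M N : Matrix Ix Ix ℝ} (hM : M.toBlocks₂₁ = 0) (hd : M.det = 1)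
    (h : M * N = 1) : N.toBlocks₂₁ = 0 := by
  have h1 : (M * N).toBlocks₂₁ = 0 := by
    rw [h, ← Matrix.fromBlocks_one, Matrix.toBlocks_fromBlocks₂₁]
  rw [← Matrix.fromBlocks_toBlocks M, ← Matrix.fromBlocks_toBlocks N, hM,
    Matrix.fromBlocks_multiply, Matrix.toBlocks_fromBlocks₂₁, Matrix.zero_mul, zero_add] at h1
  have h2 := det_denom_ne_zero hM hd 0
  rw [denom_of_blocks hM] at h2
  have hu : IsUnit M.toBlocks₂₂.det := isUnit_iff_ne_zero.mpr h2
  rw [← Matrix.nonsing_inv_mul_cancel_left _ N.toBlocks₂₁ hu, h1, Matrix.mul_zero]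

/-- The stabiliser of the common kernel of `α` and `β` among the affine transformations. -/
def stabGroup (α β : Jet →L[ℝ] ℝ) : Subgroup (Matrix.SpecialLinearGroup Ix ℝ) where
  carrier := {M | M.1.toBlocks₂₁ = 0 ∧
    ∀ W, (α (act M.1 W) = 0 ∧ β (act M.1 W) = 0) ↔ (α W = 0 ∧ β W = 0)}
  mul_mem' := by
    rintro M N ⟨h1, h2⟩ ⟨k1, k2⟩
    refine ⟨toBlocks₂₁_mul h1 k1, fun W => ?_⟩
    change α (act (M.1 * N.1) W) = 0 ∧ β (act (M.1 * N.1) W) = 0 ↔ _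
    rw [act_mul _ _ (det_denom_ne_zero k1 N.2 W), h2, k2]
  one_mem' := by
    refine ⟨?_, fun W => ?_⟩
    · change (1 : Matrix Ix Ix ℝ).toBlocks₂₁ = 0
      rw [← Matrix.fromBlocks_one, Matrix.toBlocks_fromBlocks₂₁]
    · change α (act 1 W) = 0 ∧ β (act 1 W) = 0 ↔ _
      rw [act_one]
  inv_mem' := by
    rintro M ⟨h1, h2⟩
    have e : M.1 * M⁻¹.1 = 1 := congrArg Subtype.val (mul_inv_cancel M)
    have h3 := toBlocks₂₁_of_mul_eq_one h1 M.2 e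
    refine ⟨h3, fun W => ?_⟩
    rw [← h2, ← act_mul _ _ (det_denom_ne_zero h3 M⁻¹.2 W), e, act_one]

lemma exp_mem_stabGroup (h : conicDet α β ≠ 0) {A : Matrix Ix Ix ℝ} (hA : A ∈ stabAlg α β) :
    ∃ M ∈ stabGroup α β, M.1 = NormedSpace.exp A := by
  have hd : (NormedSpace.exp A).det = 1 := by simpa using det_exp_of_trace_eq_zero hA.2.1 1
  have hb := toBlocks₂₁_exp hA.1
  refine ⟨⟨NormedSpace.exp A, hd⟩, ⟨hb, fun W => ⟨?_, ?_⟩⟩, rfl⟩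
  · rintro ⟨e1, e2⟩
    have := act_exp_mem h ((stabAlg α β).neg_mem hA) e1 e2
    change α (act _ (act (NormedSpace.exp A) W)) = 0 ∧ β (act _ (act (NormedSpace.exp A) W)) = 0
      at this
    rwa [← act_mul _ _ (det_denom_ne_zero hb hd W), ← Matrix.exp_add_of_commute _ _
      (Commute.neg_left (Commute.refl A)), neg_add_cancel, NormedSpace.exp_zero, act_one] at this
  · rintro ⟨e1, e2⟩
    exact act_exp_mem h hA e1 e2

lemma isLieAlgebraOf_stabGroup (h : conicDet α β ≠ 0) :
    IsLieAlgebraOf (stabAlg α β) (stabGroup α β) := by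
  intro A
  refine ⟨fun hA t => exp_mem_stabGroup h ((stabAlg α β).smul_mem t hA), fun hA => ?_⟩
  have hd : ∀ t : ℝ, (NormedSpace.exp (t • A)).det = 1 := fun t => by
    obtain ⟨M, -, hM⟩ := hA t
    rw [← hM]
    exact M.2
  refine ⟨?_, trace_eq_zero_of_det_exp hd, fun W e1 e2 => ?_⟩
  · ext i j
    have h1 := hasDerivAt_exp_entry A (Sum.inr i) (Sum.inl j)
    have h2 : ∀ t : ℝ, NormedSpace.exp (t • A) (Sum.inr i) (Sum.inl j) = 0 := by
      intro t
      obtain ⟨M, hM, e⟩ := hA t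
      rw [← e]
      exact congrFun (congrFun hM.1 i) j
    simp only [h2] at h1
    exact h1.unique (hasDerivAt_const _ _)
  · have h1 := hasDerivAt_act_zero A W
    have h2 : ∀ t : ℝ, α (act (NormedSpace.exp (t • A)) W) = 0 ∧
        β (act (NormedSpace.exp (t • A)) W) = 0 := by
      intro t
      obtain ⟨M, hM, e⟩ := hA t
      rw [← e]
      exact (hM.2 W).mpr ⟨e1, e2⟩
    have k1 := α.hasFDerivAt.comp_hasDerivAt 0 h1
    have k2 := β.hasFDerivAt.comp_hasDerivAt 0 h1
    simp only [Function.comp_def, h2] at k1 k2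
    exact ⟨k1.unique (hasDerivAt_const _ _), k2.unique (hasDerivAt_const _ _)⟩

/-- The common kernel of `α` and `β`. -/
abbrev pencilKer (α β : Jet →L[ℝ] ℝ) : Submodule ℝ Jet :=
  LinearMap.ker ((α : Jet →ₗ[ℝ] ℝ).prod (β : Jet →ₗ[ℝ] ℝ))

lemma mem_pencilKer {W : Jet} : W ∈ pencilKer α β ↔ α W = 0 ∧ β W = 0 := by
  simp [pencilKer, Prod.ext_iff]

lemma finrank_pencilKer (h : conicDet α β ≠ 0) : Module.finrank ℝ (pencilKer α β) = 4 := by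
  have h1 := LinearMap.finrank_range_add_finrank_ker ((α : Jet →ₗ[ℝ] ℝ).prod (β : Jet →ₗ[ℝ] ℝ))
  have h2 : LinearMap.range ((α : Jet →ₗ[ℝ] ℝ).prod (β : Jet →ₗ[ℝ] ℝ)) = ⊤ := by
    rw [LinearMap.range_eq_top]
    rintro ⟨a, b⟩
    obtain ⟨H, e1, e2⟩ := exists_dual h a b
    exact ⟨H, Prod.ext e1 e2⟩
  have h3 : Module.finrank ℝ Jet = 6 := by
    simp [Module.finrank_pi_fintype]
  rw [h2, finrank_top, Module.finrank_prod, h3, Module.finrank_self] at h1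
  change 1 + 1 + Module.finrank ℝ (pencilKer α β) = 6 at h1
  omega

lemma trace_eq_blocks (a : Matrix (Fin 2) (Fin 2) ℝ) (b : Matrix (Fin 2) (Fin 3) ℝ)
    (c : Matrix (Fin 3) (Fin 2) ℝ) (d : Matrix (Fin 3) (Fin 3) ℝ) :
    (Matrix.fromBlocks a b c d).trace = a.trace + d.trace := by
  simp [Matrix.trace, Fintype.sum_sum_type]

/-- A translation along the kernel and an arbitrary left 2 × 2 block are free, giving 4 + 4. The
right block exists by `exists_isotropy`, and it is unique because the remaining scalar is fixed by
the trace. -/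
lemma finrank_stabAlg (h : conicDet α β ≠ 0) : Module.finrank ℝ (stabAlg α β) = 8 := by
  let f : stabAlg α β →ₗ[ℝ] pencilKer α β × Matrix (Fin 2) (Fin 2) ℝ :=
    { toFun := fun A => (⟨Matrix.of.symm A.1.toBlocks₁₂,
        mem_pencilKer.mpr (apply_isotropy_of_mem A.2).1⟩, A.1.toBlocks₁₁)
      map_add' := fun _ _ => rfl
      map_smul' := fun _ _ => rfl }
  have hinj : Function.Injective f := by
    rw [injective_iff_map_eq_zero]
    rintro ⟨A, hA⟩ h0
    have hb : A.toBlocks₁₂ = 0 := congrArg Subtype.val (congrArg Prod.fst h0)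
    have ha : A.toBlocks₁₁ = 0 := congrArg Prod.snd h0
    have h3 := (apply_isotropy_of_mem hA).2
    rw [ha] at h3
    obtain ⟨m, hm⟩ := eq_scalar_of_isotropy h
      (fun k => (h3 _ (apply_frame_left _ _ k) (apply_frame_right _ _ k)).1)
      (fun k => (h3 _ (apply_frame_left _ _ k) (apply_frame_right _ _ k)).2)
    have ht := hA.2.1
    rw [← Matrix.fromBlocks_toBlocks A, trace_eq_blocks, ha, hm, Matrix.trace_zero,
      zero_add, Matrix.trace_smul, Matrix.trace_one] at ht
    have hm0 : m = 0 := by simpa using ht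
    refine Subtype.ext ?_
    change A = 0
    rw [← Matrix.fromBlocks_toBlocks A, ha, hb, hA.1, hm, hm0, zero_smul, Matrix.fromBlocks_zero]
  have hsurj : Function.Surjective f := by
    rintro ⟨⟨b, hb⟩, a⟩
    obtain ⟨d, hd, hd'⟩ := exists_isotropy h a
    have hb := mem_pencilKer.mp hb
    refine ⟨⟨Matrix.fromBlocks a (Matrix.of b) 0 d, ?_, ?_, fun W e1 e2 => ?_⟩, rfl⟩
    · exact Matrix.toBlocks_fromBlocks₂₁ _ _ _ _
    · rw [trace_eq_blocks, hd, add_neg_cancel]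
    · rw [vf_eq_of_blocks (Matrix.toBlocks_fromBlocks₂₁ _ _ _ _), Matrix.toBlocks_fromBlocks₁₁,
        Matrix.toBlocks_fromBlocks₁₂, Matrix.toBlocks_fromBlocks₂₂, map_add, map_add]
      obtain ⟨c, rfl⟩ := exists_frame_coord h e1 e2
      rw [← isotropyL_apply]
      simp only [map_sum, map_smul, isotropyL_apply, (hd' _).1, (hd' _).2, smul_zero,
        Finset.sum_const_zero, zero_add]
      exact hb
  rw [(LinearEquiv.ofBijective f ⟨hinj, hsurj⟩).finrank_eq, Module.finrank_prod,
    finrank_pencilKer h, Module.finrank_matrix]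
  simp

end Stabiliser

/-! ## Monge–Ampère systems are invariant under eight-dimensional groups -/

theorem IsRegular.isInvariant_of_isMongeAmpere {Ω : Set Jet} {F G : Jet → ℝ}
    (hR : IsRegular Ω F G) (hne : (fourfold Ω F G).Nonempty) (h : IsMongeAmpere Ω F G) :
    IsInvariantUnderSubgroupOfDim 8 Ω F G := by
  obtain ⟨U₀, hU₀⟩ := hne
  obtain ⟨P, hP⟩ := hR.exists_shift h hU₀
  have hc := hR.conicDet_ne_zero hU₀
  set α := fderiv ℝ F U₀ with hα
  set β := fderiv ℝ G U₀ with hβ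
  let S : Matrix.SpecialLinearGroup Ix ℝ := ⟨shift U₀ P, det_shift U₀ P⟩
  have eS : S.1 * S⁻¹.1 = 1 := congrArg Subtype.val (mul_inv_cancel S)
  have eS' : S⁻¹.1 * S.1 = 1 := congrArg Subtype.val (inv_mul_cancel S)
  let u : (Matrix Ix Ix ℝ)ˣ := ⟨S.1, S⁻¹.1, eS, eS'⟩
  let c : Matrix Ix Ix ℝ ≃ₗ[ℝ] Matrix Ix Ix ℝ :=
    { toFun := fun A => S.1 * A * S⁻¹.1
      invFun := fun A => S⁻¹.1 * A * S.1
      left_inv := fun A => by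
        simp only [Matrix.mul_assoc, eS', Matrix.mul_one]
        rw [← Matrix.mul_assoc, eS', Matrix.one_mul]
      right_inv := fun A => by
        simp only [Matrix.mul_assoc, eS, Matrix.mul_one]
        rw [← Matrix.mul_assoc, eS, Matrix.one_mul]
      map_add' := fun A B => by rw [Matrix.mul_add, Matrix.add_mul]
      map_smul' := fun r A => by simp }
  have hcexp : ∀ A, NormedSpace.exp (c A) = S.1 * NormedSpace.exp A * S⁻¹.1 := fun A =>
    Matrix.exp_units_conj u A
  -- The group of the linear system is conjugated back by the linearising shift S.
  refine ⟨(stabGroup α β).comap (MulAut.conj S).toMonoidHom, (stabAlg α β).comap c.toLinearMap,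
    fun A => ?_, ?_, fun U hU => ?_⟩
  · rw [Submodule.mem_comap]
    refine (isLieAlgebraOf_stabGroup hc (c A)).trans (forall_congr' fun t => ?_)
    have ec : t • c A = c (t • A) := (map_smul c t A).symm
    rw [ec]
    change (∃ h ∈ stabGroup α β, h.1 = NormedSpace.exp (c (t • A))) ↔ _
    rw [hcexp]
    constructor
    · rintro ⟨M, hM, e⟩
      refine ⟨S⁻¹ * M * S, ?_, ?_⟩
      · rw [Subgroup.mem_comap]
        have : (MulAut.conj S).toMonoidHom (S⁻¹ * M * S) = M := by
          change S * (S⁻¹ * M * S) * S⁻¹ = M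
          group
        rwa [this]
      · change S⁻¹.1 * M.1 * S.1 = _
        rw [e]
        exact c.left_inv _
    · rintro ⟨M, hM, e⟩
      refine ⟨S * M * S⁻¹, hM, ?_⟩
      change S.1 * M.1 * S⁻¹.1 = _
      rw [e]
  · have e := (c.submoduleMap ((stabAlg α β).comap c.toLinearMap)).finrank_eq
    have e2 : Submodule.map c.toLinearMap ((stabAlg α β).comap c.toLinearMap) = stabAlg α β :=
      Submodule.map_comap_eq_of_surjective c.surjective _
    rw [e]
    change Module.finrank ℝ (Submodule.map c.toLinearMap _) = 8
    rw [e2, finrank_stabAlg hc]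
  -- S may send U to infinity, so invariance cannot be read off directly at U. It is proved near
  -- `U₀`, where S is defined, and propagated to the whole fourfold as the vanishing of a
  -- combination of minors.
  · have key : ∀ A ∈ (stabAlg α β).comap c.toLinearMap,
        α (clearedAct (S.1 * NormedSpace.exp A) U) = 0 ∧
        β (clearedAct (S.1 * NormedSpace.exp A) U) = 0 := by
      intro A hA
      obtain ⟨M, hM, e⟩ := exp_mem_stabGroup hc (Submodule.mem_comap.mp hA)
      have e' : S.1 * NormedSpace.exp A = M.1 * S.1 := by
        rw [e]
        change _ = NormedSpace.exp (c A) * _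
        rw [hcexp, Matrix.mul_assoc, eS', Matrix.mul_one]
      rw [e']
      have hcont := (isMinorCombination_det_denom S.1).contDiff.continuous
      have hne : (denom S.1 U₀).det ≠ 0 := by
        change (denom (shift U₀ P) U₀).det ≠ 0
        rw [denom_shift_self, Matrix.det_one]
        exact one_ne_zero
      have hv : ∀ᶠ V in 𝓝 U₀, V ∈ fourfold Ω F G →
          α (clearedAct (M.1 * S.1) V) = 0 ∧ β (clearedAct (M.1 * S.1) V) = 0 := by
        filter_upwards [hP U₀ hU₀, hcont.continuousAt.eventually_ne hne] with V hV hdet hVX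
        obtain ⟨f1, f2⟩ := hV.mp hVX
        have g1 := (apply_clearedAct_eq_zero_iff S.1 (α : Jet →ₗ[ℝ] ℝ) hdet).mp f1
        have g2 := (apply_clearedAct_eq_zero_iff S.1 (β : Jet →ₗ[ℝ] ℝ) hdet).mp f2
        obtain ⟨k1, k2⟩ := (hM.2 (act S.1 V)).mpr ⟨g1, g2⟩
        rw [clearedAct_mul _ _ hdet, clearedAct_eq M.1 (det_denom_ne_zero hM.1 M.2 _)]
        simp [k1, k2]
      exact ⟨hR.eq_zero_of_eventually hU₀ hP
          (isMinorCombination_clearedAct (M.1 * S.1) (α : Jet →ₗ[ℝ] ℝ)) hU₀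
          (hv.mono fun V hV h => (hV h).1) U hU,
        hR.eq_zero_of_eventually hU₀ hP
          (isMinorCombination_clearedAct (M.1 * S.1) (β : Jet →ₗ[ℝ] ℝ)) hU₀
          (hv.mono fun V hV h => (hV h).2) U hU⟩
    have h1 : (denom 1 U).det ≠ 0 := by
      rw [denom_one, Matrix.det_one]; exact one_ne_zero
    have hact := (continuousAt_act h1).tendsto.comp tendsto_exp_zero
    rw [act_one] at hact
    filter_upwards [hact.eventually (hP U hU),
      tendsto_exp_zero.eventually (continuousAt_det_denom.eventually_ne h1)] with A hA hdet hmem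
    obtain ⟨k1, k2⟩ := key A hmem
    -- For A near zero the denominator of exp A is invertible at U, so the moved point satisfies the
    -- defining equations, and it is still close to U.
    rw [clearedAct_mul _ _ hdet, map_smul, smul_eq_mul, mul_eq_zero, or_iff_right hdet] at k1 k2
    exact hA.mpr ⟨k1, k2⟩

/-! ## Invariance under an eight-dimensional group implies that the second fundamental form
vanishes on characteristic directions -/

section

variable {Ω : Set Jet} {F G K : Jet → ℝ} {U : Jet}

/-- The symmetric bilinear map `(H, K) ↦ H c K + K c H`. -/
def sandwich (c : Matrix (Fin 3) (Fin 2) ℝ) (H K : Jet) : Jet :=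
  Matrix.of.symm (Matrix.of H * c * Matrix.of K + Matrix.of K * c * Matrix.of H)

/-- By the Cayley–Hamilton type identity for products H c K, the quadratic part of a projective
vector field is a combination of minors modulo terms containing α(H) or α(K). On the kernel of α
only the minors remain. -/
lemma apply_sandwich (α : Jet →L[ℝ] ℝ) (c : Matrix (Fin 3) (Fin 2) ℝ) (H K : Jet) :
    α (sandwich c H K) = (c * Matrix.of H).trace * α K + (c * Matrix.of K).trace * α H
      - minorForm (shiftCoeff α (Matrix.of.symm cᵀ)) H K := by
  rw [apply_eq_row α (sandwich c H K), apply_eq_row α H, apply_eq_row α K]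
  simp [sandwich, Matrix.mul_apply, Fin.sum_univ_three, Fin.sum_univ_two, Matrix.trace,
    minorForm, shiftCoeff, cross_apply, dotProduct]
  ring

/-- The linear part of the vector field `vf A` at `U`, on the left. -/
def linLeft (A : Matrix Ix Ix ℝ) (U : Jet) : Matrix (Fin 2) (Fin 2) ℝ :=
  A.toBlocks₁₁ - Matrix.of U * A.toBlocks₂₁

lemma vf_add_smul (A : Matrix Ix Ix ℝ) (U H : Jet) (s : ℝ) :
    vf A (U + s • H) = vf A U + s • isotropy (linLeft A U) (denom A U) H
      - (s ^ 2 / 2) • sandwich A.toBlocks₂₁ H H := by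
  have e : ∀ V, vf A V = Matrix.of.symm (A.toBlocks₁₁ * Matrix.of V + A.toBlocks₁₂
      - Matrix.of V * (A.toBlocks₂₁ * Matrix.of V + A.toBlocks₂₂)) := fun _ => rfl
  rw [e, e]
  ext i j
  simp only [isotropy, sandwich, linLeft, denom, Pi.add_apply, Pi.sub_apply, Pi.smul_apply,
    smul_eq_mul, Matrix.of_symm_apply, Matrix.sub_apply, Matrix.add_apply, Matrix.mul_apply,
    Fin.sum_univ_three, Fin.sum_univ_two, Matrix.of_apply]
  ring

lemma isotropy_add_smul (A : Matrix Ix Ix ℝ) (U H K : Jet) (s : ℝ) :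
    isotropy (linLeft A (U + s • H)) (denom A (U + s • H)) K
      = isotropy (linLeft A U) (denom A U) K - s • sandwich A.toBlocks₂₁ H K := by
  ext i j
  simp only [isotropy, sandwich, linLeft, denom, Pi.add_apply, Pi.sub_apply, Pi.smul_apply,
    smul_eq_mul, Matrix.of_symm_apply, Matrix.sub_apply, Matrix.add_apply, Matrix.mul_apply,
    Fin.sum_univ_three, Fin.sum_univ_two, Matrix.of_apply]
  ring

lemma contDiff_vf (A : Matrix Ix Ix ℝ) : ContDiff ℝ ∞ (vf A) := by
  have e : ∀ V, vf A V = Matrix.of.symm (A.toBlocks₁₁ * Matrix.of V + A.toBlocks₁₂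
      - Matrix.of V * (A.toBlocks₂₁ * Matrix.of V + A.toBlocks₂₂)) := fun _ => rfl
  rw [funext e]
  refine contDiff_pi.mpr fun i => contDiff_pi.mpr fun j => ?_
  simp only [Matrix.of_symm_apply, Matrix.sub_apply, Matrix.add_apply, Matrix.mul_apply,
    Fin.sum_univ_three, Fin.sum_univ_two, Matrix.of_apply]
  fun_prop

lemma fderiv_vf (A : Matrix Ix Ix ℝ) (U H : Jet) :
    fderiv ℝ (vf A) U H = isotropy (linLeft A U) (denom A U) H := by
  have h1 := hasDerivAt_comp_line ((contDiff_vf A).differentiable (by simp) U) H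
  simp only [vf_add_smul] at h1
  have h2 := (((hasDerivAt_id (0 : ℝ)).smul_const (isotropy (linLeft A U) (denom A U) H)).const_add
    (vf A U)).sub (((hasDerivAt_pow 2 (0 : ℝ)).div_const 2).smul_const
      (sandwich A.toBlocks₂₁ H H))
  rw [h1.unique h2]
  simp

lemma fderiv_fderiv_vf (A : Matrix Ix Ix ℝ) (U H K : Jet) :
    fderiv ℝ (fderiv ℝ (vf A)) U H K = - sandwich A.toBlocks₂₁ H K := by
  have h0 := ((contDiff_vf A).contDiffAt (x := U))
  have h1 := (hasDerivAt_comp_line ((contDiffAt_fderiv h0).differentiableAt (by simp)) H).clm_apply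
    (hasDerivAt_const (0 : ℝ) K)
  rw [map_zero, add_zero] at h1
  simp only [fderiv_vf, isotropy_add_smul] at h1
  have h2 := ((hasDerivAt_id (0 : ℝ)).smul_const (sandwich A.toBlocks₂₁ H K)).const_sub
    (isotropy (linLeft A U) (denom A U) K)
  have h3 := h1.unique h2
  rw [one_smul] at h3
  exact h3

/-- A vector field that is tangent to the fourfold. -/
def IsSymmetry (Ω : Set Jet) (F G : Jet → ℝ) (A : Matrix Ix Ix ℝ) : Prop :=
  ∀ V ∈ fourfold Ω F G, fderiv ℝ F V (vf A V) = 0 ∧ fderiv ℝ G V (vf A V) = 0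

/-- The first derivative of the tangency condition. -/
lemma IsRegular.tangency_first (hR : IsRegular Ω F G) (hU : U ∈ fourfold Ω F G)
    (hK : ContDiffAt ℝ ∞ K U) {A : Matrix Ix Ix ℝ}
    (hA : ∀ V ∈ fourfold Ω F G, fderiv ℝ K V (vf A V) = 0) {H : Jet}
    (h1 : fderiv ℝ F U H = 0) (h2 : fderiv ℝ G U H = 0) :
    hess K U H (vf A U) + fderiv ℝ K U (fderiv ℝ (vf A) U H) = 0 := by
  have d := ((contDiffAt_fderiv hK).differentiableAt (by simp)).hasFDerivAt.clm_apply
    ((contDiff_vf A).differentiable (by simp) U).hasFDerivAt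
  have := hR.fderiv_eq_zero hU d (Filter.Eventually.of_forall hA) h1 h2
  rw [add_comm]
  simpa [hess] using this

/-- The second derivative of the tangency condition, at a zero of the vector field. -/
lemma IsRegular.tangency_second (hR : IsRegular Ω F G) (hU : U ∈ fourfold Ω F G)
    (hK : ∀ V ∈ Ω, ContDiffAt ℝ ∞ K V) {A : Matrix Ix Ix ℝ}
    (hA : ∀ V ∈ fourfold Ω F G, fderiv ℝ K V (vf A V) = 0) (h0 : vf A U = 0) {H : Jet}
    (h1 : fderiv ℝ F U H = 0) (h2 : fderiv ℝ G U H = 0) (k : Fin 4) :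
    hess K U (tframe F G k U) (fderiv ℝ (vf A) U H)
      + hess K U H (fderiv ℝ (vf A) U (tframe F G k U))
      + fderiv ℝ K U (fderiv ℝ (vf A) U (fderiv ℝ (tframe F G k) U H))
      = fderiv ℝ K U (sandwich A.toBlocks₂₁ H (tframe F G k U)) := by
  have hz : ∀ V ∈ fourfold Ω F G, hess K V (tframe F G k V) (vf A V)
      + fderiv ℝ K V (fderiv ℝ (vf A) V (tframe F G k V)) = 0 := fun V hV =>
    hR.tangency_first hV (hK V hV.1) hA (IsRegular.tframe_left k) (IsRegular.tframe_right k)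
  have ch : DifferentiableAt ℝ (hess K) U :=
    (contDiffAt_fderiv (contDiffAt_fderiv (hK U hU.1))).differentiableAt (by simp)
  have cf : DifferentiableAt ℝ (fderiv ℝ K) U :=
    (contDiffAt_fderiv (hK U hU.1)).differentiableAt (by simp)
  have ct : DifferentiableAt ℝ (tframe F G k) U :=
    (hR.contDiffAt_tframe hU.1 k).differentiableAt (by simp)
  have cv : DifferentiableAt ℝ (vf A) U := (contDiff_vf A).differentiable (by simp) U
  have cv' : DifferentiableAt ℝ (fderiv ℝ (vf A)) U :=
    (contDiffAt_fderiv (contDiff_vf A).contDiffAt).differentiableAt (by simp)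
  let f : Jet → ℝ := fun V => hess K V (tframe F G k V) (vf A V)
      + fderiv ℝ K V (fderiv ℝ (vf A) V (tframe F G k V))
  have hf : DifferentiableAt ℝ f U :=
    ((ch.clm_apply ct).clm_apply cv).add (cf.clm_apply (cv'.clm_apply ct))
  have d1 : HasDerivAt (fun s : ℝ => f (U + s • H)) 0 0 :=
    hR.hasDerivAt_line hU hf (Filter.Eventually.of_forall hz) h1 h2
  have lt := hasDerivAt_comp_line ct H
  have lh : HasDerivAt (fun s : ℝ => hess K (U + s • H)) (fderiv ℝ (hess K) U H) 0 :=
    hasDerivAt_comp_line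
      ((contDiffAt_fderiv (contDiffAt_fderiv (hK U hU.1))).differentiableAt (by simp)) H
  have lf : HasDerivAt (fun s : ℝ => fderiv ℝ K (U + s • H)) (hess K U H) 0 :=
    hasDerivAt_comp_line cf H
  have lv : HasDerivAt (fun s : ℝ => fderiv ℝ (vf A) (U + s • H))
      (fderiv ℝ (fderiv ℝ (vf A)) U H) 0 :=
    hasDerivAt_comp_line cv' H
  have a1 := lh.clm_apply lt
  have a2 := a1.clm_apply (hasDerivAt_comp_line cv H)
  have b1 := lv.clm_apply lt
  have b2 := lf.clm_apply b1
  have d2 := a2.add b2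
  have d3 := d2.unique d1
  simp only [zero_smul, add_zero, h0, map_zero, zero_add, map_add, fderiv_fderiv_vf,
    map_neg] at d3
  change _ + (hess K U H _ + _) = 0 at d3
  linear_combination d3

lemma IsRegular.fderiv_tframe_of_tangent (hR : IsRegular Ω F G) (hU : U ∈ Ω)
    (hK : ContDiffAt ℝ ∞ K U) (k : Fin 4)
    (ht : ∀ V, fderiv ℝ K V (tframe F G k V) = 0) (H : Jet) :
    fderiv ℝ K U (fderiv ℝ (tframe F G k) U H) = - hess K U H (tframe F G k U) := by
  have d := (hasDerivAt_comp_line ((contDiffAt_fderiv hK).differentiableAt (by simp)) H).clm_apply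
    (hasDerivAt_comp_line ((hR.contDiffAt_tframe hU k).differentiableAt (by simp)) H)
  simp only [ht] at d
  have := d.unique (hasDerivAt_const _ _)
  simp only [zero_smul, add_zero] at this
  change hess K U H _ + _ = 0 at this
  linarith

lemma isSymmetry_of_mem {H : Subgroup (Matrix.SpecialLinearGroup Ix ℝ)}
    {𝔥 : Submodule ℝ (Matrix Ix Ix ℝ)} (hR : IsRegular Ω F G)
    (hinv : ∀ U ∈ fourfold Ω F G, ∀ᶠ A in 𝓝 (0 : Matrix Ix Ix ℝ), A ∈ 𝔥 →
      act (NormedSpace.exp A) U ∈ fourfold Ω F G) {A : Matrix Ix Ix ℝ} (hA : A ∈ 𝔥) :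
    IsSymmetry Ω F G A := by
  intro V hV
  have ht : Filter.Tendsto (fun t : ℝ => t • A) (𝓝 0) (𝓝 0) := by
    have : Continuous fun t : ℝ => t • A := by fun_prop
    simpa using this.tendsto 0
  have he := (ht.eventually (hinv V hV)).mono fun t h => h (𝔥.smul_mem t hA)
  have hd := hasDerivAt_act_zero A V
  have key : ∀ K : Jet → ℝ, ContDiffAt ℝ ∞ K V → (∀ W ∈ fourfold Ω F G, K W = 0) →
      fderiv ℝ K V (vf A V) = 0 := by
    intro K hK hz
    have d1 := (hK.differentiableAt (by simp)).hasFDerivAt.comp_hasDerivAt_of_eq (0 : ℝ) hd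
      (by simp [NormedSpace.exp_zero, act_one])
    refine d1.unique ((hasDerivAt_const (0 : ℝ) (0 : ℝ)).congr_of_eventuallyEq ?_)
    filter_upwards [he] with t h
    exact hz _ h
  exact ⟨key F (hR.contDiffAt_left hV.1) fun W hW => hW.2.1,
    key G (hR.contDiffAt_right hV.1) fun W hW => hW.2.2⟩

lemma trace_linLeft (A : Matrix Ix Ix ℝ) (U : Jet) :
    (linLeft A U).trace + (denom A U).trace = A.trace := by
  conv_rhs => rw [← Matrix.fromBlocks_toBlocks A, trace_eq_blocks]
  rw [linLeft, denom, Matrix.trace_sub, Matrix.trace_add, Matrix.trace_mul_comm (Matrix.of U)]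
  ring

/-- The isotropy at `U` of a symmetry that vanishes there. -/
lemma IsSymmetry.isotropy_mem (hR : IsRegular Ω F G) (hU : U ∈ fourfold Ω F G) {A : Matrix Ix Ix ℝ}
    (hA : IsSymmetry Ω F G A) (h0 : vf A U = 0) (k : Fin 4) :
    fderiv ℝ F U (isotropy (linLeft A U) (denom A U) (tframe F G k U)) = 0 ∧
      fderiv ℝ G U (isotropy (linLeft A U) (denom A U) (tframe F G k U)) = 0 := by
  have h1 := hR.tangency_first hU (hR.contDiffAt_left hU.1) (fun V hV => (hA V hV).1)
    (IsRegular.tframe_left k) (IsRegular.tframe_right k)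
  have h2 := hR.tangency_first hU (hR.contDiffAt_right hU.1) (fun V hV => (hA V hV).2)
    (IsRegular.tframe_left k) (IsRegular.tframe_right k)
  rw [h0, map_zero, zero_add, fderiv_vf] at h1 h2
  exact ⟨h1, h2⟩

lemma isotropy_sub (a a' : Matrix (Fin 2) (Fin 2) ℝ) (d d' : Matrix (Fin 3) (Fin 3) ℝ) (H : Jet) :
    isotropy (a - a') (d - d') H = isotropy a d H - isotropy a' d' H := by
  ext i j
  simp only [isotropy_apply, Matrix.sub_apply, Matrix.vecMul_sub, Pi.add_apply, Pi.sub_apply,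
    Pi.smul_apply, smul_eq_mul]
  ring

lemma isotropy_scalar (r s : ℝ) (H : Jet) : isotropy (r • 1) (s • 1) H = (r - s) • H := by
  ext i j
  fin_cases i <;>
  simp [isotropy_apply, Matrix.vecMul_smul] <;> ring

/-- A traceless symmetry that vanishes at `U` and is a multiple of the identity on the left is
a multiple of the identity there. -/
lemma IsSymmetry.denom_eq (hR : IsRegular Ω F G) (hU : U ∈ fourfold Ω F G) {A : Matrix Ix Ix ℝ}
    (hA : IsSymmetry Ω F G A) (h0 : vf A U = 0) (htr : A.trace = 0) {r : ℝ}
    (hr : linLeft A U = (3 * r) • (1 : Matrix (Fin 2) (Fin 2) ℝ)) :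
    denom A U = (- 2 * r) • (1 : Matrix (Fin 3) (Fin 3) ℝ) := by
  -- A left multiple of the identity acts on every matrix as a scalar and so preserves the tangent
  -- space; subtracting it reduces to an isotropy with zero left part.
  have e : ∀ k, isotropy 0 (denom A U - (0 : ℝ) • 1) (tframe F G k U)
      = isotropy (linLeft A U) (denom A U) (tframe F G k U) - (3 * r) • tframe F G k U := by
    intro k
    have := isotropy_scalar (3 * r) 0 (tframe F G k U)
    rw [sub_zero] at this
    rw [← this, ← isotropy_sub, hr, sub_self]
  have hiso := fun k => hA.isotropy_mem hR hU h0 k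
  obtain ⟨m, hm⟩ := eq_scalar_of_isotropy (hR.conicDet_ne_zero hU) (d := denom A U - (0 : ℝ) • 1)
    (fun k => by
      change fderiv ℝ F U (isotropy 0 _ (tframe F G k U)) = 0
      rw [e, map_sub, (hiso k).1, map_smul, IsRegular.tframe_left, smul_zero, sub_zero])
    (fun k => by
      change fderiv ℝ G U (isotropy 0 _ (tframe F G k U)) = 0
      rw [e, map_sub, (hiso k).2, map_smul, IsRegular.tframe_right, smul_zero, sub_zero])
  rw [zero_smul, sub_zero] at hm
  have ht := trace_linLeft A U
  rw [htr, hr, hm, Matrix.trace_smul, Matrix.trace_smul, Matrix.trace_one, Matrix.trace_one] at ht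
  have : m = -2 * r := by
    simp at ht
    linarith
  rw [hm, this]

/-- A symmetry is determined by its value and left linear part at a point. -/
lemma IsSymmetry.eq_zero (hR : IsRegular Ω F G) (hU : U ∈ fourfold Ω F G) {A : Matrix Ix Ix ℝ}
    (hA : IsSymmetry Ω F G A) (h0 : vf A U = 0) (htr : A.trace = 0) (hl : linLeft A U = 0) :
    A = 0 := by
  have hd : denom A U = 0 := by
    rw [hA.denom_eq hR hU h0 htr (r := 0) (by simp [hl])]
    simp
  have hz : ∀ H, fderiv ℝ (vf A) U H = 0 := fun H => by
    rw [fderiv_vf, hl, hd, ← isotropyL_apply]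
    ext i j
    rw [isotropyL_apply, isotropy_apply]
    simp
  -- The first derivative of the vector field is zero at U, so the second derivative of the tangency
  -- condition involves its quadratic part alone. The corresponding minors vanish on the tangent
  -- space, and hence so do their coefficients.
  have hp : ∀ K : Jet → ℝ, (∀ V ∈ Ω, ContDiffAt ℝ ∞ K V) →
      (∀ V ∈ fourfold Ω F G, fderiv ℝ K V (vf A V) = 0) →
      (∀ k, fderiv ℝ K U (tframe F G k U) = 0) →
      shiftCoeff (fderiv ℝ K U) (Matrix.of.symm A.toBlocks₂₁ᵀ) = 0 := by
    intro K hK hs ht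
    refine minorForm_injective (hR.conicDet_ne_zero hU) fun j k => ?_
    have := hR.tangency_second hU hK hs h0 (IsRegular.tframe_left j) (IsRegular.tframe_right j) k
    simp only [hz, map_zero, add_zero, apply_sandwich, ht, mul_zero, zero_sub] at this
    exact neg_eq_zero.mp this.symm
  have hc := shiftCoeff_injective (hR.conicDet_ne_zero hU)
    (hp F (fun V hV => hR.contDiffAt_left hV) (fun V hV => (hA V hV).1)
      fun k => IsRegular.tframe_left k)
    (hp G (fun V hV => hR.contDiffAt_right hV) (fun V hV => (hA V hV).2)
      fun k => IsRegular.tframe_right k)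
  have h21 : A.toBlocks₂₁ = 0 := by
    ext i j
    exact congrFun (congrFun hc j) i
  have h22 : A.toBlocks₂₂ = 0 := by
    rwa [denom, h21, Matrix.zero_mul, zero_add] at hd
  have h11 : A.toBlocks₁₁ = 0 := by
    rwa [linLeft, h21, Matrix.mul_zero, sub_zero] at hl
  have h12 : A.toBlocks₁₂ = 0 := by
    rw [vf, numer, hd, h11, Matrix.zero_mul, zero_add, Matrix.mul_zero, sub_zero] at h0
    exact h0
  rw [← Matrix.fromBlocks_toBlocks A, h11, h12, h21, h22, Matrix.fromBlocks_zero]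

lemma linLeft_add (A B : Matrix Ix Ix ℝ) (U : Jet) :
    linLeft (A + B) U = linLeft A U + linLeft B U := by
  have e1 : (A + B).toBlocks₁₁ = A.toBlocks₁₁ + B.toBlocks₁₁ := rfl
  have e2 : (A + B).toBlocks₂₁ = A.toBlocks₂₁ + B.toBlocks₂₁ := rfl
  rw [linLeft, linLeft, linLeft, e1, e2, Matrix.mul_add]
  abel

lemma linLeft_smul (r : ℝ) (A : Matrix Ix Ix ℝ) (U : Jet) :
    linLeft (r • A) U = r • linLeft A U := by
  have e1 : (r • A).toBlocks₁₁ = r • A.toBlocks₁₁ := rfl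
  have e2 : (r • A).toBlocks₂₁ = r • A.toBlocks₂₁ := rfl
  rw [linLeft, linLeft, e1, e2, Matrix.mul_smul, smul_sub]

/-- An eight-dimensional algebra of symmetries contains an element that acts by dilations at a
given point. -/
lemma exists_dilation {𝔥 : Submodule ℝ (Matrix Ix Ix ℝ)} (hR : IsRegular Ω F G)
    (hU : U ∈ fourfold Ω F G) (hdim : Module.finrank ℝ 𝔥 = 8)
    (hs : ∀ A ∈ 𝔥, IsSymmetry Ω F G A) (htr : ∀ A ∈ 𝔥, A.trace = 0) :
    ∃ A ∈ 𝔥, vf A U = 0 ∧ linLeft A U = (3 : ℝ) • (1 : Matrix (Fin 2) (Fin 2) ℝ) := by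
  let f : 𝔥 →ₗ[ℝ] pencilKer (fderiv ℝ F U) (fderiv ℝ G U) × Matrix (Fin 2) (Fin 2) ℝ :=
    { toFun := fun A => (⟨vf A.1 U, mem_pencilKer.mpr (hs A.1 A.2 U hU)⟩, linLeft A.1 U)
      map_add' := fun A B => Prod.ext (Subtype.ext (vf_add A.1 B.1 U)) (linLeft_add A.1 B.1 U)
      map_smul' := fun r A => Prod.ext (Subtype.ext (vf_smul r A.1 U)) (linLeft_smul r A.1 U) }
  have hinj : Function.Injective f := by
    rw [injective_iff_map_eq_zero]
    rintro ⟨A, hA⟩ h0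
    exact Subtype.ext ((hs A hA).eq_zero hR hU (congrArg Subtype.val (congrArg Prod.fst h0))
      (htr A hA) (congrArg Prod.snd h0))
  -- The target also has dimension eight, as the sum of the tangent space and the 2 × 2 matrices, so
  -- the injective map f is onto.
  have hsurj : Function.Surjective f := by
    refine (LinearMap.injective_iff_surjective_of_finrank_eq_finrank ?_).mp hinj
    rw [hdim, Module.finrank_prod, finrank_pencilKer (hR.conicDet_ne_zero hU),
      Module.finrank_matrix]
    simp
  obtain ⟨⟨A, hA⟩, h⟩ := hsurj (0, (3 : ℝ) • 1)
  exact ⟨A, hA, congrArg Subtype.val (congrArg Prod.fst h), congrArg Prod.snd h⟩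

theorem IsRegular.isRankOneFlat_of_isInvariant (hR : IsRegular Ω F G)
    (h : IsInvariantUnderSubgroupOfDim 8 Ω F G) : IsRankOneFlat Ω F G := by
  obtain ⟨H, 𝔥, hL, hdim, hinv⟩ := h
  have hs : ∀ A ∈ 𝔥, IsSymmetry Ω F G A := fun A hA => isSymmetry_of_mem (H := H) hR hinv hA
  have htr : ∀ A ∈ 𝔥, A.trace = 0 := fun A hA => trace_eq_zero_of_det_exp fun t => by
    obtain ⟨M, -, hM⟩ := (hL A).mp hA t
    rw [← hM]
    exact M.2
  intro U hU x y
  obtain ⟨A, hA, h0, hl⟩ := exists_dilation hR hU hdim hs htr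
  have hd := (hs A hA).denom_eq hR hU h0 (htr A hA) (r := 1) (by simpa using hl)
  -- The left part is 3 and, by tracelessness, the right part is -2, as 2 · 3 + 3 · (-2) = 0; the
  -- field therefore dilates by 3 - (-2) = 5.
  have h5 : ∀ H, fderiv ℝ (vf A) U H = (5 : ℝ) • H := fun H => by
    rw [fderiv_vf, hl, hd, isotropy_scalar]
    norm_num
  have key : ∀ K : Jet → ℝ, (∀ V ∈ Ω, ContDiffAt ℝ ∞ K V) →
      (∀ V ∈ fourfold Ω F G, fderiv ℝ K V (vf A V) = 0) →
      (∀ k V, fderiv ℝ K V (tframe F G k V) = 0) →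
      hess K U (tchar F G x y U) (tchar F G x y U) = 0 := by
    intro K hK hv ht
    set t := tchar F G x y U with htdef
    have h1 : fderiv ℝ F U t = 0 := apply_charDir_left _ _ x y
    have h2 : fderiv ℝ G U t = 0 := apply_charDir_right _ _ x y
    -- Tangency to second order contributes the Hessian ten times from the dilation and minus five
    -- times from the derivative of the frame. The remaining five equal minors, up to a term with
    -- the differential of K at t, which is zero.
    have e : ∀ k, 5 * hess K U t (tframe F G k U)
        = - minorForm (shiftCoeff (fderiv ℝ K U) (Matrix.of.symm A.toBlocks₂₁ᵀ)) t
          (tframe F G k U) + (A.toBlocks₂₁ * Matrix.of (tframe F G k U)).trace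
            * fderiv ℝ K U t := by
      intro k
      have := hR.tangency_second hU hK hv h0 h1 h2 k
      simp only [h5, map_smul, smul_eq_mul, apply_sandwich, ht,
        hR.fderiv_tframe_of_tangent hU.1 (hK U hU.1) k (ht k)] at this
      rw [hess_comm (hK U hU.1) (tframe F G k U) t] at this
      linarith
    have ht' : t = x ^ 3 • tframe F G 0 U + (x ^ 2 * y) • tframe F G 1 U
      + (x * y ^ 2) • tframe F G 2 U + y ^ 3 • tframe F G 3 U := rfl
    have ht0 : fderiv ℝ K U t = 0 := by
      rw [ht']
      simp [ht]
    have hm : minorForm (shiftCoeff (fderiv ℝ K U) (Matrix.of.symm A.toBlocks₂₁ᵀ)) t t = 0 :=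
      minorForm_charDir _ _ _ x y
    have e2 : ∀ L : Jet →L[ℝ] ℝ, L t = x ^ 3 * L (tframe F G 0 U)
        + x ^ 2 * y * L (tframe F G 1 U) + x * y ^ 2 * L (tframe F G 2 U)
        + y ^ 3 * L (tframe F G 3 U) := by
      intro L
      conv_lhs => rw [ht']
      simp
    have e3 := e2 (minorFormL (shiftCoeff (fderiv ℝ K U) (Matrix.of.symm A.toBlocks₂₁ᵀ)) t)
    simp only [minorFormL_apply, hm] at e3
    rw [e2 (hess K U t)]
    have k0 := e 0
    have k1 := e 1
    have k2 := e 2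
    have k3 := e 3
    rw [ht0, mul_zero, add_zero] at k0 k1 k2 k3
    linear_combination (x ^ 3 * k0 + x ^ 2 * y * k1 + x * y ^ 2 * k2 + y ^ 3 * k3 + e3) / 5
  exact ⟨key F (fun V hV => hR.contDiffAt_left hV) (fun V hV => (hs A hA V hV).1)
      fun k V => IsRegular.tframe_left k,
    key G (fun V hV => hR.contDiffAt_right hV) (fun V hV => (hs A hA V hV).2)
      fun k V => IsRegular.tframe_right k⟩

end

/-! ## Partial derivatives -/

section PartialDerivatives

variable {f g : (Fin 3 → ℝ) → ℝ} {x : Fin 3 → ℝ} {i j : Fin 3}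

lemma pd_add (hf : DifferentiableAt ℝ f x) (hg : DifferentiableAt ℝ g x) :
    pd i (fun y => f y + g y) x = pd i f x + pd i g x := by
  rw [pd, fderiv_fun_add hf hg]; rfl

lemma pd_sub (hf : DifferentiableAt ℝ f x) (hg : DifferentiableAt ℝ g x) :
    pd i (fun y => f y - g y) x = pd i f x - pd i g x := by
  rw [pd, fderiv_fun_sub hf hg]; rfl

lemma pd_mul (hf : DifferentiableAt ℝ f x) (hg : DifferentiableAt ℝ g x) :
    pd i (fun y => f y * g y) x = pd i f x * g x + f x * pd i g x := by
  rw [pd, fderiv_fun_mul hf hg]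
  simp [pd]
  ring

lemma pd_const (r : ℝ) : pd i (fun _ => r) x = 0 := by
  rw [pd]; simp

lemma pd_neg : pd i (fun y => - f y) x = - pd i f x := by
  rw [pd, fderiv_fun_neg]; rfl

lemma pd_congr (h : f =ᶠ[𝓝 x] g) : pd i f x = pd i g x := by
  rw [pd, pd, h.fderiv_eq]

lemma pd_congr_of_isOpen {N : Set (Fin 3 → ℝ)} (hN : IsOpen N) (hx : x ∈ N)
    (h : ∀ y ∈ N, f y = g y) : pd i f x = pd i g x :=
  pd_congr ((hN.eventually_mem hx).mono h)

lemma contDiffAt_pd (hf : ContDiffAt ℝ ∞ f x) : ContDiffAt ℝ ∞ (pd i f) x :=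
  (contDiffAt_fderiv hf).clm_apply contDiffAt_const

lemma pd_pd_comm (hf : ContDiffAt ℝ ∞ f x) : pd i (pd j f) x = pd j (pd i f) x := by
  have hd := (contDiffAt_fderiv hf).differentiableAt (by simp)
  have e : ∀ i j, pd i (pd j f) x = fderiv ℝ (fderiv ℝ f) x (Pi.single i 1) (Pi.single j 1) := by
    intro i j
    have := (hd.hasFDerivAt.clm_apply (hasFDerivAt_const (Pi.single j (1 : ℝ)) x)).fderiv
    change fderiv ℝ (fun y => fderiv ℝ f y (Pi.single j 1)) x _ = _
    rw [this]
    simp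
  rw [e, e]
  have hs : IsSymmSndFDerivAt ℝ f x :=
    hf.isSymmSndFDerivAt (by
      rw [minSmoothness_of_isRCLikeNormedField]
      exact WithTop.coe_le_coe.mpr (le_top : (2 : ℕ∞) ≤ ⊤))
  exact hs.eq _ _

end PartialDerivatives

lemma contDiffAt_inv_apply {E : Type*} [NormedAddCommGroup E] [NormedSpace ℝ E] {n : ℕ∞ω}
    {M : E → Matrix (Fin 3) (Fin 3) ℝ} {x : E} (hM : ∀ i j, ContDiffAt ℝ n (fun y => M y i j) x)
    (hdet : (M x).det ≠ 0) (i j : Fin 3) : ContDiffAt ℝ n (fun y => (M y)⁻¹ i j) x := by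
  have e : (fun y => (M y)⁻¹ i j) = fun y => ((M y).det)⁻¹ * (M y).adjugate i j := by
    ext y
    rw [Matrix.inv_def, Ring.inverse_eq_inv', Matrix.smul_apply, smul_eq_mul]
  rw [e]
  refine ContDiffAt.mul (ContDiffAt.inv ?_ hdet) ?_
  · simp only [Matrix.det_fin_three]
    fun_prop (disch := assumption)
  · fin_cases i <;> fin_cases j <;>
    · simp [Matrix.adjugate_fin_three]
      fun_prop (disch := assumption)

/-! ## The Cotton tensor of a conformally flat metric -/

/-- A flat metric in dimension three. -/
def eta (u v : Fin 3 → ℝ) : ℝ := 2 * (u 0 * v 2 + u 2 * v 0) - u 1 * v 1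

/-- The matrix of `eta`. -/
def etaMat : Matrix (Fin 3) (Fin 3) ℝ := !![0, 0, 2; 0, -1, 0; 2, 0, 0]

/-- The inverse of `etaMat`. -/
def etaInv : Matrix (Fin 3) (Fin 3) ℝ := !![0, 0, 1 / 2; 0, -1, 0; 1 / 2, 0, 0]

lemma etaMat_mul_etaInv : etaMat * etaInv = 1 := by
  ext i j
  fin_cases i <;> fin_cases j <;> simp [etaMat, etaInv, Matrix.mul_apply, Fin.sum_univ_three]

/-- Index raising with `etaInv`. -/
def raise (v : Fin 3 → ℝ) : Fin 3 → ℝ := ![v 2 / 2, - v 1, v 0 / 2]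

lemma raise_zero (v : Fin 3 → ℝ) : raise v 0 = v 2 / 2 := rfl

lemma raise_one (v : Fin 3 → ℝ) : raise v 1 = - v 1 := rfl

lemma raise_two (v : Fin 3 → ℝ) : raise v 2 = v 0 / 2 := rfl

/-- The metric `g` is `c` times the pull-back of `eta` by a coframe `J` of closed forms, and `h` are
the components of `dc / 2c` in this coframe. -/
structure IsConformallyFlatOn (N : Set (Fin 3 → ℝ))
    (g : (Fin 3 → ℝ) → Matrix (Fin 3) (Fin 3) ℝ) (c : (Fin 3 → ℝ) → ℝ)
    (J : Fin 3 → Fin 3 → (Fin 3 → ℝ) → ℝ) (h : Fin 3 → (Fin 3 → ℝ) → ℝ) : Prop where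
  isOpen : IsOpen N
  smooth_c : ∀ x ∈ N, ContDiffAt ℝ ∞ c x
  smooth_J : ∀ x ∈ N, ∀ a i, ContDiffAt ℝ ∞ (J a i) x
  smooth_h : ∀ x ∈ N, ∀ a, ContDiffAt ℝ ∞ (h a) x
  c_ne : ∀ x ∈ N, c x ≠ 0
  det_ne : ∀ x ∈ N, (Matrix.of fun a i => J a i x).det ≠ 0
  metric : ∀ x ∈ N, ∀ i j, g x i j = c x * eta (fun a => J a i x) fun a => J a j x
  closed : ∀ x ∈ N, ∀ a i j, pd i (J a j) x = pd j (J a i) x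
  pd_c : ∀ x ∈ N, ∀ i, pd i c x = 2 * c x * (J 0 i x * h 0 x + J 1 i x * h 1 x + J 2 i x * h 2 x)
  symm : ∀ x ∈ N, ∀ i j,
    J 0 j x * pd i (h 0) x + J 1 j x * pd i (h 1) x + J 2 j x * pd i (h 2) x
      = J 0 i x * pd j (h 0) x + J 1 i x * pd j (h 1) x + J 2 i x * pd j (h 2) x

section Cotton

variable {N : Set (Fin 3 → ℝ)} {g : (Fin 3 → ℝ) → Matrix (Fin 3) (Fin 3) ℝ}
  {c : (Fin 3 → ℝ) → ℝ} {J : Fin 3 → Fin 3 → (Fin 3 → ℝ) → ℝ} {h : Fin 3 → (Fin 3 → ℝ) → ℝ}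
  {x : Fin 3 → ℝ}

/-- The components of `dc / 2c` in coordinates. -/
def logDeriv (J : Fin 3 → Fin 3 → (Fin 3 → ℝ) → ℝ) (h : Fin 3 → (Fin 3 → ℝ) → ℝ) (i : Fin 3)
    (y : Fin 3 → ℝ) : ℝ :=
  J 0 i y * h 0 y + J 1 i y * h 1 y + J 2 i y * h 2 y

/-- The Levi-Civita connection with upper index in the coframe. -/
def connection (J : Fin 3 → Fin 3 → (Fin 3 → ℝ) → ℝ) (h : Fin 3 → (Fin 3 → ℝ) → ℝ)
    (b i j : Fin 3) (y : Fin 3 → ℝ) : ℝ :=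
  pd i (J b j) y + J b i y * logDeriv J h j y + J b j y * logDeriv J h i y
    - eta (fun a => J a i y) (fun a => J a j y) * raise (fun a => h a y) b

/-- The negative of the Schouten tensor. -/
def negSchouten (J : Fin 3 → Fin 3 → (Fin 3 → ℝ) → ℝ) (h : Fin 3 → (Fin 3 → ℝ) → ℝ)
    (p q : Fin 3) (y : Fin 3 → ℝ) : ℝ :=
  (J 0 q y * pd p (h 0) y + J 1 q y * pd p (h 1) y + J 2 q y * pd p (h 2) y)
    - logDeriv J h p y * logDeriv J h q y
    + 1 / 2 * eta (fun a => J a p y) (fun a => J a q y) * (h 0 y * h 2 y - h 1 y * h 1 y)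

/-- The inverse of the coframe. -/
def dualFrame (J : Fin 3 → Fin 3 → (Fin 3 → ℝ) → ℝ) (y : Fin 3 → ℝ) : Matrix (Fin 3) (Fin 3) ℝ :=
  (Matrix.of fun a i => J a i y)⁻¹

lemma IsConformallyFlatOn.metric_eq (hf : IsConformallyFlatOn N g c J h) (hx : x ∈ N) :
    g x = c x • ((Matrix.of fun a i => J a i x)ᵀ * etaMat * (Matrix.of fun a i => J a i x)) := by
  ext i j
  rw [hf.metric x hx i j, Matrix.smul_apply, smul_eq_mul]
  congr 1
  simp [eta, etaMat, Matrix.mul_apply, Fin.sum_univ_three]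
  ring

lemma IsConformallyFlatOn.mul_dualFrame (hf : IsConformallyFlatOn N g c J h) (hx : x ∈ N) :
    (Matrix.of fun a i => J a i x) * dualFrame J x = 1 :=
  Matrix.mul_nonsing_inv _ (isUnit_iff_ne_zero.mpr (hf.det_ne x hx))

lemma IsConformallyFlatOn.dualFrame_mul (hf : IsConformallyFlatOn N g c J h) (hx : x ∈ N) :
    dualFrame J x * (Matrix.of fun a i => J a i x) = 1 :=
  Matrix.nonsing_inv_mul _ (isUnit_iff_ne_zero.mpr (hf.det_ne x hx))

lemma IsConformallyFlatOn.mul_inv (hf : IsConformallyFlatOn N g c J h) (hx : x ∈ N) :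
    g x * ((c x)⁻¹ • (dualFrame J x * etaInv * (dualFrame J x)ᵀ)) = 1 := by
  have e : (Matrix.of fun a i => J a i x)ᵀ * (dualFrame J x)ᵀ = 1 := by
    rw [← Matrix.transpose_mul, hf.dualFrame_mul hx, Matrix.transpose_one]
  rw [hf.metric_eq hx, Matrix.smul_mul, Matrix.mul_smul, smul_smul,
    mul_inv_cancel₀ (hf.c_ne x hx), one_smul]
  calc _ = (Matrix.of fun a i => J a i x)ᵀ * (etaMat * (((Matrix.of fun a i => J a i x)
        * dualFrame J x) * etaInv)) * (dualFrame J x)ᵀ := by simp only [Matrix.mul_assoc]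
    _ = 1 := by
      rw [hf.mul_dualFrame hx, Matrix.one_mul, etaMat_mul_etaInv, Matrix.mul_one, e]

lemma IsConformallyFlatOn.inv_eq (hf : IsConformallyFlatOn N g c J h) (hx : x ∈ N) :
    (g x)⁻¹ = (c x)⁻¹ • (dualFrame J x * etaInv * (dualFrame J x)ᵀ) :=
  Matrix.inv_eq_right_inv (hf.mul_inv hx)

lemma IsConformallyFlatOn.pd_metric (hf : IsConformallyFlatOn N g c J h) (hx : x ∈ N)
    (i j l : Fin 3) : pd i (fun y => g y j l) x
      = c x * (2 * logDeriv J h i x * eta (fun a => J a j x) (fun a => J a l x)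
        + eta (fun a => pd i (J a j) x) (fun a => J a l x)
        + eta (fun a => J a j x) (fun a => pd i (J a l) x)) := by
  rw [pd_congr_of_isOpen hf.isOpen hx fun y hy => hf.metric y hy j l]
  have hc := (hf.smooth_c x hx).differentiableAt (by simp)
  have hJ := fun a i => (hf.smooth_J x hx a i).differentiableAt (by simp)
  simp only [eta]
  simp (disch := fun_prop (disch := assumption)) only [pd_mul, pd_add, pd_sub, pd_const]
  rw [hf.pd_c x hx, logDeriv]
  ring

/-- Koszul's formula with the index lowered by g. Closedness of the coframe lets the derivatives of
its components be exchanged until only one of them remains. -/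
lemma IsConformallyFlatOn.christoffel_eq (hf : IsConformallyFlatOn N g c J h) (hx : x ∈ N)
    (k i j : Fin 3) :
    christoffel g k i j x = (dualFrame J x *ᵥ fun b => connection J h b i j x) k := by
  have hv : ∀ l, (1 / 2 : ℝ) * (pd i (fun y => g y j l) x + pd j (fun y => g y i l) x
      - pd l (fun y => g y i j) x)
      = (g x *ᵥ (dualFrame J x *ᵥ fun b => connection J h b i j x)) l := by
    intro l
    rw [Matrix.mulVec_mulVec, hf.metric_eq hx, Matrix.smul_mul, Matrix.mul_assoc,
      hf.mul_dualFrame hx, Matrix.mul_one, hf.pd_metric hx, hf.pd_metric hx, hf.pd_metric hx]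
    simp only [hf.closed x hx _ l i, hf.closed x hx _ l j, hf.closed x hx _ j i]
    simp [Matrix.mulVec, dotProduct, Matrix.mul_apply, Fin.sum_univ_three, etaMat, connection,
      raise, eta, logDeriv]
    ring
  have hu : IsUnit (g x).det :=
    Matrix.isUnit_det_of_right_inverse (hf.mul_inv hx)
  rw [christoffel, Finset.mul_sum]
  have : ∀ l, (1 / 2 : ℝ) * ((g x)⁻¹ k l * (pd i (fun y => g y j l) x + pd j (fun y => g y i l) x
      - pd l (fun y => g y i j) x)) = (g x)⁻¹ k l *
        (g x *ᵥ (dualFrame J x *ᵥ fun b => connection J h b i j x)) l := by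
    intro l; rw [← hv]; ring
  simp only [this]
  change ((g x)⁻¹ *ᵥ (g x *ᵥ _)) k = _
  rw [Matrix.mulVec_mulVec, Matrix.nonsing_inv_mul _ hu, Matrix.one_mulVec]

lemma IsConformallyFlatOn.frame_christoffel (hf : IsConformallyFlatOn N g c J h) (hx : x ∈ N)
    (b i j : Fin 3) :
    J b 0 x * christoffel g 0 i j x + J b 1 x * christoffel g 1 i j x
      + J b 2 x * christoffel g 2 i j x = connection J h b i j x := by
  have e : ((Matrix.of fun a i => J a i x) *ᵥ fun k => christoffel g k i j x) b
      = connection J h b i j x := by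
    rw [funext fun k => hf.christoffel_eq hx k i j]
    rw [Matrix.mulVec_mulVec, hf.mul_dualFrame hx, Matrix.one_mulVec]
  rw [← e]
  simp [Matrix.mulVec, dotProduct, Fin.sum_univ_three]

lemma IsConformallyFlatOn.contDiffAt_logDeriv (hf : IsConformallyFlatOn N g c J h) (hx : x ∈ N)
    (i : Fin 3) : ContDiffAt ℝ ∞ (logDeriv J h i) x := by
  have hJ := hf.smooth_J x hx
  have hh := hf.smooth_h x hx
  unfold logDeriv
  fun_prop (disch := assumption)

lemma IsConformallyFlatOn.contDiffAt_raise (hf : IsConformallyFlatOn N g c J h) (hx : x ∈ N)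
    (b : Fin 3) : ContDiffAt ℝ ∞ (fun y => raise (fun a => h a y) b) x := by
  have hh := hf.smooth_h x hx
  fin_cases b <;> simp [raise] <;> fun_prop (disch := assumption)

lemma IsConformallyFlatOn.contDiffAt_connection (hf : IsConformallyFlatOn N g c J h) (hx : x ∈ N)
    (b i j : Fin 3) : ContDiffAt ℝ ∞ (connection J h b i j) x := by
  have hJ := hf.smooth_J x hx
  have hp := contDiffAt_pd (i := i) (hJ b j)
  have h1 := hf.contDiffAt_logDeriv hx
  have h2 := hf.contDiffAt_raise hx b
  unfold connection eta
  fun_prop (disch := assumption)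

lemma IsConformallyFlatOn.contDiffAt_christoffel (hf : IsConformallyFlatOn N g c J h)
    (hx : x ∈ N) (k i j : Fin 3) : ContDiffAt ℝ ∞ (christoffel g k i j) x := by
  have e : christoffel g k i j =ᶠ[𝓝 x] fun y =>
      ((Matrix.of fun a i => J a i y).det)⁻¹ * ((Matrix.of fun a i => J a i y).adjugate *ᵥ
        fun b => connection J h b i j y) k := by
    filter_upwards [hf.isOpen.mem_nhds hx] with y hy
    rw [hf.christoffel_eq hy, dualFrame, Matrix.inv_def, Ring.inverse_eq_inv', Matrix.smul_mulVec]
    rfl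
  refine ContDiffAt.congr_of_eventuallyEq ?_ e
  have hJ := hf.smooth_J x hx
  have hW := fun b => hf.contDiffAt_connection hx b i j
  have hd := hf.det_ne x hx
  refine ContDiffAt.mul (ContDiffAt.inv ?_ hd) ?_
  · simp only [Matrix.det_fin_three, Matrix.of_apply]
    fun_prop (disch := assumption)
  · fin_cases k <;>
    · simp [Matrix.mulVec, dotProduct, Fin.sum_univ_three, Matrix.adjugate_fin_three]
      fun_prop (disch := assumption)

/-- The Riemann tensor. -/
def riemann (g : (Fin 3 → ℝ) → Matrix (Fin 3) (Fin 3) ℝ) (l m k j : Fin 3) (x : Fin 3 → ℝ) : ℝ :=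
  pd m (christoffel g l k j) x - pd k (christoffel g l m j) x
    + (christoffel g l m 0 x * christoffel g 0 k j x + christoffel g l m 1 x * christoffel g 1 k j x
        + christoffel g l m 2 x * christoffel g 2 k j x)
    - (christoffel g l k 0 x * christoffel g 0 m j x + christoffel g l k 1 x * christoffel g 1 m j x
        + christoffel g l k 2 x * christoffel g 2 m j x)

lemma IsConformallyFlatOn.pd_connection (hf : IsConformallyFlatOn N g c J h) (hx : x ∈ N)
    (b m k j : Fin 3) : pd m (connection J h b k j) x
      = pd m (pd k (J b j)) x + pd m (J b k) x * logDeriv J h j x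
        + J b k x * pd m (logDeriv J h j) x + pd m (J b j) x * logDeriv J h k x
        + J b j x * pd m (logDeriv J h k) x
        - (eta (fun a => pd m (J a k) x) (fun a => J a j x)
          + eta (fun a => J a k x) (fun a => pd m (J a j) x)) * raise (fun a => h a x) b
        - eta (fun a => J a k x) (fun a => J a j x) * raise (fun a => pd m (h a) x) b := by
  have hJ := fun a i => (hf.smooth_J x hx a i).differentiableAt (by simp)
  have hh := fun a => (hf.smooth_h x hx a).differentiableAt (by simp)
  have h1 := fun i => (hf.contDiffAt_logDeriv hx i).differentiableAt (by simp)
  have h2 := (hf.contDiffAt_raise hx b).differentiableAt (by simp)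
  have h3 := (contDiffAt_pd (i := k) (hf.smooth_J x hx b j)).differentiableAt (by simp)
  have h4 : pd m (fun y => raise (fun a => h a y) b) x = raise (fun a => pd m (h a) x) b := by
    have e : ∀ a, (fun y => h a y / 2) = fun y => h a y * (1 / 2) := fun a => by ext; ring
    fin_cases b <;>
    simp (disch := fun_prop (disch := assumption)) [raise, e, pd_mul, pd_neg, pd_const] <;> ring
  unfold connection
  simp only [eta]
  simp (disch := fun_prop (disch := assumption)) only [pd_mul, pd_add, pd_sub, pd_const]
  rw [h4]
  ring

lemma IsConformallyFlatOn.pd_logDeriv (hf : IsConformallyFlatOn N g c J h) (hx : x ∈ N)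
    (m k : Fin 3) : pd m (logDeriv J h k) x
      = pd m (J 0 k) x * h 0 x + pd m (J 1 k) x * h 1 x + pd m (J 2 k) x * h 2 x
      + (J 0 k x * pd m (h 0) x + J 1 k x * pd m (h 1) x + J 2 k x * pd m (h 2) x) := by
  have hJ := fun a i => (hf.smooth_J x hx a i).differentiableAt (by simp)
  have hh := fun a => (hf.smooth_h x hx a).differentiableAt (by simp)
  unfold logDeriv
  simp (disch := fun_prop (disch := assumption)) only [pd_mul, pd_add]
  ring

/-- Differentiating J · Γ = `connection` trades the derivatives of the Christoffel symbols, which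
contain the inverse coframe, for those of `connection`, which is polynomial in J, its derivatives
and h. -/
lemma IsConformallyFlatOn.frame_riemann (hf : IsConformallyFlatOn N g c J h) (hx : x ∈ N)
    (b m k j : Fin 3) :
    J b 0 x * riemann g 0 m k j x + J b 1 x * riemann g 1 m k j x
      + J b 2 x * riemann g 2 m k j x
      = pd m (connection J h b k j) x - pd k (connection J h b m j) x
        + ((connection J h b m 0 x - pd m (J b 0) x) * christoffel g 0 k j x
          + (connection J h b m 1 x - pd m (J b 1) x) * christoffel g 1 k j x
          + (connection J h b m 2 x - pd m (J b 2) x) * christoffel g 2 k j x)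
        - ((connection J h b k 0 x - pd k (J b 0) x) * christoffel g 0 m j x
          + (connection J h b k 1 x - pd k (J b 1) x) * christoffel g 1 m j x
          + (connection J h b k 2 x - pd k (J b 2) x) * christoffel g 2 m j x) := by
  have hJ := fun a i => (hf.smooth_J x hx a i).differentiableAt (by simp)
  have hΓ := fun l k j => (hf.contDiffAt_christoffel hx l k j).differentiableAt (by simp)
  have hd : ∀ m k, pd m (connection J h b k j) x
      = pd m (J b 0) x * christoffel g 0 k j x + J b 0 x * pd m (christoffel g 0 k j) x
      + (pd m (J b 1) x * christoffel g 1 k j x + J b 1 x * pd m (christoffel g 1 k j) x)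
      + (pd m (J b 2) x * christoffel g 2 k j x + J b 2 x * pd m (christoffel g 2 k j) x) := by
    intro m k
    rw [← pd_congr_of_isOpen hf.isOpen hx fun y hy => hf.frame_christoffel hy b k j]
    simp (disch := fun_prop (disch := assumption)) only [pd_mul, pd_add]
  rw [hd, hd]
  simp only [← hf.frame_christoffel hx, riemann]
  ring

/-- The Riemann tensor with its upper index in the coframe. -/
lemma IsConformallyFlatOn.frame_riemann_eq (hf : IsConformallyFlatOn N g c J h) (hx : x ∈ N)
    (b m k j : Fin 3) :
    J b 0 x * riemann g 0 m k j x + J b 1 x * riemann g 1 m k j x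
      + J b 2 x * riemann g 2 m k j x
      = J b k x * negSchouten J h m j x - J b m x * negSchouten J h k j x
        - eta (fun a => J a k x) (fun a => J a j x) * (raise (fun a => pd m (h a) x) b
          - raise (fun a => h a x) b * logDeriv J h m x
          + 1 / 2 * J b m x * (h 0 x * h 2 x - h 1 x * h 1 x))
        + eta (fun a => J a m x) (fun a => J a j x) * (raise (fun a => pd k (h a) x) b
          - raise (fun a => h a x) b * logDeriv J h k x
          + 1 / 2 * J b k x * (h 0 x * h 2 x - h 1 x * h 1 x)) := by
  rw [hf.frame_riemann hx, hf.pd_connection hx, hf.pd_connection hx]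
  rw [pd_pd_comm (hf.smooth_J x hx b j)]
  simp only [hf.pd_logDeriv hx]
  have hs := hf.symm x hx m k
  have c0 := fun a => hf.closed x hx a k m
  have e : ∀ m n, connection J h b m n x - pd m (J b n) x
      = J b m x * logDeriv J h n x + J b n x * logDeriv J h m x
        - eta (fun a => J a m x) (fun a => J a n x) * raise (fun a => h a x) b := by
    intro m n; rw [connection]; ring
  -- After subtraction of the derivative of the coframe the connection is algebraic in J and h, so
  -- its contraction with the Christoffel symbols is again expressed through `connection`.
  have w : ∀ m k j, (connection J h b m 0 x - pd m (J b 0) x) * christoffel g 0 k j x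
      + (connection J h b m 1 x - pd m (J b 1) x) * christoffel g 1 k j x
      + (connection J h b m 2 x - pd m (J b 2) x) * christoffel g 2 k j x
      = J b m x * (h 0 x * connection J h 0 k j x + h 1 x * connection J h 1 k j x
          + h 2 x * connection J h 2 k j x)
        + connection J h b k j x * logDeriv J h m x
        - eta (fun a => J a m x) (fun a => connection J h a k j x)
          * raise (fun a => h a x) b := by
    intro m k j
    simp only [e]
    simp only [← hf.frame_christoffel hx, logDeriv, eta]
    ring
  rw [w, w]
  simp only [connection, negSchouten, logDeriv, eta, raise_zero, raise_one, raise_two, c0]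
  -- The only differential relation left to use is the closedness of dc / 2c.
  linear_combination J b j x * hs

end Cotton

/-! ### Ricci, Schouten and Cotton tensors in the coframe -/

section Cotton

variable {N : Set (Fin 3 → ℝ)} {g : (Fin 3 → ℝ) → Matrix (Fin 3) (Fin 3) ℝ}
  {c : (Fin 3 → ℝ) → ℝ} {J : Fin 3 → Fin 3 → (Fin 3 → ℝ) → ℝ} {h : Fin 3 → (Fin 3 → ℝ) → ℝ}
  {x : Fin 3 → ℝ}

lemma eta_comm (u v : Fin 3 → ℝ) : eta u v = eta v u := by
  simp only [eta]; ring

lemma IsConformallyFlatOn.christoffel_comm (hf : IsConformallyFlatOn N g c J h) (hx : x ∈ N)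
    (k i j : Fin 3) : christoffel g k i j x = christoffel g k j i x := by
  rw [hf.christoffel_eq hx, hf.christoffel_eq hx]
  congr 2
  ext b
  rw [connection, connection, hf.closed x hx, eta_comm]
  ring

lemma IsConformallyFlatOn.ricci_eq (hf : IsConformallyFlatOn N g c J h) (hx : x ∈ N)
    (i j : Fin 3) : ricci g i j x = ∑ k, riemann g k k j i x := by
  refine Finset.sum_congr rfl fun k _ => ?_
  rw [riemann, Fin.sum_univ_three, pd_congr_of_isOpen hf.isOpen hx fun y hy =>
    hf.christoffel_comm hy k i j, pd_congr_of_isOpen hf.isOpen hx fun y hy =>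
    hf.christoffel_comm hy k i k]
  simp only [hf.christoffel_comm hx _ i j, hf.christoffel_comm hx _ i k]
  ring

/-- The derivative of `h` in the coframe. -/
def frameDeriv (J : Fin 3 → Fin 3 → (Fin 3 → ℝ) → ℝ) (h : Fin 3 → (Fin 3 → ℝ) → ℝ)
    (x : Fin 3 → ℝ) (a b : Fin 3) : ℝ :=
  dualFrame J x 0 a * pd 0 (h b) x + dualFrame J x 1 a * pd 1 (h b) x
    + dualFrame J x 2 a * pd 2 (h b) x

lemma IsConformallyFlatOn.pd_h (hf : IsConformallyFlatOn N g c J h) (hx : x ∈ N)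
    (k b : Fin 3) : pd k (h b) x = J 0 k x * frameDeriv J h x 0 b + J 1 k x * frameDeriv J h x 1 b
      + J 2 k x * frameDeriv J h x 2 b := by
  have e : ∀ n, (dualFrame J x * (Matrix.of fun a i => J a i x)) n k
      = (1 : Matrix (Fin 3) (Fin 3) ℝ) n k := fun n => by rw [hf.dualFrame_mul hx]
  have e0 := e 0
  have e1 := e 1
  have e2 := e 2
  simp only [Matrix.mul_apply, Fin.sum_univ_three, Matrix.of_apply] at e0 e1 e2
  have e3 := congrFun (Matrix.vecMul_one (fun n => pd n (h b) x)) k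
  simp only [Matrix.vecMul, dotProduct, Fin.sum_univ_three] at e3
  rw [← e3, ← e0, ← e1, ← e2]
  simp only [frameDeriv]
  ring

/-- Contracting over a coordinate index pairs the dual frame with the coframe, so the trace can be
taken over coframe indices and the inverse of J never has to be expanded. -/
lemma IsConformallyFlatOn.contraction (hf : IsConformallyFlatOn N g c J h) (hx : x ∈ N)
    (f : Fin 3 → Fin 3 → ℝ) : ∑ k, ∑ b, dualFrame J x k b *
      (J 0 k x * f b 0 + J 1 k x * f b 1 + J 2 k x * f b 2) = f 0 0 + f 1 1 + f 2 2 := by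
  have e : ∀ a b, ((Matrix.of fun a i => J a i x) * dualFrame J x) a b
      = (1 : Matrix (Fin 3) (Fin 3) ℝ) a b := fun a b => by rw [hf.mul_dualFrame hx]
  simp only [Matrix.mul_apply, Fin.sum_univ_three, Matrix.of_apply] at e ⊢
  have e00 := e 0 0
  have e01 := e 0 1
  have e02 := e 0 2
  have e10 := e 1 0
  have e11 := e 1 1
  have e12 := e 1 2
  have e20 := e 2 0
  have e21 := e 2 1
  have e22 := e 2 2
  simp only [Matrix.one_apply, Fin.isValue, reduceIte] at e00 e01 e02 e10 e11 e12 e20 e21 e22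
  simp at e01 e02 e10 e12 e20 e21
  linear_combination f 0 0 * e00 + f 1 0 * e01 + f 2 0 * e02 + f 0 1 * e10 + f 1 1 * e11
    + f 2 1 * e12 + f 0 2 * e20 + f 1 2 * e21 + f 2 2 * e22

/-- The trace of `negSchouten` for the metric `eta`. -/
def negSchoutenTrace (J : Fin 3 → Fin 3 → (Fin 3 → ℝ) → ℝ) (h : Fin 3 → (Fin 3 → ℝ) → ℝ)
    (x : Fin 3 → ℝ) : ℝ :=
  raise (frameDeriv J h x 0) 0 + raise (frameDeriv J h x 1) 1 + raise (frameDeriv J h x 2) 2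
    + 1 / 2 * (h 0 x * h 2 x - h 1 x * h 1 x)

lemma IsConformallyFlatOn.negSchouten_comm (hf : IsConformallyFlatOn N g c J h) (hx : x ∈ N)
    (i j : Fin 3) : negSchouten J h i j x = negSchouten J h j i x := by
  rw [negSchouten, negSchouten, hf.symm x hx, eta_comm]
  ring

lemma IsConformallyFlatOn.ricci_eq_negSchouten (hf : IsConformallyFlatOn N g c J h) (hx : x ∈ N)
    (i j : Fin 3) : ricci g i j x = - negSchouten J h i j x
      - eta (fun a => J a i x) (fun a => J a j x) * negSchoutenTrace J h x := by
  have e1 : ∀ k, riemann g k k j i x = ∑ b, dualFrame J x k b *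
      (J b 0 x * riemann g 0 k j i x + J b 1 x * riemann g 1 k j i x
        + J b 2 x * riemann g 2 k j i x) := by
    intro k
    have : (dualFrame J x *ᵥ ((Matrix.of fun a i => J a i x) *ᵥ fun l => riemann g l k j i x)) k
        = riemann g k k j i x := by
      rw [Matrix.mulVec_mulVec, hf.dualFrame_mul hx, Matrix.one_mulVec]
    rw [← this]
    simp only [Matrix.mulVec, dotProduct, Fin.sum_univ_three, Matrix.of_apply]
  -- The i-th column of the coframe lowered by `eta`, so that `eta` of columns k and i is linear in
  -- column k. The array f below collects the Riemann tensor as a linear function of column k.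
  let low : Fin 3 → ℝ := ![2 * J 2 i x, - J 1 i x, 2 * J 0 i x]
  let f : Fin 3 → Fin 3 → ℝ := fun b a =>
    J b j x * (J 0 i x * frameDeriv J h x a 0 + J 1 i x * frameDeriv J h x a 1
      + J 2 i x * frameDeriv J h x a 2 - h a x * logDeriv J h i x
      + 1 / 2 * low a * (h 0 x * h 2 x - h 1 x * h 1 x))
    - (1 : Matrix (Fin 3) (Fin 3) ℝ) b a * negSchouten J h j i x
    - eta (fun a => J a j x) (fun a => J a i x) * (raise (frameDeriv J h x a) b
      - raise (fun a => h a x) b * h a x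
      + 1 / 2 * (1 : Matrix (Fin 3) (Fin 3) ℝ) b a * (h 0 x * h 2 x - h 1 x * h 1 x))
    + low a * (raise (fun a => pd j (h a) x) b
          - raise (fun a => h a x) b * logDeriv J h j x
          + 1 / 2 * J b j x * (h 0 x * h 2 x - h 1 x * h 1 x))
  have e2 : ∀ k b, J b 0 x * riemann g 0 k j i x + J b 1 x * riemann g 1 k j i x
      + J b 2 x * riemann g 2 k j i x
      = J 0 k x * f b 0 + J 1 k x * f b 1 + J 2 k x * f b 2 := by
    intro k b
    rw [hf.frame_riemann_eq hx]
    have hk : (fun b => pd k (h b) x) = fun b => J 0 k x * frameDeriv J h x 0 b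
      + J 1 k x * frameDeriv J h x 1 b + J 2 k x * frameDeriv J h x 2 b :=
      funext fun b => hf.pd_h hx k b
    have hP : negSchouten J h k i x = (J 0 i x * (fun b => pd k (h b) x) 0
      + J 1 i x * (fun b => pd k (h b) x) 1 + J 2 i x * (fun b => pd k (h b) x) 2)
      - logDeriv J h k x * logDeriv J h i x
      + 1 / 2 * eta (fun a => J a k x) (fun a => J a i x) * (h 0 x * h 2 x - h 1 x * h 1 x) := rfl
    rw [hP, hk]
    fin_cases b <;>
    simp [f, low, eta, raise, logDeriv, Matrix.one_apply] <;> ring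
  rw [hf.ricci_eq hx]
  simp only [e1, e2]
  rw [hf.contraction hx, hf.negSchouten_comm hx i j]
  simp only [f, low, negSchoutenTrace, negSchouten, hf.pd_h hx j]
  simp [eta, raise, logDeriv]
  ring

/-- The Ricci tensor is -P - (tr P) η with P the negative of the Schouten tensor. In dimension three
its trace is -(1 + 3) tr P, and inverting g divides by c. -/
lemma IsConformallyFlatOn.scalarCurv_eq (hf : IsConformallyFlatOn N g c J h) (hx : x ∈ N) :
    scalarCurv g x = - 4 * negSchoutenTrace J h x / c x := by
  let Jm : Matrix (Fin 3) (Fin 3) ℝ := Matrix.of fun a i => J a i x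
  let r : Matrix (Fin 3) (Fin 3) ℝ := Matrix.of fun a b => - frameDeriv J h x a b + h a x * h b x
    - (1 / 2 * (h 0 x * h 2 x - h 1 x * h 1 x) + negSchoutenTrace J h x) * etaMat a b
  have hr : (Matrix.of fun i j => ricci g i j x) = Jmᵀ * r * Jm := by
    ext i j
    rw [Matrix.of_apply, hf.ricci_eq_negSchouten hx]
    simp only [negSchouten, hf.pd_h hx i]
    simp [Jm, r, Matrix.mul_apply, Fin.sum_univ_three, eta, logDeriv, etaMat]
    ring
  have e : (dualFrame J x)ᵀ * Jmᵀ = 1 := by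
    rw [← Matrix.transpose_mul, hf.mul_dualFrame hx, Matrix.transpose_one]
  have h1 : scalarCurv g x = ((g x)⁻¹ * (Matrix.of fun i j => ricci g i j x)ᵀ).trace := by
    simp [scalarCurv, Matrix.trace, Matrix.mul_apply]
  have e' : (dualFrame J x)ᵀ * (Jmᵀ * (rᵀ * Jm)) = rᵀ * Jm := by
    rw [← Matrix.mul_assoc, e, Matrix.one_mul]
  rw [h1, hr, hf.inv_eq hx, Matrix.smul_mul, Matrix.trace_smul, Matrix.transpose_mul,
    Matrix.transpose_mul, Matrix.transpose_transpose, Matrix.mul_assoc, e', Matrix.mul_assoc,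
    Matrix.trace_mul_comm, Matrix.mul_assoc, Matrix.mul_assoc, hf.mul_dualFrame hx, Matrix.mul_one]
  have h2 : (etaInv * rᵀ).trace = - 4 * negSchoutenTrace J h x := by
    simp only [r, Matrix.trace, Matrix.diag, Matrix.mul_apply, Matrix.transpose_apply,
      Fin.sum_univ_three, Matrix.of_apply]
    simp [etaInv, etaMat, negSchoutenTrace, raise]
    ring
  rw [h2, smul_eq_mul]
  ring

lemma IsConformallyFlatOn.schouten_eq (hf : IsConformallyFlatOn N g c J h) (hx : x ∈ N)
    (p q : Fin 3) : schouten g p q x = - negSchouten J h p q x := by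
  rw [schouten, hf.ricci_eq_negSchouten hx, hf.scalarCurv_eq hx, hf.metric x hx]
  have := hf.c_ne x hx
  field_simp
  ring

lemma IsConformallyFlatOn.pd_negSchouten (hf : IsConformallyFlatOn N g c J h) (hx : x ∈ N)
    (r p q : Fin 3) : pd r (negSchouten J h p q) x
      = pd r (J 0 q) x * pd p (h 0) x + pd r (J 1 q) x * pd p (h 1) x
        + pd r (J 2 q) x * pd p (h 2) x
        + (J 0 q x * pd r (pd p (h 0)) x + J 1 q x * pd r (pd p (h 1)) x
        + J 2 q x * pd r (pd p (h 2)) x)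
        - pd r (logDeriv J h p) x * logDeriv J h q x - logDeriv J h p x * pd r (logDeriv J h q) x
        + 1 / 2 * (eta (fun a => pd r (J a p) x) (fun a => J a q x)
          + eta (fun a => J a p x) (fun a => pd r (J a q) x)) * (h 0 x * h 2 x - h 1 x * h 1 x)
        + 1 / 2 * eta (fun a => J a p x) (fun a => J a q x)
          * (pd r (h 0) x * h 2 x + h 0 x * pd r (h 2) x - 2 * h 1 x * pd r (h 1) x) := by
  have hJ := fun a i => (hf.smooth_J x hx a i).differentiableAt (by simp)
  have hh := fun a => (hf.smooth_h x hx a).differentiableAt (by simp)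
  have h1 := fun i => (hf.contDiffAt_logDeriv hx i).differentiableAt (by simp)
  have h2 := fun a => (contDiffAt_pd (i := p) (hf.smooth_h x hx a)).differentiableAt (by simp)
  unfold negSchouten
  simp only [eta]
  simp (disch := fun_prop (disch := assumption)) only [pd_mul, pd_add, pd_sub, pd_const]
  ring

theorem IsConformallyFlatOn.cotton_eq_zero (hf : IsConformallyFlatOn N g c J h) (hx : x ∈ N)
    (p q r : Fin 3) : cotton g p q r x = 0 := by
  have hp : ∀ r p q, pd r (schouten g p q) x = - pd r (negSchouten J h p q) x := by
    intro r p q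
    rw [pd_congr_of_isOpen hf.isOpen hx fun y hy => hf.schouten_eq hy p q, pd_neg]
  have hΓ : ∀ r p q, ∑ s, christoffel g s r p x * schouten g s q x
      = - ((connection J h 0 r p x * pd q (h 0) x + connection J h 1 r p x * pd q (h 1) x
          + connection J h 2 r p x * pd q (h 2) x)
        - (h 0 x * connection J h 0 r p x + h 1 x * connection J h 1 r p x
          + h 2 x * connection J h 2 r p x) * logDeriv J h q x
        + 1 / 2 * eta (fun a => connection J h a r p x) (fun a => J a q x)
          * (h 0 x * h 2 x - h 1 x * h 1 x)) := by
    intro r p q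
    simp only [← hf.frame_christoffel hx, Fin.sum_univ_three, hf.schouten_eq hx,
      hf.negSchouten_comm hx _ q]
    simp only [negSchouten, eta, logDeriv]
    ring
  -- The derivative of the closedness relation for dc / 2c. It supplies the exchange of second
  -- derivatives of h by which the antisymmetrised derivative of the Schouten tensor cancels.
  have hs : pd p (fun y => J 0 q y * pd r (h 0) y + J 1 q y * pd r (h 1) y + J 2 q y * pd r (h 2) y)
      x = pd p (fun y => J 0 r y * pd q (h 0) y + J 1 r y * pd q (h 1) y
        + J 2 r y * pd q (h 2) y) x :=
    pd_congr_of_isOpen hf.isOpen hx fun y hy => hf.symm y hy r q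
  have hJ := fun a i => (hf.smooth_J x hx a i).differentiableAt (by simp)
  have h2 := fun i a => (contDiffAt_pd (i := i) (hf.smooth_h x hx a)).differentiableAt (by simp)
  simp (disch := fun_prop (disch := assumption)) only [pd_mul, pd_add] at hs
  simp only [pd_pd_comm (hf.smooth_h x hx _) (i := p)] at hs
  have c1 := fun a => hf.closed x hx a q r
  have c2 := fun a => hf.closed x hx a p q
  have c3 := fun a => hf.closed x hx a p r
  rw [cotton, covDeriv, covDeriv, hp, hp, hΓ, hΓ]
  have hsym : ∑ s, christoffel g s r q x * schouten g p s x
      = ∑ s, christoffel g s q r x * schouten g p s x :=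
    Finset.sum_congr rfl fun s _ => by rw [hf.christoffel_comm hx s r q]
  rw [hsym, hf.pd_negSchouten hx, hf.pd_negSchouten hx]
  simp only [hf.pd_logDeriv hx, connection, logDeriv, eta, raise_zero, raise_one, raise_two]
  simp only [c1, c2, c3] at hs ⊢
  linear_combination (-1) * hs

end Cotton

/-! ## Characteristic conformal structures of Monge–Ampère systems -/

section

variable {N : Set (Fin 3 → ℝ)} {g : (Fin 3 → ℝ) → Matrix (Fin 3) (Fin 3) ℝ}
  {c : (Fin 3 → ℝ) → ℝ} {J : Fin 3 → Fin 3 → (Fin 3 → ℝ) → ℝ}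

lemma pd_div_two_mul {x : Fin 3 → ℝ} (hc : ContDiffAt ℝ ∞ c x) (h : c x ≠ 0) (i j : Fin 3) :
    pd i (fun y => pd j c y / (2 * c y)) x
      = pd i (pd j c) x / (2 * c x) - pd j c x * pd i c x / (2 * c x ^ 2) := by
  have hd := hc.differentiableAt (by simp)
  have hd' := (contDiffAt_pd (i := j) hc).differentiableAt (by simp)
  have h1 : DifferentiableAt ℝ (fun y => pd j c y / (2 * c y)) x := by
    exact ((contDiffAt_pd hc).fun_div (contDiffAt_const.mul hc)
      (mul_ne_zero two_ne_zero h)).differentiableAt (by simp)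
  have e : (fun y => pd j c y / (2 * c y) * (2 * c y)) =ᶠ[𝓝 x] pd j c := by
    filter_upwards [hc.continuousAt.eventually_ne h] with y hy
    field_simp
  have e2 := pd_congr (i := i) e
  simp (disch := fun_prop (disch := assumption)) only [pd_mul, pd_const] at e2
  have : pd i (fun y => pd j c y / (2 * c y)) x * (2 * c x)
      = pd i (pd j c) x - pd j c x * pd i c x / c x := by
    rw [← e2]; field_simp; ring
  field_simp at this ⊢
  linear_combination this

/-- The components of dc / 2c in the coframe serve as h. Their symmetry condition is closedness of
this logarithmic differential, rewritten by means of the closedness of the coframe. -/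
lemma exists_isConformallyFlatOn (hN : IsOpen N) (hc : ∀ x ∈ N, ContDiffAt ℝ ∞ c x)
    (hJ : ∀ x ∈ N, ∀ a i, ContDiffAt ℝ ∞ (J a i) x) (hc0 : ∀ x ∈ N, c x ≠ 0)
    (hdet : ∀ x ∈ N, (Matrix.of fun a i => J a i x).det ≠ 0)
    (hg : ∀ x ∈ N, ∀ i j, g x i j = c x * eta (fun a => J a i x) fun a => J a j x)
    (hcl : ∀ x ∈ N, ∀ a i j, pd i (J a j) x = pd j (J a i) x) :
    ∃ h, IsConformallyFlatOn N g c J h := by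
  let l : Fin 3 → (Fin 3 → ℝ) → ℝ := fun i y => pd i c y / (2 * c y)
  let h : Fin 3 → (Fin 3 → ℝ) → ℝ := fun a y =>
    dualFrame J y 0 a * l 0 y + dualFrame J y 1 a * l 1 y + dualFrame J y 2 a * l 2 y
  have hE : ∀ x ∈ N, ∀ i a, ContDiffAt ℝ ∞ (fun y => dualFrame J y i a) x := by
    intro x hx i a
    exact contDiffAt_inv_apply (M := fun y => Matrix.of fun a i => J a i y) (hJ x hx) (hdet x hx) i a
  have hl : ∀ x ∈ N, ∀ i, ContDiffAt ℝ ∞ (l i) x := by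
    intro x hx i
    refine (contDiffAt_pd (hc x hx)).div (contDiffAt_const.mul (hc x hx)) ?_
    have := hc0 x hx
    positivity
  have hh : ∀ x ∈ N, ∀ a, ContDiffAt ℝ ∞ (h a) x := by
    intro x hx a
    have h1 := fun i => hE x hx i a
    have h2 := hl x hx
    fun_prop (disch := assumption)
  have hJh : ∀ x ∈ N, ∀ i, J 0 i x * h 0 x + J 1 i x * h 1 x + J 2 i x * h 2 x = l i x := by
    intro x hx i
    have e1 : dualFrame J x * (Matrix.of fun a i => J a i x) = 1 :=
      Matrix.nonsing_inv_mul _ (isUnit_iff_ne_zero.mpr (hdet x hx))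
    have e2 := congrFun (Matrix.vecMul_one (fun n => l n x)) i
    rw [← e1] at e2
    simp only [Matrix.vecMul, dotProduct, Fin.sum_univ_three, Matrix.mul_apply,
      Matrix.of_apply] at e2
    rw [← e2]
    simp only [h]
    ring
  refine ⟨h, hN, hc, hJ, hh, hc0, hdet, hg, hcl, fun x hx i => ?_, fun x hx i j => ?_⟩
  · rw [hJh x hx]
    have := hc0 x hx
    simp only [l]
    field_simp
  · have hJd := fun a i => (hJ x hx a i).differentiableAt (by simp)
    have hhd := fun a => (hh x hx a).differentiableAt (by simp)
    have e : ∀ i j, pd i (l j) x = pd i (J 0 j) x * h 0 x + J 0 j x * pd i (h 0) x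
        + (pd i (J 1 j) x * h 1 x + J 1 j x * pd i (h 1) x)
        + (pd i (J 2 j) x * h 2 x + J 2 j x * pd i (h 2) x) := by
      intro i j
      rw [← pd_congr_of_isOpen hN hx fun y hy => hJh y hy j]
      simp (disch := fun_prop (disch := assumption)) only [pd_mul, pd_add]
    have hs : pd i (l j) x = pd j (l i) x := by
      rw [pd_div_two_mul (hc x hx) (hc0 x hx), pd_div_two_mul (hc x hx) (hc0 x hx),
        pd_pd_comm (hc x hx)]
      ring
    rw [e, e] at hs
    have c0 := fun a => hcl x hx a i j
    simp only [c0] at hs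
    linear_combination hs

end

/-! ### The symbol of a Monge–Ampère system and its metric on solutions -/

section

variable {Ω : Set Jet} {F G : Jet → ℝ} {U : Jet}

/-- The pull-back of a linear form under left and right multiplication. -/
def pullForm (α : Jet →L[ℝ] ℝ) (n : Matrix (Fin 2) (Fin 2) ℝ) (k : Matrix (Fin 3) (Fin 3) ℝ)
    (H : Jet) : ℝ := α (Matrix.of.symm (n * Matrix.of H * k))

/-- The dispersion form is a 2 × 2 determinant in the row index and quadratic in the column index,
so left multiplication contributes a determinant and right multiplication a congruence. -/
lemma symb_pullForm {α β α' β' : Jet →L[ℝ] ℝ} {n : Matrix (Fin 2) (Fin 2) ℝ}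
    {k : Matrix (Fin 3) (Fin 3) ℝ} (hα : ∀ H, α' H = pullForm α n k H)
    (hβ : ∀ H, β' H = pullForm β n k H) :
    symb α' β' = n.det • (k * symb α β * kᵀ) := by
  have e : ∀ (θ θ' : Jet →L[ℝ] ℝ), (∀ H, θ' H = pullForm θ n k H) → ∀ b j, row θ' b j
      = n 0 b * (k j 0 * row θ 0 0 + k j 1 * row θ 0 1 + k j 2 * row θ 0 2)
        + n 1 b * (k j 0 * row θ 1 0 + k j 1 * row θ 1 1 + k j 2 * row θ 1 2) := by
    intro θ θ' h b j
    rw [row, h, pullForm, apply_eq_row]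
    have : ∀ a i, (n * Matrix.of (jetDir b j) * k) a i = n a b * k j i := by
      intro a i
      simp [Matrix.mul_apply, jetDir, Pi.single_apply, ite_apply]
    simp only [Matrix.of_symm_apply, this]
    ring
  ext i j
  simp only [symb, Matrix.of_apply, e α α' hα, e β β' hβ, Matrix.smul_apply, smul_eq_mul,
    Matrix.det_fin_two, Matrix.mul_apply, Fin.sum_univ_three, Matrix.transpose_apply]
  ring

lemma symb_combination (α β : Jet →L[ℝ] ℝ) (p q r s : ℝ) :
    symb (p • α + q • β) (r • α + s • β) = (p * s - q * r) • symb α β := by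
  ext i j
  simp [symb, row]
  ring

/-- The matrix whose rows are the coefficients of the characteristic covector. -/
def conicMat (α β : Jet →L[ℝ] ℝ) : Matrix (Fin 3) (Fin 3) ℝ := Matrix.of (conic α β)

lemma det_conicMat (α β : Jet →L[ℝ] ℝ) : (conicMat α β).det = conicDet α β := by
  simp only [conicMat, conicDet, Matrix.det_fin_three, cross_apply, dotProduct, Fin.sum_univ_three,
    Matrix.of_apply, Matrix.cons_val]
  ring

/-- Characteristic covectors are null for the symbol (`charVec_isotropic`) and have coordinates (x²,
xy, y²) in the conic basis. There the symbol is thus a multiple of the one quadratic form vanishing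
on that conic, represented by `etaInv`. -/
lemma conicMat_mul_symb (α β : Jet →L[ℝ] ℝ) :
    conicMat α β * symb α β * (conicMat α β)ᵀ = conicDet α β • etaInv := by
  have hs : ∀ i j, symb α β i j = (1 / 2 : ℝ) * (row α 0 i * row β 1 j + row α 0 j * row β 1 i
      - row α 1 i * row β 0 j - row α 1 j * row β 0 i) := fun _ _ => rfl
  have hL : ∀ i j, conicMat α β i j = conic α β i j := fun _ _ => rfl
  ext i j
  simp only [Matrix.mul_apply, Matrix.transpose_apply, Fin.sum_univ_three, hs, hL,
    Matrix.smul_apply, smul_eq_mul]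
  fin_cases i <;> fin_cases j <;>
  · simp [conicDet, conic, etaInv, cross_apply, dotProduct, Fin.sum_univ_three]
    ring

lemma HasDerivAt.id_mul {f : ℝ → ℝ} (hf : ContinuousAt f 0) :
    HasDerivAt (fun s => s * f s) (f 0) 0 := by
  rw [hasDerivAt_iff_tendsto_slope_zero]
  refine (hf.tendsto.mono_left nhdsWithin_le_nhds).congr' ?_
  filter_upwards [self_mem_nhdsWithin] with t ht
  have : t ≠ 0 := ht
  simp [this]

/-- Numerator and denominator are affine in V and the left side vanishes at V = U, so V - U factors
out exactly. The differential of the cleared action thus needs no differentiation of an inverse. -/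
lemma numer_sub_act_mul_denom (U₀ : Jet) (P : Matrix (Fin 3) (Fin 2) ℝ)
    (h : (denom (shift U₀ P) U).det ≠ 0) (V : Jet) :
    numer (shift U₀ P) V - Matrix.of (act (shift U₀ P) U) * denom (shift U₀ P) V
      = (1 - Matrix.of (act (shift U₀ P) U) * P) * Matrix.of (V - U) := by
  have hu : IsUnit (denom (shift U₀ P) U).det := isUnit_iff_ne_zero.mpr h
  have e : Matrix.of (act (shift U₀ P) U) * denom (shift U₀ P) U = numer (shift U₀ P) U := by
    change numer _ U * (denom _ U)⁻¹ * denom _ U = _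
    rw [Matrix.mul_assoc, Matrix.nonsing_inv_mul _ hu, Matrix.mul_one]
  have e1 : denom (shift U₀ P) V = denom (shift U₀ P) U + P * Matrix.of (V - U) := by
    rw [denom_shift, denom_shift, add_assoc, ← Matrix.mul_add]
    congr 2
    ext a i
    simp
  have e2 : numer (shift U₀ P) V = numer (shift U₀ P) U + Matrix.of (V - U) := by
    rw [numer_shift, numer_shift]
    ext a i
    simp
  rw [e1, e2, Matrix.mul_add, e, Matrix.sub_mul, Matrix.one_mul, Matrix.mul_assoc]
  abel

/-- Putting V = `U₀` in the preceding identity exhibits 1 + (U - U₀) P as an inverse. -/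
lemma det_one_sub_act_mul_ne_zero (U₀ : Jet) (P : Matrix (Fin 3) (Fin 2) ℝ)
    (h : (denom (shift U₀ P) U).det ≠ 0) :
    (1 - Matrix.of (act (shift U₀ P) U) * P).det ≠ 0 := by
  have h1 := numer_sub_act_mul_denom U₀ P h U₀
  rw [denom_shift_self, numer_shift, sub_self] at h1
  set n := 1 - Matrix.of (act (shift U₀ P) U) * P with hn
  have e : n * (1 + Matrix.of (U - U₀) * P) = 1 := by
    have h2 : n * Matrix.of (U - U₀) = Matrix.of (act (shift U₀ P) U) := by
      have e3 : Matrix.of (U₀ - U) = - Matrix.of (U - U₀) := by ext; simp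
      have e4 : Matrix.of (0 : Jet) = 0 := rfl
      rw [e3, e4, Matrix.mul_one, Matrix.mul_neg, zero_sub, neg_inj] at h1
      exact h1.symm
    rw [Matrix.mul_add, Matrix.mul_one, ← Matrix.mul_assoc, h2, hn, sub_add_cancel]
  exact (Matrix.isUnit_det_of_right_inverse e).ne_zero

lemma fderiv_clearedAct_shift (θ : Jet →L[ℝ] ℝ) (U₀ : Jet) (P : Matrix (Fin 3) (Fin 2) ℝ)
    (h : (denom (shift U₀ P) U).det ≠ 0) (hθ : θ (act (shift U₀ P) U) = 0) (H : Jet) :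
    fderiv ℝ (fun V => θ (clearedAct (shift U₀ P) V)) U H
      = pullForm θ (1 - Matrix.of (act (shift U₀ P) U) * P) (denom (shift U₀ P) U).adjugate H := by
  set n := 1 - Matrix.of (act (shift U₀ P) U) * P
  have hd : DifferentiableAt ℝ (fun V => θ (clearedAct (shift U₀ P) V)) U :=
    (isMinorCombination_clearedAct (shift U₀ P) (θ : Jet →ₗ[ℝ] ℝ)).contDiff.differentiable
      (by simp) U
  have e : ∀ V, θ (clearedAct (shift U₀ P) V)
      = pullForm θ n (denom (shift U₀ P) V).adjugate (V - U) := by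
    intro V
    rw [pullForm, ← numer_sub_act_mul_denom U₀ P h V, Matrix.sub_mul, Matrix.mul_assoc,
      Matrix.mul_adjugate]
    have : Matrix.of (act (shift U₀ P) U)
          * ((denom (shift U₀ P) V).det • (1 : Matrix (Fin 3) (Fin 3) ℝ))
        = (denom (shift U₀ P) V).det • Matrix.of (act (shift U₀ P) U) := by
      rw [Matrix.mul_smul, Matrix.mul_one]
    rw [this]
    change _ = θ (clearedAct (shift U₀ P) V - (denom (shift U₀ P) V).det • act (shift U₀ P) U)
    rw [map_sub, map_smul, hθ, smul_zero, sub_zero]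
  have h1 := hasDerivAt_comp_line hd H
  have h2 : Continuous fun s : ℝ => pullForm θ n
      (denom (shift U₀ P) (U + s • H)).adjugate H := by
    unfold pullForm
    refine θ.continuous.comp ?_
    change Continuous fun s : ℝ => n * Matrix.of H * (denom (shift U₀ P) (U + s • H)).adjugate
    refine continuous_const.matrix_mul (Continuous.matrix_adjugate ?_)
    refine continuous_matrix fun k i => ?_
    simp only [denom_apply]
    simp only [Pi.add_apply, Pi.smul_apply, smul_eq_mul]
    fun_prop
  have e2 : (fun s : ℝ => θ (clearedAct (shift U₀ P) (U + s • H))) = fun s : ℝ => s * pullForm θ n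
      (denom (shift U₀ P) (U + s • H)).adjugate H := by
    ext s
    rw [e, add_sub_cancel_left, pullForm, pullForm]
    have : Matrix.of (s • H) = s • Matrix.of H := rfl
    rw [this, Matrix.mul_smul, Matrix.smul_mul]
    exact map_smul θ s _
  rw [e2] at h1
  have := h1.unique (HasDerivAt.id_mul h2.continuousAt)
  rw [this, zero_smul, add_zero]

/-- The symbol at all points of a Monge–Ampère fourfold in terms of the symbol at one of them. -/
lemma IsRegular.symb_conj (hR : IsRegular Ω F G) {U₀ : Jet} (hU₀ : U₀ ∈ fourfold Ω F G)
    {P : Matrix (Fin 3) (Fin 2) ℝ} (hU : U ∈ fourfold Ω F G)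
    (hP : ∀ᶠ V in 𝓝 U, V ∈ fourfold Ω F G ↔ (fderiv ℝ F U₀ (clearedAct (shift U₀ P) V) = 0 ∧
        fderiv ℝ G U₀ (clearedAct (shift U₀ P) V) = 0))
    (h : (denom (shift U₀ P) U).det ≠ 0) :
    ∃ ρ : ℝ, ρ ≠ 0 ∧ denom (shift U₀ P) U * symbolForm F G U * (denom (shift U₀ P) U)ᵀ
      = ρ • symbolForm F G U₀ := by
  set M := shift U₀ P
  set K := denom M U with hK
  set n := 1 - Matrix.of (act M U) * P with hn
  have hz := hP.self_of_nhds.mp hU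
  have z1 : fderiv ℝ F U₀ (act M U) = 0 :=
    (apply_clearedAct_eq_zero_iff M (fderiv ℝ F U₀ : Jet →ₗ[ℝ] ℝ) h).mp hz.1
  have z2 : fderiv ℝ G U₀ (act M U) = 0 :=
    (apply_clearedAct_eq_zero_iff M (fderiv ℝ G U₀ : Jet →ₗ[ℝ] ℝ) h).mp hz.2
  have hd := fun θ : Jet →L[ℝ] ℝ => (isMinorCombination_clearedAct M
    (θ : Jet →ₗ[ℝ] ℝ)).contDiff.differentiable (by simp) U
  obtain ⟨p, q, e1⟩ := hR.fderiv_comb hU (hd (fderiv ℝ F U₀))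
    (hP.mono fun V hV h => (hV.mp h).1)
  obtain ⟨r, s, e2⟩ := hR.fderiv_comb hU (hd (fderiv ℝ G U₀))
    (hP.mono fun V hV h => (hV.mp h).2)
  have e3 := symb_pullForm (fderiv_clearedAct_shift _ U₀ P h z1)
    (fderiv_clearedAct_shift _ U₀ P h z2)
  have e4 : (p * s - q * r) • symbolForm F G U = n.det • (K.adjugate * symbolForm F G U₀
      * (K.adjugate)ᵀ) := by
    rw [symbolForm_eq, symbolForm_eq, ← symb_combination, ← e1, ← e2]
    exact e3
  -- Multiplying by K and its transpose turns the adjugates into powers of det K. The factor p s - q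
  -- r cannot vanish, since the right side is a non-zero multiple of a non-degenerate symbol.
  have e5 : (p * s - q * r) • (K * symbolForm F G U * Kᵀ)
      = (n.det * K.det ^ 2) • symbolForm F G U₀ := by
    rw [← Matrix.smul_mul, ← Matrix.mul_smul, e4, Matrix.mul_smul, Matrix.smul_mul]
    have a1 : (K.adjugate)ᵀ * Kᵀ = K.det • 1 := by
      rw [← Matrix.transpose_mul, Matrix.mul_adjugate, Matrix.transpose_smul, Matrix.transpose_one]
    calc _ = n.det • ((K * K.adjugate) * symbolForm F G U₀ * ((K.adjugate)ᵀ * Kᵀ)) := by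
          simp only [Matrix.mul_assoc]
      _ = _ := by
          rw [a1, Matrix.mul_adjugate, Matrix.smul_mul, Matrix.one_mul, Matrix.mul_smul,
            Matrix.mul_one, smul_smul, smul_smul]
          ring_nf
  have hn0 : n.det * K.det ^ 2 ≠ 0 :=
    mul_ne_zero (det_one_sub_act_mul_ne_zero U₀ P h) (pow_ne_zero 2 h)
  have hm : p * s - q * r ≠ 0 := by
    intro h0
    rw [h0, zero_smul] at e5
    have := (smul_eq_zero.mp e5.symm).resolve_left hn0
    exact hR.nondeg U₀ hU₀ (by rw [this]; simp)
  refine ⟨(p * s - q * r)⁻¹ * (n.det * K.det ^ 2), mul_ne_zero (inv_ne_zero hm) hn0, ?_⟩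
  rw [mul_smul, ← e5, inv_smul_smul₀ hm]

lemma contDiffAt_jetOf {u v : (Fin 3 → ℝ) → ℝ} {x : Fin 3 → ℝ} (hu : ContDiffAt ℝ ∞ u x)
    (hv : ContDiffAt ℝ ∞ v x) : ContDiffAt ℝ ∞ (jetOf u v) x := by
  rw [contDiffAt_pi]
  intro a
  fin_cases a
  · exact contDiffAt_pi.mpr fun i => contDiffAt_pd hu
  · exact contDiffAt_pi.mpr fun i => contDiffAt_pd hv

lemma IsRegular.contDiffAt_symbolForm (hR : IsRegular Ω F G) {u v : (Fin 3 → ℝ) → ℝ}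
    {x : Fin 3 → ℝ} (hx : jetOf u v x ∈ Ω) (hj : ContDiffAt ℝ ∞ (jetOf u v) x) (i j : Fin 3) :
    ContDiffAt ℝ ∞ (fun y => symbolForm F G (jetOf u v y) i j) x := by
  have h1 : ∀ a i, ContDiffAt ℝ ∞ (fun y => jetDeriv F a i (jetOf u v y)) x := fun a i =>
    ContDiffAt.comp x ((contDiffAt_fderiv (hR.contDiffAt_left hx)).clm_apply contDiffAt_const) hj
  have h2 : ∀ a i, ContDiffAt ℝ ∞ (fun y => jetDeriv G a i (jetOf u v y)) x := fun a i =>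
    ContDiffAt.comp x ((contDiffAt_fderiv (hR.contDiffAt_right hx)).clm_apply contDiffAt_const) hj
  simp only [symbolForm, Matrix.of_apply]
  fun_prop (disch := assumption)

/-- The rows of C U + D along a solution are the differentials of the transformed independent
variables C (u, v) + D x. In these closed forms the symbol is conformal to its constant value at the
base point, so the metric is conformally flat. -/
theorem IsRegular.isFlatOnSolutions_of_isMongeAmpere (hR : IsRegular Ω F G)
    (h : IsMongeAmpere Ω F G) : IsFlatOnSolutions Ω F G := by
  rintro D u v ⟨hD, hu, hv, hX⟩ x₀ hx₀ p q r
  obtain ⟨P, hP⟩ := hR.exists_shift h (hX x₀ hx₀)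
  set U₀ := jetOf u v x₀ with hU₀
  set M := shift U₀ P with hM
  let L := conicMat (fderiv ℝ F U₀) (fderiv ℝ G U₀)
  let J : Fin 3 → Fin 3 → (Fin 3 → ℝ) → ℝ := fun a i y => (L * denom M (jetOf u v y)) a i
  have hux : ∀ x ∈ D, ContDiffAt ℝ ∞ u x := fun x hx => hu.contDiffAt (hD.mem_nhds hx)
  have hvx : ∀ x ∈ D, ContDiffAt ℝ ∞ v x := fun x hx => hv.contDiffAt (hD.mem_nhds hx)
  have hjx : ∀ x ∈ D, ContDiffAt ℝ ∞ (jetOf u v) x := fun x hx =>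
    contDiffAt_jetOf (hux x hx) (hvx x hx)
  have hJe : ∀ a i, J a i = fun y => (L * M.toBlocks₂₂) a i
      + (L * M.toBlocks₂₁) a 0 * pd i u y + (L * M.toBlocks₂₁) a 1 * pd i v y := by
    intro a i
    ext y
    simp [J, Matrix.mul_apply, denom, Fin.sum_univ_three, Fin.sum_univ_two, jetOf]
    ring
  have hJ : ∀ x ∈ D, ∀ a i, ContDiffAt ℝ ∞ (J a i) x := by
    intro x hx a i
    rw [hJe]
    have h1 := contDiffAt_pd (i := i) (hux x hx)
    have h2 := contDiffAt_pd (i := i) (hvx x hx)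
    fun_prop (disch := assumption)
  -- The conformal factor is read off the middle entry, where `etaInv` is -1; defined in this way it
  -- is visibly smooth.
  let κ : (Fin 3 → ℝ) → ℝ := fun y => - ((L * denom M (jetOf u v y))
    * symbolForm F G (jetOf u v y) * (L * denom M (jetOf u v y))ᵀ) 1 1
  have hκ : ∀ x ∈ D, ContDiffAt ℝ ∞ κ x := by
    intro x hx
    have h1 := hJ x hx
    have h2 := hR.contDiffAt_symbolForm (hX x hx).1 (hjx x hx)
    have e : κ = fun y => - (∑ j, (∑ i, J 1 i y * symbolForm F G (jetOf u v y) i j) * J 1 j y) := by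
      ext y
      simp only [κ, Matrix.mul_apply (M := L * denom M (jetOf u v y) * symbolForm F G _),
        Matrix.mul_apply (N := symbolForm F G _), Matrix.transpose_apply]
      rfl
    rw [e]
    simp only [Fin.sum_univ_three]
    fun_prop (disch := assumption)
  have hcd : ContinuousOn (fun y => (denom M (jetOf u v y)).det) D := fun x hx =>
    ((isMinorCombination_det_denom M).contDiff.continuous.continuousAt.comp
      (hjx x hx).continuousAt).continuousWithinAt
  -- The transformed variables are coordinates only where the denominator is invertible; at `x₀` it
  -- is the identity.
  let N := D ∩ (fun y => (denom M (jetOf u v y)).det) ⁻¹' {0}ᶜ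
  have hN : IsOpen N := hcd.isOpen_inter_preimage hD isOpen_compl_singleton
  have hL : L.det ≠ 0 := by
    rw [det_conicMat]
    exact hR.conicDet_ne_zero (hX x₀ hx₀)
  have hdet : ∀ x ∈ N, (L * denom M (jetOf u v x)).det ≠ 0 := by
    intro x hx
    rw [Matrix.det_mul]
    exact mul_ne_zero hL hx.2
  have hconj : ∀ x ∈ N, κ x ≠ 0 ∧ (L * denom M (jetOf u v x)) * symbolForm F G (jetOf u v x)
      * (L * denom M (jetOf u v x))ᵀ = κ x • etaInv := by
    intro x hx
    obtain ⟨ρ, hρ, e⟩ := hR.symb_conj (hX x₀ hx₀) (hX x hx.1) (hP _ (hX x hx.1)) hx.2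
    have e1 : (L * denom M (jetOf u v x)) * symbolForm F G (jetOf u v x)
      * (L * denom M (jetOf u v x))ᵀ
        = (ρ * conicDet (fderiv ℝ F U₀) (fderiv ℝ G U₀)) • etaInv := by
      calc _ = L * (denom M (jetOf u v x) * symbolForm F G (jetOf u v x)
            * (denom M (jetOf u v x))ᵀ) * Lᵀ := by
            simp only [Matrix.transpose_mul, Matrix.mul_assoc]
        _ = _ := by
            rw [e, symbolForm_eq, Matrix.mul_smul, Matrix.smul_mul, conicMat_mul_symb, smul_smul]
    have e2 : κ x = ρ * conicDet (fderiv ℝ F U₀) (fderiv ℝ G U₀) := by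
      simp only [κ]
      rw [e1]
      simp [etaInv]
    rw [e2]
    exact ⟨mul_ne_zero hρ (hR.conicDet_ne_zero (hX x₀ hx₀)), e1⟩
  have hmetric : ∀ x ∈ N, ∀ i j, charMetric F G u v x i j
      = (κ x)⁻¹ * eta (fun a => J a i x) fun a => J a j x := by
    intro x hx i j
    obtain ⟨h0, e⟩ := hconj x hx
    set A := L * denom M (jetOf u v x) with hA
    have hu1 : IsUnit A.det := isUnit_iff_ne_zero.mpr (hdet x hx)
    have e1 : symbolForm F G (jetOf u v x) * ((κ x)⁻¹ • (Aᵀ * etaMat * A)) = 1 := by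
      have e2 : A * (symbolForm F G (jetOf u v x) * ((κ x)⁻¹ • (Aᵀ * etaMat * A))) = A * 1 := by
        calc _ = (κ x)⁻¹ • ((A * symbolForm F G (jetOf u v x) * Aᵀ) * etaMat * A) := by
              simp only [Matrix.mul_smul, Matrix.mul_assoc]
          _ = _ := by
              rw [e, Matrix.smul_mul, Matrix.smul_mul, smul_smul, inv_mul_cancel₀ h0, one_smul,
                mul_eq_one_comm.mp etaMat_mul_etaInv, Matrix.one_mul, Matrix.mul_one]
      have := congrArg (fun B => A⁻¹ * B) e2
      simpa only [Matrix.nonsing_inv_mul_cancel_left _ _ hu1] using this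
    rw [charMetric, Matrix.inv_eq_right_inv e1, Matrix.smul_apply, smul_eq_mul]
    congr 1
    have : ∀ a i, J a i x = A a i := fun _ _ => rfl
    simp only [this]
    simp [eta, etaMat, Matrix.mul_apply, Fin.sum_univ_three]
    ring
  obtain ⟨l, hl⟩ := exists_isConformallyFlatOn (g := charMetric F G u v) (c := fun y => (κ y)⁻¹)
    (J := J) hN (fun x hx => (hκ x hx.1).inv (hconj x hx).1) (fun x hx => hJ x hx.1)
    (fun x hx => inv_ne_zero (hconj x hx).1) hdet hmetric (fun x hx a i j => by
      have h1 := fun i => (contDiffAt_pd (i := i) (hux x hx.1)).differentiableAt (by simp)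
      have h2 := fun i => (contDiffAt_pd (i := i) (hvx x hx.1)).differentiableAt (by simp)
      rw [hJe, hJe]
      simp (disch := fun_prop (disch := assumption)) only [pd_mul, pd_add, pd_const]
      rw [pd_pd_comm (hux x hx.1), pd_pd_comm (hvx x hx.1)]
      ring)
  refine hl.cotton_eq_zero ⟨hx₀, ?_⟩ p q r
  change (denom M U₀).det ≠ 0
  rw [hM, denom_shift_self, Matrix.det_one]
  exact one_ne_zero

end

/-! ## Second fundamental form along characteristic directions -/

section

/-- The matrix of rank one with column `(x, y)` and row `L`. -/
def tens (x y : ℝ) (L : Fin 3 → ℝ) : Jet := ![x • L, y • L]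

lemma charDir_eq_tens (α β : Jet →L[ℝ] ℝ) (x y : ℝ) :
    charDir α β x y = tens x y (charVec α β x y) := by
  ext a i
  fin_cases a
  · exact congrFun (charDir_zero α β x y) i
  · exact congrFun (charDir_one α β x y) i

lemma apply_tens (α : Jet →L[ℝ] ℝ) (x y : ℝ) (L : Fin 3 → ℝ) :
    α (tens x y L) = (x • row α 0 + y • row α 1) ⬝ᵥ L := by
  rw [apply_eq_row]
  simp [tens, dotProduct, Fin.sum_univ_three]
  ring

/-- The symbol is alternating in the row index, so replacing the standard basis of ℝ² by (x, y), (z,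
w) multiplies it by x w - y z. -/
lemma two_mul_symb (α β : Jet →L[ℝ] ℝ) (x y z w : ℝ) (L M : Fin 3 → ℝ) :
    2 * (x * w - y * z) * (M ⬝ᵥ symb α β *ᵥ L)
      = α (tens x y L) * β (tens z w M) + α (tens x y M) * β (tens z w L)
        - α (tens z w L) * β (tens x y M) - α (tens z w M) * β (tens x y L) := by
  have hs : ∀ i j, symb α β i j = (1 / 2 : ℝ) * (row α 0 i * row β 1 j + row α 0 j * row β 1 i
      - row α 1 i * row β 0 j - row α 1 j * row β 0 i) := fun _ _ => rfl
  simp only [apply_tens, dotProduct, Fin.sum_univ_three, Matrix.mulVec, hs, Pi.add_apply,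
    Pi.smul_apply, smul_eq_mul]
  ring

/-- The derivative of `charVec` in the direction `(z, w)`. -/
def charVecDeriv (α β : Jet →L[ℝ] ℝ) (x y z w : ℝ) : Fin 3 → ℝ :=
  (2 * x * z) • conic α β 0 + (x * w + y * z) • conic α β 1 + (2 * y * w) • conic α β 2

lemma hasDerivAt_charVec (α β : Jet →L[ℝ] ℝ) (x y z w : ℝ) :
    HasDerivAt (fun s : ℝ => charVec α β (x + s * z) (y + s * w)) (charVecDeriv α β x y z w) 0 := by
  have h1 : HasDerivAt (fun s : ℝ => x + s * z) z 0 := by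
    simpa using ((hasDerivAt_id (0 : ℝ)).mul_const z).const_add x
  have h2 : HasDerivAt (fun s : ℝ => y + s * w) w 0 := by
    simpa using ((hasDerivAt_id (0 : ℝ)).mul_const w).const_add y
  have := (((h1.fun_pow 2).smul_const (conic α β 0)).add
    ((h1.mul h2).smul_const (conic α β 1))).add ((h2.fun_pow 2).smul_const (conic α β 2))
  refine this.congr_deriv ?_
  simp only [charVecDeriv]
  norm_num
  module

lemma hasDerivAt_tens {L : ℝ → Fin 3 → ℝ} {L' : Fin 3 → ℝ} (x y z w : ℝ)
    (h : HasDerivAt L L' 0) :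
    HasDerivAt (fun s : ℝ => tens (x + s * z) (y + s * w) (L s))
      (tens x y L' + tens z w (L 0)) 0 := by
  have h1 : HasDerivAt (fun s : ℝ => x + s * z) z 0 := by
    simpa using ((hasDerivAt_id (0 : ℝ)).mul_const z).const_add x
  have h2 : HasDerivAt (fun s : ℝ => y + s * w) w 0 := by
    simpa using ((hasDerivAt_id (0 : ℝ)).mul_const w).const_add y
  rw [hasDerivAt_pi]
  intro a
  fin_cases a
  · exact (h1.smul h).congr_deriv (g' := x • L' + z • L 0) (by simp)
  · exact (h2.smul h).congr_deriv (g' := y • L' + w • L 0) (by simp)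

lemma charVec_eq_cross (α β : Jet →L[ℝ] ℝ) (x y : ℝ) :
    charVec α β x y = (x • row α 0 + y • row α 1) ⨯₃ (x • row β 0 + y • row β 1) := by
  ext i
  fin_cases i <;>
  · simp [charVec, conic, cross_apply]
    ring

/-- The point of the conic at (x, y) and its derivative span the tangent line there, which meets the
conic only at that parameter, and doubly. This gives two factors x w - y z; the third comes from
differentiating towards (z, w). -/
lemma det_charVec (α β : Jet →L[ℝ] ℝ) (x y z w : ℝ) :
    charVec α β z w ⬝ᵥ (charVec α β x y ⨯₃ charVecDeriv α β x y z w)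
      = (x * w - y * z) ^ 3 * conicDet α β := by
  simp only [charVec, charVecDeriv, conicDet]
  generalize conic α β 0 = A
  generalize conic α β 1 = B
  generalize conic α β 2 = C
  simp only [cross_apply, dotProduct, Fin.sum_univ_three, Pi.add_apply, Pi.smul_apply,
    smul_eq_mul, Matrix.cons_val]
  ring

lemma apply_tens_charVec (α β : Jet →L[ℝ] ℝ) (x y : ℝ) :
    α (tens x y (charVec α β x y)) = 0 ∧ β (tens x y (charVec α β x y)) = 0 := by
  rw [← charDir_eq_tens]
  exact ⟨apply_charDir_left α β x y, apply_charDir_right α β x y⟩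

/-- The quadratic forms `A` and `B` vanish on the characteristic directions if for each of them the
variation of the symbol respects the polar line. -/
theorem eq_zero_of_symb_variation {α β : Jet →L[ℝ] ℝ} (hdet : conicDet α β ≠ 0)
    {A B : Jet →L[ℝ] Jet →L[ℝ] ℝ} (hA : ∀ H K, A H K = A K H) (hB : ∀ H K, B H K = B K H)
    (h : ∀ x y : ℝ, ∃ μ : ℝ, (symb (A (charDir α β x y)) β + symb α (B (charDir α β x y)))
      *ᵥ charVec α β x y = μ • (symb α β *ᵥ charVec α β x y)) (x y : ℝ) :
    A (charDir α β x y) (charDir α β x y) = 0 ∧ B (charDir α β x y) (charDir α β x y) = 0 := by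
  by_cases hxy : x = 0 ∧ y = 0
  · have : charDir α β x y = 0 := by
      rw [hxy.1, hxy.2, charDir]; simp
    simp [this]
  obtain ⟨z, w, hD⟩ : ∃ z w : ℝ, x * w - y * z ≠ 0 := by
    by_cases hx : x = 0
    · exact ⟨1, 0, by simpa using fun hy => hxy ⟨hx, hy⟩⟩
    · exact ⟨0, 1, by simpa using hx⟩
  -- the first relation, on all of the line through `(x, y)` in the direction `(z, w)`
  have r1 : ∀ x y : ℝ, x * w - y * z ≠ 0 →
      A (tens x y (charVec α β x y)) (tens x y (charVec α β x y))
          * β (tens z w (charVec α β x y))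
        - B (tens x y (charVec α β x y)) (tens x y (charVec α β x y))
          * α (tens z w (charVec α β x y)) = 0 := by
    intro x y hD
    obtain ⟨μ, hμ⟩ := h x y
    rw [charDir_eq_tens] at hμ
    have e := congrArg (fun v => 2 * (x * w - y * z) * (charVec α β x y ⬝ᵥ v)) hμ
    simp only [Matrix.add_mulVec, dotProduct_add, dotProduct_smul, smul_eq_mul, mul_add] at e
    have e2 := two_mul_symb α β x y z w (charVec α β x y) (charVec α β x y)
    obtain ⟨a1, a2⟩ := apply_tens_charVec α β x y
    rw [two_mul_symb, two_mul_symb, mul_left_comm, e2, a1, a2] at e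
    linear_combination e / 2
  set L := charVec α β x y with hL
  set W := charVecDeriv α β x y z w with hW
  set t := tens x y L with ht
  set e := tens x y W + tens z w L with he
  obtain ⟨a1, a2⟩ := apply_tens_charVec α β x y
  have ht' := hasDerivAt_tens x y z w (hasDerivAt_charVec α β x y z w)
  have hL' := hasDerivAt_charVec α β x y z w
  have h0 : charVec α β (x + 0 * z) (y + 0 * w) = L := by simp [hL]
  have h0' : tens (x + 0 * z) (y + 0 * w) L = t := by simp [ht]
  have hz' : HasDerivAt (fun s : ℝ => tens z w (charVec α β (x + s * z) (y + s * w)))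
      (tens z w W) 0 := by
    rw [hasDerivAt_pi]
    intro a
    fin_cases a
    · exact hL'.const_smul z
    · exact hL'.const_smul w
  rw [h0] at ht'
  have hq : ∀ A : Jet →L[ℝ] Jet →L[ℝ] ℝ, (∀ H K, A H K = A K H) → HasDerivAt (fun s : ℝ =>
      A (tens (x + s * z) (y + s * w) (charVec α β (x + s * z) (y + s * w)))
        (tens (x + s * z) (y + s * w) (charVec α β (x + s * z) (y + s * w)))) (2 * A t e) 0 := by
    intro A hA
    have := ((A.hasFDerivAt.comp_hasDerivAt (0 : ℝ) ht').clm_apply ht')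
    refine this.congr_deriv ?_
    simp only [Function.comp_apply, h0, h0']
    rw [hA _ t]
    ring
  have hl : ∀ α' : Jet →L[ℝ] ℝ, HasDerivAt (fun s : ℝ =>
      α' (tens z w (charVec α β (x + s * z) (y + s * w)))) (α' (tens z w W)) 0 := fun α' =>
    α'.hasFDerivAt.comp_hasDerivAt (0 : ℝ) hz'
  -- The derivative of the first relation along the parameter; differentiating the quadratic terms
  -- produces a factor of two.
  have r2 : 2 * A t e * β (tens z w L) + A t t * β (tens z w W)
      - (2 * B t e * α (tens z w L) + B t t * α (tens z w W)) = 0 := by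
    have hd := ((hq A hA).mul (hl β)).sub ((hq B hB).mul (hl α))
    have hc : HasDerivAt (fun _ : ℝ => (0 : ℝ)) 0 0 := hasDerivAt_const _ _
    have := (hd.congr_of_eventuallyEq (f₁ := fun _ : ℝ => (0 : ℝ))
      (Filter.Eventually.of_forall fun s => (r1 (x + s * z) (y + s * w) (by
        have : (x + s * z) * w - (y + s * w) * z = x * w - y * z := by ring
        rwa [this])).symm)).unique hc
    simpa only [h0, h0'] using this
  have b : ∀ α' : Jet →L[ℝ] ℝ, (∀ s : ℝ, α' (tens (x + s * z) (y + s * w)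
      (charVec α β (x + s * z) (y + s * w))) = 0) → α' (tens x y W) = - α' (tens z w L) := by
    intro α' h
    have h1 := α'.hasFDerivAt.comp_hasDerivAt (0 : ℝ) ht'
    have := (h1.congr_of_eventuallyEq (f₁ := fun _ : ℝ => (0 : ℝ))
      (Filter.Eventually.of_forall fun s => (h s).symm)).unique (hasDerivAt_const _ _)
    rw [map_add] at this
    linarith
  have b1 := b α fun s => (apply_tens_charVec α β _ _).1
  have b2 := b β fun s => (apply_tens_charVec α β _ _).2
  -- The same hypothesis, paired with the derivative of the characteristic covector instead of the
  -- covector itself. Here the mixed terms appear once, not twice, so comparison with `r2`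
  -- eliminates them.
  have r3 : A t e * β (tens z w L) - B t e * α (tens z w L)
      + (A t t * β (tens z w W) - B t t * α (tens z w W)) = 0 := by
    obtain ⟨μ, hμ⟩ := h x y
    rw [charDir_eq_tens] at hμ
    have e1 := congrArg (fun v => 2 * (x * w - y * z) * (W ⬝ᵥ v)) hμ
    simp only [Matrix.add_mulVec, dotProduct_add, dotProduct_smul, smul_eq_mul, mul_add] at e1
    have e2 := two_mul_symb α β x y z w L W
    rw [two_mul_symb, two_mul_symb, mul_left_comm, e2, a1, a2, b1, b2] at e1
    have e3 : ∀ θ : Jet →L[ℝ] ℝ, θ e = θ (tens x y W) + θ (tens z w L) := fun θ => map_add θ _ _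
    rw [e3, e3]
    linear_combination e1
  have r4 := r1 x y hD
  -- By the Binet–Cauchy identity this determinant is the triple product of `det_charVec`. The two
  -- relations `r4` and `y1` then have only the zero solution.
  have hdd : β (tens z w L) * α (tens z w W) - α (tens z w L) * β (tens z w W) ≠ 0 := by
    have e1 := det_charVec α β x y z w
    rw [charVec_eq_cross α β z w, cross_dot_cross, ← apply_tens, ← apply_tens, ← apply_tens,
      ← apply_tens] at e1
    intro h0
    exact mul_ne_zero (pow_ne_zero 3 hD) hdet (by rw [← e1]; linear_combination -h0)
  have y1 : A t t * β (tens z w W) - B t t * α (tens z w W) = 0 := by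
    linear_combination 2 * r3 - r2
  rw [charDir_eq_tens]
  constructor
  · refine (mul_eq_zero.mp (?_ : _ * A t t = 0)).resolve_left hdd
    linear_combination α (tens z w W) * r4 - α (tens z w L) * y1
  · refine (mul_eq_zero.mp (?_ : _ * B t t = 0)).resolve_left hdd
    linear_combination β (tens z w W) * r4 - β (tens z w L) * y1

end

/-! ## Simple waves -/

section Existence

variable {E E' : Type*} [NormedAddCommGroup E] [NormedSpace ℝ E] [CompleteSpace E]
  [NormedAddCommGroup E'] [NormedSpace ℝ E']

/-- Integral curves of smooth vector fields are smooth. -/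
lemma exists_smooth_integralCurve {Ω : Set E} (hΩ : IsOpen Ω) {f : E → E}
    (hf : ContDiffOn ℝ ∞ f Ω) {U : E} (hU : U ∈ Ω) :
    ∃ (γ : ℝ → E) (ε : ℝ), 0 < ε ∧ γ 0 = U ∧ ContDiffOn ℝ ∞ γ (Set.Ioo (-ε) ε) ∧
      ∀ t ∈ Set.Ioo (-ε) ε, γ t ∈ Ω ∧ HasDerivAt γ (f (γ t)) t := by
  obtain ⟨γ, h0, ε, hε, hγ⟩ := ((hf.contDiffAt (hΩ.mem_nhds hU)).of_le
    (by simp : (1 : ℕ∞ω) ≤ ∞)).exists_forall_mem_closedBall_exists_eq_forall_mem_Ioo_hasDerivAt₀ 0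
  have hc : ContinuousAt γ 0 := (hγ 0 (by simpa using hε)).continuousAt
  have hn : γ ⁻¹' Ω ∈ 𝓝 0 := hc.preimage_mem_nhds (by rw [h0]; exact hΩ.mem_nhds hU)
  obtain ⟨δ, hδ, hb⟩ := Metric.mem_nhds_iff.mp hn
  let η := min ε δ / 2
  have hη : 0 < η := by positivity
  have h1 : η < ε := by have := min_le_left ε δ; simp only [η]; linarith
  have h2 : η < δ := by have := min_le_right ε δ; simp only [η]; linarith
  have hI : ∀ t ∈ Set.Icc (-η) η, γ t ∈ Ω ∧ HasDerivAt γ (f (γ t)) t := by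
    intro t ht
    refine ⟨hb ?_, hγ t ⟨by linarith [ht.1], by linarith [ht.2]⟩⟩
    rw [Metric.mem_ball, Real.dist_eq, sub_zero, abs_lt]
    exact ⟨by linarith [ht.1], by linarith [ht.2]⟩
  refine ⟨γ, η, hη, h0, ?_, fun t ht => hI t (Set.Ioo_subset_Icc_self ht)⟩
  have hF : ContDiffOn ℝ ((⊤ : ℕ∞) : ℕ∞ω) (Function.uncurry fun _ : ℝ => f) (Set.Icc (-η) η ×ˢ Ω) :=
    hf.comp contDiffOn_snd fun (p : ℝ × E) hp => hp.2
  exact (ODE.contDiffOn_enat_Icc_of_hasDerivWithinAt hF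
    (fun t ht => (hI t ht).2.hasDerivWithinAt) fun t ht => (hI t ht).1).mono
    Set.Ioo_subset_Icc_self

/-- The smooth inverse function theorem with smoothness on a neighbourhood. -/
lemma exists_smooth_localInverse {s : Set E} (hs : IsOpen s) {f : E → E'}
    (hf : ContDiffOn ℝ ∞ f s) {a : E} (ha : a ∈ s) {f' : E ≃L[ℝ] E'}
    (hf' : HasFDerivAt f (f' : E →L[ℝ] E') a) :
    ∃ (g : E' → E) (T : Set E'), IsOpen T ∧ f a ∈ T ∧ g (f a) = a ∧ ContDiffOn ℝ ∞ g T ∧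
      ∀ y ∈ T, g y ∈ s ∧ f (g y) = y := by
  have hfa := hf.contDiffAt (hs.mem_nhds ha)
  let e := hfa.toOpenPartialHomeomorph f hf' (by simp)
  have he : ∀ x, e x = f x := fun _ => rfl
  have hea : a ∈ e.source := hfa.mem_toOpenPartialHomeomorph_source hf' (by simp)
  -- The set where the differential stays invertible is open, and on it the local inverse is smooth,
  -- rather than merely at the image of a.
  let s' := s ∩ (fderiv ℝ f) ⁻¹' Set.range ((↑) : (E ≃L[ℝ] E') → E →L[ℝ] E')
  have hs' : IsOpen s' := (hf.continuousOn_fderiv_of_isOpen hs (by simp)).isOpen_inter_preimage hs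
    ContinuousLinearEquiv.isOpen
  have ha' : a ∈ s' := ⟨ha, f', hf'.fderiv.symm⟩
  have hsy : e.symm (f a) = a := e.left_inv hea
  refine ⟨e.symm, e.target ∩ e.symm ⁻¹' s', e.isOpen_inter_preimage_symm hs',
    ⟨e.map_source hea, ?_⟩, hsy, fun y hy => ?_, fun y hy => ⟨hy.2.1, e.right_inv hy.1⟩⟩
  · rw [Set.mem_preimage, hsy]; exact ha'
  · obtain ⟨g', hg'⟩ := hy.2.2
    have hfy := hf.contDiffAt (hs.mem_nhds hy.2.1)
    refine (e.contDiffAt_symm hy.1 (f₀' := g') ?_ hfy).contDiffWithinAt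
    rw [hg']
    exact (hfy.differentiableAt (by simp)).hasFDerivAt

end Existence

/-- The solution `σ` of `σ = ∑ ℓₐ(σ) xᵃ`. -/
lemma exists_phase {ℓ : ℝ → Fin 3 → ℝ} {I : Set ℝ} (hI : IsOpen I) (h0 : (0 : ℝ) ∈ I)
    (hℓ : ContDiffOn ℝ ∞ ℓ I) :
    ∃ (D : Set (Fin 3 → ℝ)) (σ : (Fin 3 → ℝ) → ℝ), IsOpen D ∧ 0 ∈ D ∧ σ 0 = 0 ∧
      ContDiffOn ℝ ∞ σ D ∧ ∀ x ∈ D, σ x ∈ I ∧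
        σ x = ℓ (σ x) 0 * x 0 + ℓ (σ x) 1 * x 1 + ℓ (σ x) 2 * x 2 := by
  let s : Set ((Fin 3 → ℝ) × ℝ) := Set.univ ×ˢ I
  have hs : IsOpen s := isOpen_univ.prod hI
  -- The phase is the second component of the local inverse on the slice where the second coordinate
  -- is zero; at the origin the differential is unipotent.
  let f : (Fin 3 → ℝ) × ℝ → (Fin 3 → ℝ) × ℝ := fun p =>
    (p.1, p.2 - (ℓ p.2 0 * p.1 0 + ℓ p.2 1 * p.1 1 + ℓ p.2 2 * p.1 2))
  have hℓa : ∀ a, ContDiffOn ℝ ∞ (fun p : (Fin 3 → ℝ) × ℝ => ℓ p.2 a) s := fun a =>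
    (contDiffOn_pi.mp hℓ a).comp contDiffOn_snd fun p hp => hp.2
  have hf : ContDiffOn ℝ ∞ f s := by
    have hp : ∀ a, ContDiffOn ℝ ∞ (fun p : (Fin 3 → ℝ) × ℝ => p.1 a) s := fun a => by fun_prop
    exact contDiffOn_fst.prodMk (contDiffOn_snd.sub ((((hℓa 0).mul (hp 0)).add
      ((hℓa 1).mul (hp 1))).add ((hℓa 2).mul (hp 2))))
  let P : Fin 3 → (Fin 3 → ℝ) × ℝ →L[ℝ] ℝ := fun a =>
    (ContinuousLinearMap.proj a).comp (ContinuousLinearMap.fst ℝ (Fin 3 → ℝ) ℝ)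
  let l : (Fin 3 → ℝ) × ℝ →L[ℝ] ℝ := ℓ 0 0 • P 0 + ℓ 0 1 • P 1 + ℓ 0 2 • P 2
  let f₁ : (Fin 3 → ℝ) × ℝ →L[ℝ] (Fin 3 → ℝ) × ℝ :=
    (ContinuousLinearMap.fst ℝ _ _).prod (ContinuousLinearMap.snd ℝ _ _ - l)
  let f₂ : (Fin 3 → ℝ) × ℝ →L[ℝ] (Fin 3 → ℝ) × ℝ :=
    (ContinuousLinearMap.fst ℝ _ _).prod (ContinuousLinearMap.snd ℝ _ _ + l)
  let f' : ((Fin 3 → ℝ) × ℝ) ≃L[ℝ] (Fin 3 → ℝ) × ℝ := ContinuousLinearEquiv.equivOfInverse f₁ f₂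
    (fun p => by ext <;> simp [f₁, f₂, l, P]) (fun p => by ext <;> simp [f₁, f₂, l, P])
  have hf' : HasFDerivAt f (f' : (Fin 3 → ℝ) × ℝ →L[ℝ] (Fin 3 → ℝ) × ℝ) (0, 0) := by
    have hP : ∀ a, HasFDerivAt (fun p : (Fin 3 → ℝ) × ℝ => p.1 a) (P a) (0, 0) := fun a =>
      (P a).hasFDerivAt
    have hd : ∀ a, HasFDerivAt (fun p : (Fin 3 → ℝ) × ℝ => ℓ p.2 a * p.1 a)
        (ℓ 0 a • P a) (0, 0) := by
      intro a
      have h1 := (((hℓa a).contDiffAt (hs.mem_nhds (⟨trivial, h0⟩ :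
        ((0, 0) : (Fin 3 → ℝ) × ℝ) ∈ s))).differentiableAt (by simp)).hasFDerivAt
      exact (h1.mul (hP a)).congr_fderiv (by simp)
    exact hasFDerivAt_fst.prodMk (hasFDerivAt_snd.sub (((hd 0).add (hd 1)).add (hd 2)))
  obtain ⟨g, T, hT, h0T, hg0, hg, hgT⟩ := exists_smooth_localInverse hs hf
    (⟨trivial, h0⟩ : ((0, 0) : (Fin 3 → ℝ) × ℝ) ∈ s) hf'
  have hf0 : f (0, 0) = (0, 0) := by simp [f]
  rw [hf0] at h0T hg0
  let i : (Fin 3 → ℝ) → (Fin 3 → ℝ) × ℝ := fun x => (x, 0)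
  have hi : ContDiff ℝ ∞ i := contDiff_id.prodMk contDiff_const
  refine ⟨i ⁻¹' T, fun x => (g (x, 0)).2, hT.preimage hi.continuous, h0T, by
    change (g (0, 0)).2 = 0
    rw [hg0], contDiff_snd.comp_contDiffOn (hg.comp hi.contDiffOn fun x hx => hx), fun x hx => ?_⟩
  obtain ⟨h1, h2⟩ := hgT (x, 0) hx
  refine ⟨h1.2, ?_⟩
  have e1 : (g (x, 0)).1 = x := congrArg Prod.fst h2
  have e2 : (g (x, 0)).2 - (ℓ (g (x, 0)).2 0 * (g (x, 0)).1 0 + ℓ (g (x, 0)).2 1 * (g (x, 0)).1 1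
    + ℓ (g (x, 0)).2 2 * (g (x, 0)).1 2) = 0 := congrArg Prod.snd h2
  rw [e1] at e2
  linarith

section SimpleWave

lemma contDiffAt_coord (j : Fin 3) (z : Fin 3 → ℝ) :
    ContDiffAt ℝ ∞ (fun z : Fin 3 → ℝ => z j) z := contDiffAt_pi.mp contDiffAt_id j

lemma pd_coord (i j : Fin 3) (z : Fin 3 → ℝ) :
    pd i (fun z : Fin 3 → ℝ => z j) z = (Pi.single i 1 : Fin 3 → ℝ) j := by
  have : HasFDerivAt (fun z : Fin 3 → ℝ => z j)
    (ContinuousLinearMap.proj j : (Fin 3 → ℝ) →L[ℝ] ℝ) z := hasFDerivAt_apply j z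
  rw [pd, this.fderiv]
  rfl

lemma contDiffAt_wave {p : Fin 3 → (Fin 3 → ℝ) → ℝ} {s : (Fin 3 → ℝ) → ℝ} {z : Fin 3 → ℝ} (c : ℝ)
    (hp : ∀ j, ContDiffAt ℝ ∞ (p j) z) (hs : ContDiffAt ℝ ∞ s z) :
    ContDiffAt ℝ ∞ (fun z => p 0 z * z 0 + p 1 z * z 1 + p 2 z * z 2
      - c * (s z * s z * (s z * s z))) z := by
  have hx := fun j => contDiffAt_coord j z
  exact ((((hp 0).mul (hx 0)).add ((hp 1).mul (hx 1))).add ((hp 2).mul (hx 2))).sub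
    (contDiffAt_const.mul ((hs.mul hs).mul (hs.mul hs)))

lemma pd_wave {p : Fin 3 → (Fin 3 → ℝ) → ℝ} {s : (Fin 3 → ℝ) → ℝ} {z : Fin 3 → ℝ} {i : Fin 3}
    (c : ℝ) (hp : ∀ j, DifferentiableAt ℝ (p j) z) (hs : DifferentiableAt ℝ s z) :
    pd i (fun z => p 0 z * z 0 + p 1 z * z 1 + p 2 z * z 2 - c * (s z * s z * (s z * s z))) z
      = pd i (p 0) z * z 0 + pd i (p 1) z * z 1 + pd i (p 2) z * z 2 + p i z
        - c * (4 * s z ^ 3 * pd i s z) := by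
  have hx : ∀ j, DifferentiableAt ℝ (fun z : Fin 3 → ℝ => z j) z := fun j =>
    (contDiffAt_coord j z).differentiableAt (by simp)
  have hpx := fun j => pd_coord i j z
  have h1 : ∀ j, pd i (fun z => p j z * z j) z
      = pd i (p j) z * z j + p j z * (Pi.single i 1 : Fin 3 → ℝ) j := fun j => by
    rw [pd_mul (hp j) (hx j), hpx]
  have h2 : ∀ j, DifferentiableAt ℝ (fun z => p j z * z j) z := fun j => (hp j).mul (hx j)
  have h3 : DifferentiableAt ℝ (fun z => s z * s z) z := hs.mul hs
  have h4 : DifferentiableAt ℝ (fun z => s z * s z * (s z * s z)) z := h3.mul h3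
  rw [pd_sub (((h2 0).fun_add (h2 1)).fun_add (h2 2)) (h4.const_mul c),
    pd_add ((h2 0).fun_add (h2 1)) (h2 2),
    pd_add (h2 0) (h2 1), pd_mul (differentiableAt_const c) h4, pd_mul h3 h3, pd_mul hs hs,
    pd_const, h1, h1, h1]
  have e : p 0 z * (Pi.single i 1 : Fin 3 → ℝ) 0 + p 1 z * (Pi.single i 1 : Fin 3 → ℝ) 1
      + p 2 z * (Pi.single i 1 : Fin 3 → ℝ) 2 = p i z := by
    fin_cases i <;> simp
  linear_combination e

variable {Ω : Set Jet} {F G : Jet → ℝ} {U : Jet}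

/-- Characteristic directions are tangent to all level sets of F and G, not just to the zero set, so
an integral curve that starts in the fourfold remains in it. -/
lemma IsRegular.exists_charCurve (hR : IsRegular Ω F G) (hU : U ∈ fourfold Ω F G) (x y : ℝ) :
    ∃ (γ : ℝ → Jet) (I : Set ℝ), IsOpen I ∧ 0 ∈ I ∧ γ 0 = U ∧ ContDiffOn ℝ ∞ γ I ∧
      ∀ t ∈ I, γ t ∈ fourfold Ω F G ∧ HasDerivAt γ (tchar F G x y (γ t)) t := by
  have hf : ContDiffOn ℝ ∞ (tchar F G x y) Ω := fun V hV =>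
    (contDiffAt_charDir (contDiffAt_fderiv (hR.contDiffAt_left hV))
      (contDiffAt_fderiv (hR.contDiffAt_right hV)) x y).contDiffWithinAt
  obtain ⟨γ, ε, hε, h0, hs, hγ⟩ := exists_smooth_integralCurve hR.isOpen hf hU.1
  have h0I : (0 : ℝ) ∈ Set.Ioo (-ε) ε := ⟨by linarith, hε⟩
  have hz : ∀ K : Jet → ℝ, ContDiffOn ℝ ∞ K Ω → K U = 0 →
      (∀ V, fderiv ℝ K V (tchar F G x y V) = 0) → ∀ t ∈ Set.Ioo (-ε) ε, K (γ t) = 0 := by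
    intro K hK hKU hd t ht
    have hder : ∀ t ∈ Set.Ioo (-ε) ε, HasDerivAt (K ∘ γ) 0 t := by
      intro t ht
      have h1 := ((hK.contDiffAt (hR.isOpen.mem_nhds (hγ t ht).1)).differentiableAt
        (by simp)).hasFDerivAt.comp_hasDerivAt t (hγ t ht).2
      rwa [hd] at h1
    have := isOpen_Ioo.is_const_of_deriv_eq_zero isPreconnected_Ioo
      (fun t ht => (hder t ht).differentiableAt.differentiableWithinAt)
      (fun t ht => (hder t ht).deriv) ht h0I
    rw [Function.comp_apply, Function.comp_apply, h0, hKU] at this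
    exact this
  refine ⟨γ, Set.Ioo (-ε) ε, isOpen_Ioo, h0I, h0, hs, fun t ht => ⟨⟨(hγ t ht).1, ?_, ?_⟩,
    (hγ t ht).2⟩⟩
  · exact hz F hR.left hU.2.1 (fun V => apply_charDir_left _ _ x y) t ht
  · exact hz G hR.right hU.2.2 (fun V => apply_charDir_right _ _ x y) t ht

/-- A solution whose jet moves along a characteristic curve and is constant up to terms of third
order at the origin. -/
lemma IsRegular.exists_simpleWave (hR : IsRegular Ω F G) (hU : U ∈ fourfold Ω F G) (x y : ℝ) :
    ∃ (D : Set (Fin 3 → ℝ)) (u v σ : (Fin 3 → ℝ) → ℝ) (γ : ℝ → Jet), IsSolution Ω F G D u v ∧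
      0 ∈ D ∧ ContDiffAt ℝ ∞ σ 0 ∧ σ 0 = 0 ∧
      (∀ i, pd i σ 0 = charVec (fderiv ℝ F U) (fderiv ℝ G U) x y i) ∧ ContDiffAt ℝ ∞ γ 0 ∧
      γ 0 = U ∧ HasDerivAt γ (tchar F G x y U) 0 ∧ ∀ z ∈ D, jetOf u v z = γ (σ z ^ 3) := by
  obtain ⟨γ, I, hI, h0I, hγ0, hγs, hγ⟩ := hR.exists_charCurve hU x y
  let Λ : Jet → Fin 3 → ℝ := fun V => charVec (fderiv ℝ F V) (fderiv ℝ G V) x y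
  have hΛ : ∀ V ∈ Ω, ContDiffAt ℝ ∞ Λ V := by
    intro V hV
    have h := contDiffAt_conic (contDiffAt_fderiv (hR.contDiffAt_left hV))
      (contDiffAt_fderiv (hR.contDiffAt_right hV))
    exact (((h 0).const_smul _).add ((h 1).const_smul _)).add ((h 2).const_smul _)
  let I' : Set ℝ := (fun s : ℝ => s ^ 3) ⁻¹' I
  have hI' : IsOpen I' := hI.preimage (by fun_prop)
  have h0I' : (0 : ℝ) ∈ I' := by simpa [I'] using h0I
  -- The characteristic curve is run at the parameter s³, so that the jet is constant up to terms of
  -- third order at the origin, the order of derivatives of the metric in the Cotton tensor.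
  let ℓ : ℝ → Fin 3 → ℝ := fun s => Λ (γ (s ^ 3))
  have hℓ : ContDiffOn ℝ ∞ ℓ I' := by
    intro s hs
    have h1 : ContDiffAt ℝ ∞ γ (s ^ 3) := hγs.contDiffAt (hI.mem_nhds hs)
    have h2 : ContDiffAt ℝ ∞ (fun s : ℝ => s ^ 3) s := by fun_prop
    exact ((hΛ _ (hγ _ hs).1.1).comp s
      (ContDiffAt.comp (f := fun s : ℝ => s ^ 3) s h1 h2)).contDiffWithinAt
  obtain ⟨D, σ, hD, h0D, hσ0, hσs, hσ⟩ := exists_phase hI' h0I' hℓ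
  have hσx : ∀ z ∈ D, ContDiffAt ℝ ∞ σ z := fun z hz => hσs.contDiffAt (hD.mem_nhds hz)
  have hcube : ∀ z ∈ D, ContDiffAt ℝ ∞ (fun z => σ z ^ 3) z := fun z hz => (hσx z hz).pow 3
  have hγx : ∀ z ∈ D, ∀ a i, ContDiffAt ℝ ∞ (fun z => γ (σ z ^ 3) a i) z := fun z hz a i =>
    contDiffAt_pi.mp (contDiffAt_pi.mp (ContDiffAt.comp z
      (hγs.contDiffAt (hI.mem_nhds (hσ z hz).1)) (hcube z hz)) a) i
  have hpγ : ∀ z ∈ D, ∀ a i j, pd i (fun z => γ (σ z ^ 3) a j) z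
      = tchar F G x y (γ (σ z ^ 3)) a j * (3 * σ z ^ 2 * pd i σ z) := by
    intro z hz a i j
    have h1 := (hasDerivAt_pow 3 (σ z)).comp_hasFDerivAt z
      ((hσx z hz).differentiableAt (by simp)).hasFDerivAt
    have h2 := hasDerivAt_pi.mp (hasDerivAt_pi.mp (hγ _ (hσ z hz).1).2 a) j
    have h3 := h2.comp_hasFDerivAt z h1
    have h4 : pd i (fun z => γ (σ z ^ 3) a j) z = _ :=
      congrArg (fun L => L (Pi.single i 1)) h3.fderiv
    rw [h4]
    simp [pd]
  -- A Legendre-type ansatz: the quartic correction compensates for the dependence of γ on x, so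
  -- that the gradient of w is exactly the jet row.
  let w : ℝ → Fin 2 → (Fin 3 → ℝ) → ℝ := fun c a z =>
    γ (σ z ^ 3) a 0 * z 0 + γ (σ z ^ 3) a 1 * z 1 + γ (σ z ^ 3) a 2 * z 2
      - c * (σ z * σ z * (σ z * σ z))
  have hw : ∀ c a, ∀ z ∈ D, ContDiffAt ℝ ∞ (w c a) z := by
    intro c a z hz
    have h1 := hσx z hz
    have h2 := hγx z hz a
    exact contDiffAt_wave (p := fun j z => γ (σ z ^ 3) a j) c h2 h1
  have hpw : ∀ c a k, (∀ V, ∀ j, tchar F G x y V a j = k * Λ V j) → c = 3 / 4 * k →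
      ∀ z ∈ D, ∀ i, pd i (w c a) z = γ (σ z ^ 3) a i := by
    intro c a k hk hc z hz i
    have h1 := (hσx z hz).differentiableAt (by simp)
    have h2 := fun j => (hγx z hz a j).differentiableAt (by simp)
    simp only [w]
    rw [pd_wave (p := fun j z => γ (σ z ^ 3) a j) c h2 h1]
    simp only [hpγ z hz, hk, hc]
    have e := (hσ z hz).2
    simp only [ℓ] at e
    -- The phase equation σ = ℓ(σ) · x turns the derivative of γ contracted with x into 3 k σ³ dσ,
    -- the derivative of the correction with c = 3k/4.
    linear_combination - 3 * k * σ z ^ 2 * pd i σ z * e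
  have ht0 : ∀ V j, tchar F G x y V 0 j = x * Λ V j := fun V j =>
    congrFun (charDir_zero _ _ x y) j
  have ht1 : ∀ V j, tchar F G x y V 1 j = y * Λ V j := fun V j =>
    congrFun (charDir_one _ _ x y) j
  have hjet : ∀ z ∈ D, jetOf (w (3 / 4 * x) 0) (w (3 / 4 * y) 1) z = γ (σ z ^ 3) := by
    intro z hz
    ext a i
    fin_cases a
    · exact hpw _ 0 x ht0 rfl z hz i
    · exact hpw _ 1 y ht1 rfl z hz i
  refine ⟨D, w (3 / 4 * x) 0, w (3 / 4 * y) 1, σ, γ, ⟨hD,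
    fun z hz => (hw _ _ z hz).contDiffWithinAt, fun z hz => (hw _ _ z hz).contDiffWithinAt,
    fun z hz => by rw [hjet z hz]; exact (hγ _ (hσ z hz).1).1⟩, h0D, hσx 0 h0D, hσ0, fun i => ?_,
    hγs.contDiffAt (hI.mem_nhds h0I), hγ0, by rw [← hγ0]; exact (hγ 0 h0I).2, hjet⟩
  have hl : ∀ a, DifferentiableAt ℝ (fun z => ℓ (σ z) a) 0 := by
    intro a
    have h1 : ContDiffAt ℝ ∞ ℓ (σ 0) := by rw [hσ0]; exact hℓ.contDiffAt (hI'.mem_nhds h0I')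
    exact (contDiffAt_pi.mp (ContDiffAt.comp 0 h1 (hσx 0 h0D)) a).differentiableAt (by simp)
  -- The wave formula with c = 0 differentiates the implicit equation of the phase; at the origin
  -- only the term ℓ(0) survives.
  have h4 := pd_wave (p := fun a z => ℓ (σ z) a) (i := i) 0 hl
    ((hσx 0 h0D).differentiableAt (by simp))
  simp only [zero_mul, sub_zero, Pi.zero_apply, mul_zero, add_zero, zero_add] at h4
  rw [pd_congr_of_isOpen hD h0D fun z hz => (hσ z hz).2, h4]
  have e : ∀ a, ℓ (σ 0) a = charVec (fderiv ℝ F U) (fderiv ℝ G U) x y a := by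
    intro a
    simp [ℓ, hσ0, Λ, hγ0]
  exact e i

end SimpleWave

/-! ## The Cotton tensor of a metric that is constant up to terms of third order -/

section Vanishing

variable {f f' a : (Fin 3 → ℝ) → ℝ} {x : Fin 3 → ℝ}

/-- `f` is smooth and vanishes at `x`, where its gradient is `h`. -/
structure VanishesOnce (f : (Fin 3 → ℝ) → ℝ) (x : Fin 3 → ℝ) (h : Fin 3 → ℝ) : Prop where
  smooth : ContDiffAt ℝ ∞ f x
  zero : f x = 0
  pd_eq : ∀ r, pd r f x = h r

/-- `f` is smooth and vanishes at `x` with its first derivatives, and its Hessian is `H`. -/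
structure VanishesTwice (f : (Fin 3 → ℝ) → ℝ) (x : Fin 3 → ℝ) (H : Fin 3 → Fin 3 → ℝ) : Prop where
  smooth : ContDiffAt ℝ ∞ f x
  zero : f x = 0
  pd_eq : ∀ r, VanishesOnce (pd r f) x fun s => H s r

lemma eventually_differentiableAt (hf : ContDiffAt ℝ ∞ f x) :
    ∀ᶠ y in 𝓝 x, DifferentiableAt ℝ f y := by
  have h1 : ContDiffAt ℝ 1 f x := hf.of_le (by simp)
  filter_upwards [h1.eventually (by simp)] with y hy using hy.differentiableAt (by simp)

lemma VanishesOnce.congr {h : Fin 3 → ℝ} (hf : VanishesOnce f x h) (e : f' =ᶠ[𝓝 x] f) :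
    VanishesOnce f' x h :=
  ⟨hf.smooth.congr_of_eventuallyEq e, e.eq_of_nhds.trans hf.zero,
    fun r => (pd_congr e).trans (hf.pd_eq r)⟩

lemma VanishesOnce.add {h h' : Fin 3 → ℝ} (hf : VanishesOnce f x h) (hf' : VanishesOnce f' x h') :
    VanishesOnce (fun y => f y + f' y) x fun r => h r + h' r :=
  ⟨hf.smooth.add hf'.smooth, by rw [hf.zero, hf'.zero, add_zero], fun r => by
    rw [pd_add (hf.smooth.differentiableAt (by simp)) (hf'.smooth.differentiableAt (by simp)),
      hf.pd_eq, hf'.pd_eq]⟩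

lemma VanishesOnce.sub {h h' : Fin 3 → ℝ} (hf : VanishesOnce f x h) (hf' : VanishesOnce f' x h') :
    VanishesOnce (fun y => f y - f' y) x fun r => h r - h' r :=
  ⟨hf.smooth.sub hf'.smooth, by rw [hf.zero, hf'.zero, sub_zero], fun r => by
    rw [pd_sub (hf.smooth.differentiableAt (by simp)) (hf'.smooth.differentiableAt (by simp)),
      hf.pd_eq, hf'.pd_eq]⟩

lemma VanishesOnce.mul {h : Fin 3 → ℝ} (ha : ContDiffAt ℝ ∞ a x) (hf : VanishesOnce f x h) :
    VanishesOnce (fun y => a y * f y) x fun r => a x * h r :=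
  ⟨ha.mul hf.smooth, by rw [hf.zero, mul_zero], fun r => by
    rw [pd_mul (ha.differentiableAt (by simp)) (hf.smooth.differentiableAt (by simp)),
      hf.pd_eq, hf.zero, mul_zero, zero_add]⟩

lemma VanishesOnce.sum {f : Fin 3 → (Fin 3 → ℝ) → ℝ} {h : Fin 3 → Fin 3 → ℝ}
    (hf : ∀ k, VanishesOnce (f k) x (h k)) :
    VanishesOnce (fun y => ∑ k, f k y) x fun r => ∑ k, h k r := by
  simp only [Fin.sum_univ_three]
  exact ((hf 0).add (hf 1)).add (hf 2)

lemma VanishesTwice.once {H : Fin 3 → Fin 3 → ℝ} (hf : VanishesTwice f x H) :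
    VanishesOnce f x fun _ => 0 :=
  ⟨hf.smooth, hf.zero, fun r => (hf.pd_eq r).zero⟩

lemma VanishesTwice.congr {H : Fin 3 → Fin 3 → ℝ} (hf : VanishesTwice f x H)
    (e : f' =ᶠ[𝓝 x] f) : VanishesTwice f' x H :=
  ⟨hf.smooth.congr_of_eventuallyEq e, e.eq_of_nhds.trans hf.zero,
    fun r => (hf.pd_eq r).congr (e.eventuallyEq_nhds.mono fun _ h => pd_congr h)⟩

lemma VanishesTwice.add {H H' : Fin 3 → Fin 3 → ℝ} (hf : VanishesTwice f x H)
    (hf' : VanishesTwice f' x H') :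
    VanishesTwice (fun y => f y + f' y) x fun r s => H r s + H' r s :=
  ⟨hf.smooth.add hf'.smooth, by rw [hf.zero, hf'.zero, add_zero], fun r =>
    ((hf.pd_eq r).add (hf'.pd_eq r)).congr (by
      filter_upwards [eventually_differentiableAt hf.smooth,
        eventually_differentiableAt hf'.smooth] with y h1 h2 using pd_add h1 h2)⟩

lemma VanishesTwice.sub {H H' : Fin 3 → Fin 3 → ℝ} (hf : VanishesTwice f x H)
    (hf' : VanishesTwice f' x H') :
    VanishesTwice (fun y => f y - f' y) x fun r s => H r s - H' r s :=
  ⟨hf.smooth.sub hf'.smooth, by rw [hf.zero, hf'.zero, sub_zero], fun r =>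
    ((hf.pd_eq r).sub (hf'.pd_eq r)).congr (by
      filter_upwards [eventually_differentiableAt hf.smooth,
        eventually_differentiableAt hf'.smooth] with y h1 h2 using pd_sub h1 h2)⟩

lemma VanishesTwice.mul {H : Fin 3 → Fin 3 → ℝ} (ha : ContDiffAt ℝ ∞ a x)
    (hf : VanishesTwice f x H) : VanishesTwice (fun y => a y * f y) x fun r s => a x * H r s :=
  ⟨ha.mul hf.smooth, by rw [hf.zero, mul_zero], fun r => by
    have h1 := (VanishesOnce.mul (contDiffAt_pd (i := r) ha) hf.once).add
      (VanishesOnce.mul ha (hf.pd_eq r))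
    simp only [mul_zero, zero_add] at h1
    refine h1.congr ?_
    filter_upwards [eventually_differentiableAt ha,
      eventually_differentiableAt hf.smooth] with y h1 h2 using pd_mul h1 h2⟩

lemma VanishesTwice.sum {f : Fin 3 → (Fin 3 → ℝ) → ℝ} {H : Fin 3 → Fin 3 → Fin 3 → ℝ}
    (hf : ∀ k, VanishesTwice (f k) x (H k)) :
    VanishesTwice (fun y => ∑ k, f k y) x fun r s => ∑ k, H k r s := by
  simp only [Fin.sum_univ_three]
  exact ((hf 0).add (hf 1)).add (hf 2)

/-- The gradient of the cube of a function that vanishes at `x`. -/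
lemma vanishesTwice_pd_cube {σ : (Fin 3 → ℝ) → ℝ} (hσ : ContDiffAt ℝ ∞ σ x) (h0 : σ x = 0)
    (i : Fin 3) : VanishesTwice (pd i fun y => σ y ^ 3) x
      fun r s => 6 * pd r σ x * pd s σ x * pd i σ x := by
  have hc : ContDiffAt ℝ ∞ (fun y => 3 * σ y * pd i σ y) x :=
    (contDiffAt_const.mul hσ).mul (contDiffAt_pd hσ)
  have hp3 : pd i (fun y => σ y ^ 3) =ᶠ[𝓝 x] fun y => 3 * pd i σ y * (σ y * σ y) := by
    filter_upwards [eventually_differentiableAt hσ] with y hy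
    have : (fun y => σ y ^ 3) = fun y => σ y * σ y * σ y := by ext y; ring
    rw [this, pd_mul (hy.fun_mul hy) hy, pd_mul hy hy]
    ring
  have h1 : VanishesOnce σ x fun r => pd r σ x := ⟨hσ, h0, fun _ => rfl⟩
  have h2 : VanishesTwice (fun y => σ y * σ y) x fun r s => 2 * pd r σ x * pd s σ x := by
    refine ⟨hσ.mul hσ, by rw [h0, mul_zero], fun s => ?_⟩
    have e : pd s (fun y => σ y * σ y) =ᶠ[𝓝 x] fun y => 2 * pd s σ y * σ y := by
      filter_upwards [eventually_differentiableAt hσ] with y hy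
      rw [pd_mul hy hy]; ring
    have h3 := (VanishesOnce.mul (contDiffAt_const.mul (contDiffAt_pd (i := s) hσ) :
      ContDiffAt ℝ ∞ (fun y => 2 * pd s σ y) x) h1).congr e
    convert h3 using 2
    ring
  have h4 := (VanishesTwice.mul (contDiffAt_const.mul (contDiffAt_pd (i := i) hσ) :
      ContDiffAt ℝ ∞ (fun y => 3 * pd i σ y) x) h2).congr hp3
  convert h4 using 3
  ring

end Vanishing

/-! ### Flatness on simple waves and the Hessians -/

section InverseMatrix

lemma deriv_inv_apply {M : ℝ → Matrix (Fin 3) (Fin 3) ℝ} {M' : Matrix (Fin 3) (Fin 3) ℝ} {t : ℝ}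
    (hM : ∀ i j, ContDiffAt ℝ ∞ (fun s => M s i j) t)
    (hM' : ∀ i j, HasDerivAt (fun s => M s i j) (M' i j) t) (hdet : (M t).det ≠ 0) :
    (Matrix.of fun i j => deriv (fun s => (M s)⁻¹ i j) t) = - ((M t)⁻¹ * M' * (M t)⁻¹) := by
  have hu : IsUnit (M t).det := isUnit_iff_ne_zero.mpr hdet
  have hI := fun i j => ((contDiffAt_inv_apply hM hdet i j).differentiableAt
    (by simp)).hasDerivAt
  have hdc : ContinuousAt (fun s => (M s).det) t := by
    have hc := fun i j => (hM i j).continuousAt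
    simp only [Matrix.det_fin_three]
    fun_prop (disch := assumption)
  have h1 : (Matrix.of fun i j => deriv (fun s => (M s)⁻¹ i j) t) * M t + (M t)⁻¹ * M' = 0 := by
    ext i j
    have e1 : HasDerivAt (fun s => ∑ k, (M s)⁻¹ i k * M s k j)
        (∑ k, (deriv (fun s => (M s)⁻¹ i k) t * M t k j + (M t)⁻¹ i k * M' k j)) t :=
      HasDerivAt.fun_sum fun k _ => (hI i k).mul (hM' k j)
    have e2 : (fun s => ∑ k, (M s)⁻¹ i k * M s k j) =ᶠ[𝓝 t]
        fun _ => (1 : Matrix (Fin 3) (Fin 3) ℝ) i j := by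
      filter_upwards [hdc.eventually_ne hdet] with s hs
      rw [← Matrix.nonsing_inv_mul (M s) (isUnit_iff_ne_zero.mpr hs), Matrix.mul_apply]
    have e3 := e1.unique ((hasDerivAt_const t _).congr_of_eventuallyEq e2)
    rw [Matrix.add_apply, Matrix.mul_apply, Matrix.mul_apply, Matrix.zero_apply, ← e3,
      ← Finset.sum_add_distrib]
    rfl
  have h2 := congrArg (fun A => A * (M t)⁻¹) h1
  simp only [Matrix.add_mul, Matrix.zero_mul] at h2
  rw [Matrix.mul_nonsing_inv_cancel_right _ _ hu] at h2
  exact eq_neg_of_add_eq_zero_left h2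

end InverseMatrix

section Cotton

variable {g : (Fin 3 → ℝ) → Matrix (Fin 3) (Fin 3) ℝ} {q : Fin 3 → Fin 3 → ℝ → ℝ}
  {σ : (Fin 3 → ℝ) → ℝ} {x : Fin 3 → ℝ}

/-- The Cotton tensor where the metric is a function of the cube of a vanishing function with
isotropic gradient. -/
lemma cotton_of_cube (hq : ∀ i j, ContDiffAt ℝ ∞ (q i j) 0) (hσ : ContDiffAt ℝ ∞ σ x)
    (h0 : σ x = 0) (hg : ∀ᶠ y in 𝓝 x, ∀ i j, g y i j = q i j (σ y ^ 3))
    (hdet : (g x).det ≠ 0) (hsymm : ∀ i j, (g x)⁻¹ i j = (g x)⁻¹ j i) {l ν κ : Fin 3 → ℝ}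
    (hl : ∀ i, pd i σ x = l i) (hν : ν = (g x)⁻¹ *ᵥ l)
    (hκ : κ = (Matrix.of fun i j => deriv (q i j) 0) *ᵥ ν) (hiso : l ⬝ᵥ ν = 0)
    (a b c : Fin 3) :
    cotton g a b c x = 3 * (l a * (l c * κ b - l b * κ c))
      - 3 / 2 * (ν ⬝ᵥ κ) * (l c * g x a b - l b * g x a c) := by
  have hcube : ContDiffAt ℝ ∞ (fun y => σ y ^ 3) x := hσ.pow 3
  have hcube0 : σ x ^ 3 = 0 := by simp [h0]
  have hgs : ∀ i j, ContDiffAt ℝ ∞ (fun y => g y i j) x := by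
    intro i j
    refine ContDiffAt.congr_of_eventuallyEq ?_ (hg.mono fun y hy => hy i j)
    exact ContDiffAt.comp (g := q i j) (f := fun y => σ y ^ 3) x
      (by rw [hcube0]; exact hq i j) hcube
  have hinv := contDiffAt_inv_apply hgs hdet
  let d : Fin 3 → Fin 3 → (Fin 3 → ℝ) → ℝ := fun i j y => deriv (q i j) (σ y ^ 3)
  let B : Fin 3 → Fin 3 → ℝ := fun i j => deriv (q i j) 0
  have hd0 : ∀ i j, d i j x = B i j := fun i j => by simp [d, B, h0]
  have hd : ∀ i j, ContDiffAt ℝ ∞ (d i j) x := by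
    intro i j
    have h1 : ContDiffAt ℝ ∞ (deriv (q i j)) 0 := by
      have := (contDiffAt_fderiv (hq i j)).clm_apply (contDiffAt_const (c := (1 : ℝ)))
      simpa only [fderiv_apply_one_eq_deriv] using this
    exact ContDiffAt.comp (g := deriv (q i j)) (f := fun y => σ y ^ 3) x (by rwa [hcube0]) hcube
  have hw := fun i => vanishesTwice_pd_cube hσ h0 i
  simp only [hl] at hw
  have hpg : ∀ i j k, VanishesTwice (pd i fun y => g y j k) x
      fun r s => B j k * (6 * l r * l s * l i) := by
    intro i j k
    rw [← hd0]
    refine (VanishesTwice.mul (hd j k) (hw i)).congr ?_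
    have h1 : ∀ᶠ y in 𝓝 x, DifferentiableAt ℝ (q j k) (σ y ^ 3) := by
      have h2 : ∀ᶠ t in 𝓝 (0 : ℝ), DifferentiableAt ℝ (q j k) t := by
        filter_upwards [((hq j k).of_le (by simp : (1 : ℕ∞ω) ≤ ∞)).eventually (by simp)]
          with t ht using ht.differentiableAt (by simp)
      rw [← hcube0] at h2
      exact hcube.continuousAt.eventually h2
    filter_upwards [hg.eventually_nhds, h1, eventually_differentiableAt hcube] with y hy h1 h2
    have h3 : HasFDerivAt (fun z => q j k (σ z ^ 3)) (d j k y • fderiv ℝ (fun z => σ z ^ 3) y) y :=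
      h1.hasDerivAt.comp_hasFDerivAt y h2.hasFDerivAt
    rw [pd_congr (hy.mono fun z hz => hz j k), pd, h3.fderiv]
    rfl
  -- Derivatives of the metric vanish to second order, so products of Christoffel symbols are
  -- negligible and the inverse metric may be frozen at x.
  have hΓ : ∀ k i j, VanishesTwice (christoffel g k i j) x
      fun r s => 1 / 2 * ∑ n, (g x)⁻¹ k n * (B j n * (6 * l r * l s * l i)
        + B i n * (6 * l r * l s * l j) - B i j * (6 * l r * l s * l n)) := fun k i j =>
    VanishesTwice.mul contDiffAt_const (VanishesTwice.sum fun n => VanishesTwice.mul (hinv k n)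
      (((hpg i j n).add (hpg j i n)).sub (hpg n i j)))
  let K : Fin 3 → Fin 3 → ℝ := fun k j => ∑ n, (g x)⁻¹ k n * B j n
  have hν' : ∀ k, ν k = ∑ n, (g x)⁻¹ k n * l n := fun k => by rw [hν]; rfl
  have hΓ' : ∀ k i j, VanishesTwice (christoffel g k i j) x
      fun r s => 3 * l r * l s * (l i * K k j + l j * K k i - ν k * B i j) := by
    intro k i j
    convert hΓ k i j using 3
    simp only [K, hν', Fin.sum_univ_three]
    ring
  have hric : ∀ i j, VanishesOnce (ricci g i j) x fun r => ∑ k,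
      (3 * l r * l k * (l i * K k j + l j * K k i - ν k * B i j)
        - 3 * l r * l j * (l i * K k k + l k * K k i - ν k * B i k)) := by
    intro i j
    have h1 := VanishesOnce.sum fun k => (((hΓ' k i j).pd_eq k).sub ((hΓ' k i k).pd_eq j)).add
      (VanishesOnce.sum fun n => ((VanishesOnce.mul (hΓ' k k n).smooth (hΓ' n i j).once).sub
        (VanishesOnce.mul (hΓ' k j n).smooth (hΓ' n i k).once)))
    simp only [mul_zero, sub_zero, Finset.sum_const_zero, add_zero] at h1
    exact h1
  have hκ' : ∀ i, κ i = ∑ k, l k * K k i := by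
    intro i
    rw [hκ]
    simp only [Matrix.mulVec, dotProduct, Matrix.of_apply, K, hν', Fin.sum_univ_three]
    rw [hsymm 1 0, hsymm 2 0, hsymm 2 1]
    ring
  have hκ'' : ∀ i, κ i = ∑ k, ν k * B i k := by
    intro i
    rw [hκ]
    simp only [Matrix.mulVec, dotProduct, Matrix.of_apply]
    exact Finset.sum_congr rfl fun k _ => mul_comm _ _
  let τ : ℝ := ∑ k, K k k
  -- The isotropy of the gradient of the phase removes the term containing l · ν.
  have hric' : ∀ i j, VanishesOnce (ricci g i j) x fun r =>
      3 * l r * (l i * κ j + l j * κ i - l i * l j * τ) := by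
    intro i j
    convert hric i j using 2 with r
    have e1 := hκ'' i
    have e2 := hκ' i
    have e3 := hκ' j
    have e4 := hiso
    simp only [dotProduct, Fin.sum_univ_three, τ] at e1 e2 e3 e4 ⊢
    linear_combination 3 * l r * l i * e3 + 3 * l r * l j * e1
      + 3 * l r * B i j * e4
  have hscal : VanishesOnce (scalarCurv g) x fun r => 6 * l r * (ν ⬝ᵥ κ) := by
    have h1 := VanishesOnce.sum fun i => VanishesOnce.sum fun j =>
      VanishesOnce.mul (hinv i j) (hric' i j)
    have e : (fun r => 6 * l r * (ν ⬝ᵥ κ)) = fun r => ∑ i, ∑ j, (g x)⁻¹ i j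
        * (3 * l r * (l i * κ j + l j * κ i - l i * l j * τ)) := by
      ext r
      have e4 := hiso
      simp only [dotProduct, Fin.sum_univ_three, hν'] at e4 ⊢
      rw [hsymm 1 0, hsymm 2 0, hsymm 2 1] at e4 ⊢
      linear_combination 3 * l r * τ * e4
    rw [e]
    exact h1
  have hsch : ∀ i j, VanishesOnce (schouten g i j) x fun r =>
      3 * l r * (l i * κ j + l j * κ i - l i * l j * τ) - 1 / 4 * g x i j
        * (6 * l r * (ν ⬝ᵥ κ)) := by
    intro i j
    refine ((hric' i j).sub (VanishesOnce.mul (contDiffAt_const.mul (hgs i j) :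
      ContDiffAt ℝ ∞ (fun y => (1 / 4 : ℝ) * g y i j) x) hscal)).congr
        (Filter.Eventually.of_forall fun y => ?_)
    rw [schouten]
    ring
  have hcov : ∀ r i j, covDeriv g (schouten g) r i j x = pd r (schouten g i j) x := by
    intro r i j
    simp [covDeriv, (hsch _ _).zero]
  rw [cotton, hcov, hcov, (hsch _ _).pd_eq, (hsch _ _).pd_eq]
  ring

/-- Vanishing of the Cotton tensor of `cotton_of_cube`. -/
lemma parallel_of_cotton {l ν κ : Fin 3 → ℝ} {m G : Matrix (Fin 3) (Fin 3) ℝ} (hmG : m * G = 1)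
    (hν : ν = G *ᵥ l) (hG : Gᵀ = G) (hl : l ≠ 0)
    (h : ∀ a b c, 3 * (l a * (l c * κ b - l b * κ c))
      - 3 / 2 * (ν ⬝ᵥ κ) * (l c * m a b - l b * m a c) = 0) : ∃ μ : ℝ, κ = μ • l := by
  obtain ⟨s, hs⟩ := Function.ne_iff.mp hl
  rw [Pi.zero_apply] at hs
  have hk : ν ⬝ᵥ κ = 0 := by
    by_contra hk
    -- Antisymmetrising in a and b against l eliminates the terms with κ; ν · κ, assumed non-zero,
    -- is then divided out.
    have e1 : ∀ a b c r, l r * (l a * m b c - l b * m a c) = l c * (l a * m b r - l b * m a r) := by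
      intro a b c r
      refine mul_left_cancel₀ hk ?_
      linear_combination 2 / 3 * (l b * h a c r - l a * h b c r)
    -- The index c is raised with G: the metric becomes the identity and l becomes ν.
    have e2 : ∀ a b r t, l r * (l a * (1 : Matrix (Fin 3) (Fin 3) ℝ) b t
        - l b * (1 : Matrix (Fin 3) (Fin 3) ℝ) a t) = ν t * (l a * m b r - l b * m a r) := by
      intro a b r t
      have hGs : ∀ i j, G i j = G j i := fun i j => by conv_lhs => rw [← hG, Matrix.transpose_apply]
      have e3 := e1 a b 0 r
      have e4 := e1 a b 1 r
      have e5 := e1 a b 2 r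
      rw [← hmG, hν]
      simp only [Matrix.mul_apply, Matrix.mulVec, dotProduct, Fin.sum_univ_three]
      rw [hGs t 0, hGs t 1, hGs t 2]
      linear_combination G 0 t * e3 + G 1 t * e4 + G 2 t * e5
    have hbc : ∀ s : Fin 3, ∃ b c, b ≠ s ∧ c ≠ s ∧ b ≠ c := by decide
    -- Dimension three provides two further indices besides s. The relations for (b, b) and (b, c)
    -- force ν c = 0, which contradicts the one for (c, c).
    obtain ⟨b, c, hb, hc, hbc⟩ := hbc s
    have f1 := e2 s b s b
    have f2 := e2 s b s c
    have f3 := e2 s c s c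
    simp only [Matrix.one_apply, hbc, hb.symm, hc.symm, if_true, if_false, mul_one, mul_zero,
      sub_zero] at f1 f2 f3
    have n1 : l s * m b s - l b * m s s ≠ 0 := fun h0 =>
      mul_ne_zero hs hs (by rw [f1, h0, mul_zero])
    have n2 : ν c = 0 := (mul_eq_zero.mp f2.symm).resolve_right n1
    exact mul_ne_zero hs hs (by rw [f3, n2, zero_mul])
  refine ⟨κ s / l s, funext fun b => ?_⟩
  have e := h s b s
  rw [hk] at e
  rw [Pi.smul_apply, smul_eq_mul]
  field_simp
  refine mul_left_cancel₀ hs ?_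
  linear_combination e / 3

end Cotton

section

variable {Ω : Set Jet} {F G : Jet → ℝ} {U : Jet}

lemma symb_transpose (α β : Jet →L[ℝ] ℝ) : (symb α β)ᵀ = symb α β := by
  ext i j
  simp only [symb, Matrix.transpose_apply, Matrix.of_apply]
  ring

/-- The matrix (x, y) ⊗ `charVec` lies in the common kernel, so every term of `two_mul_symb` with
both covectors equal to it contains a zero factor. -/
lemma charVec_isotropic (α β : Jet →L[ℝ] ℝ) (x y : ℝ) :
    charVec α β x y ⬝ᵥ symb α β *ᵥ charVec α β x y = 0 := by
  by_cases hxy : x = 0 ∧ y = 0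
  · simp [hxy.1, hxy.2, charVec]
  obtain ⟨z, w, hD⟩ : ∃ z w : ℝ, x * w - y * z ≠ 0 := by
    by_cases hx : x = 0
    · exact ⟨1, 0, by simpa using fun hy => hxy ⟨hx, hy⟩⟩
    · exact ⟨0, 1, by simpa using hx⟩
  have e := two_mul_symb α β x y z w (charVec α β x y) (charVec α β x y)
  rw [(apply_tens_charVec α β x y).1, (apply_tens_charVec α β x y).2] at e
  refine (mul_eq_zero.mp (?_ : 2 * (x * w - y * z) * _ = 0)).resolve_left
    (mul_ne_zero two_ne_zero hD)
  rw [e]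
  ring

lemma hasDerivAt_symb {α β : ℝ → Jet →L[ℝ] ℝ} {α' β' : Jet →L[ℝ] ℝ} {t : ℝ}
    (hα : HasDerivAt α α' t) (hβ : HasDerivAt β β' t) (i j : Fin 3) :
    HasDerivAt (fun s => symb (α s) (β s) i j) ((symb α' (β t) + symb (α t) β') i j) t := by
  have hr : ∀ {θ : ℝ → Jet →L[ℝ] ℝ} {θ' : Jet →L[ℝ] ℝ}, HasDerivAt θ θ' t → ∀ a i,
      HasDerivAt (fun s => row (θ s) a i) (row θ' a i) t := by
    intro θ θ' h a i
    exact (h.clm_apply (hasDerivAt_const t (jetDir a i))).congr_deriv (by simp [row])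
  have h1 := hr hα
  have h2 := hr hβ
  have := (((((h1 0 i).mul (h2 1 j)).add ((h1 0 j).mul (h2 1 i))).sub
    ((h1 1 i).mul (h2 0 j))).sub ((h1 1 j).mul (h2 0 i))).const_mul (1 / 2 : ℝ)
  refine this.congr_deriv ?_
  simp only [symb, Matrix.add_apply, Matrix.of_apply]
  ring

/-- On a simple wave through U the Cotton tensor at the origin is determined by the derivative of
the inverse symbol along the characteristic direction. Its vanishing says that this derivative
preserves the polar line of the covector, as `eq_zero_of_symb_variation` requires. -/
theorem IsRegular.isRankOneFlat_of_isFlatOnSolutions (hR : IsRegular Ω F G)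
    (h : IsFlatOnSolutions Ω F G) : IsRankOneFlat Ω F G := by
  intro U hU x y
  have hF := hR.contDiffAt_left hU.1
  have hG := hR.contDiffAt_right hU.1
  refine eq_zero_of_symb_variation (hR.conicDet_ne_zero hU) (hess_comm hF) (hess_comm hG)
    (fun x y => ?_) x y
  set α := fderiv ℝ F U with hα
  set β := fderiv ℝ G U with hβ
  set l := charVec α β x y with hldef
  by_cases hl : l = 0
  · exact ⟨0, by rw [hl]; simp⟩
  obtain ⟨D, u, v, σ, γ, hsol, h0D, hσ, hσ0, hpσ, hγ, hγ0, hγ', hjet⟩ := hR.exists_simpleWave hU x y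
  let M : ℝ → Matrix (Fin 3) (Fin 3) ℝ := fun t => symbolForm F G (γ t)
  have hFγ : ContDiffAt ℝ ∞ (fun t => fderiv ℝ F (γ t)) 0 :=
    ContDiffAt.comp 0 (by rw [hγ0]; exact contDiffAt_fderiv hF) hγ
  have hGγ : ContDiffAt ℝ ∞ (fun t => fderiv ℝ G (γ t)) 0 :=
    ContDiffAt.comp 0 (by rw [hγ0]; exact contDiffAt_fderiv hG) hγ
  have hM : ∀ i j, ContDiffAt ℝ ∞ (fun t => M t i j) 0 := by
    intro i j
    have h1 := contDiffAt_row hFγ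
    have h2 := contDiffAt_row hGγ
    change ContDiffAt ℝ ∞ (fun t => symb (fderiv ℝ F (γ t)) (fderiv ℝ G (γ t)) i j) 0
    simp only [symb, Matrix.of_apply]
    fun_prop (disch := assumption)
  have hdK : ∀ K : Jet → ℝ, ContDiffAt ℝ ∞ K U →
      HasDerivAt (fun t => fderiv ℝ K (γ t)) (hess K U (charDir α β x y)) 0 := by
    intro K hK
    have h1 := ((contDiffAt_fderiv hK).differentiableAt (by simp)).hasFDerivAt
    rw [← hγ0] at h1
    have h2 := h1.comp_hasDerivAt (0 : ℝ) hγ'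
    rw [hγ0] at h2
    exact h2
  let M' := symb (hess F U (charDir α β x y)) β + symb α (hess G U (charDir α β x y))
  have hM' : ∀ i j, HasDerivAt (fun t => M t i j) (M' i j) 0 := by
    intro i j
    have := hasDerivAt_symb (hdK F hF) (hdK G hG) i j
    rw [hγ0] at this
    exact this
  have hM0 : M 0 = symb α β := by simp only [M, hγ0, symbolForm_eq, hα, hβ]
  have hdet : (M 0).det ≠ 0 := by
    simp only [M, hγ0]
    exact hR.nondeg U hU
  have hu : IsUnit (M 0).det := isUnit_iff_ne_zero.mpr hdet
  have hg : ∀ z ∈ D, charMetric F G u v z = (M (σ z ^ 3))⁻¹ := fun z hz => by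
    rw [charMetric, hjet z hz]
  have hg0 : charMetric F G u v 0 = (M 0)⁻¹ := by
    rw [hg 0 h0D, hσ0]; norm_num
  have hgi : (charMetric F G u v 0)⁻¹ = symb α β := by
    rw [hg0, Matrix.nonsing_inv_nonsing_inv _ hu, hM0]
  have hd := deriv_inv_apply hM hM' hdet
  let ν := symb α β *ᵥ l
  let κ := (Matrix.of fun i j => deriv (fun t => (M t)⁻¹ i j) 0) *ᵥ ν
  have hsym : ∀ i j, symb α β i j = symb α β j i := fun i j => by
    conv_lhs => rw [← symb_transpose, Matrix.transpose_apply]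
  have hcot : ∀ a b c, 3 * (l a * (l c * κ b - l b * κ c))
      - 3 / 2 * (ν ⬝ᵥ κ) * (l c * charMetric F G u v 0 a b - l b * charMetric F G u v 0 a c)
        = 0 := by
    intro a b c
    rw [← h D u v hsol 0 h0D a b c]
    refine (cotton_of_cube (q := fun i j t => (M t)⁻¹ i j) (contDiffAt_inv_apply hM hdet) hσ hσ0
      ?_ ?_ ?_ hpσ ?_ rfl ?_ a b c).symm
    · filter_upwards [hsol.1.mem_nhds h0D] with z hz i j
      rw [hg z hz]
    · rw [hg0]
      exact (Matrix.isUnit_nonsing_inv_det _ hu).ne_zero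
    · rw [hgi]; exact hsym
    · rw [hgi]
    · exact charVec_isotropic α β x y
  obtain ⟨μ, hμ⟩ := parallel_of_cotton (G := symb α β)
    (by rw [hg0, ← hM0, Matrix.nonsing_inv_mul _ hu]) rfl (symb_transpose α β) hl hcot
  refine ⟨-μ, ?_⟩
  change M' *ᵥ l = _
  have e1 : (M 0)⁻¹ *ᵥ ν = l := by
    rw [Matrix.mulVec_mulVec, ← hM0, Matrix.nonsing_inv_mul _ hu, Matrix.one_mulVec]
  -- The derivative of the inverse is -M⁻¹ M' M⁻¹, and M⁻¹ ν is l; hence κ = μ l is the relation M'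
  -- l = -μ M l.
  have e2 : κ = - ((M 0)⁻¹ *ᵥ (M' *ᵥ l)) := by
    simp only [κ]
    rw [hd, Matrix.neg_mulVec, ← Matrix.mulVec_mulVec, ← Matrix.mulVec_mulVec, e1]
  have e3 := congrArg (fun w => M 0 *ᵥ w) (e2.symm.trans hμ)
  simp only [Matrix.mulVec_neg, Matrix.mulVec_smul] at e3
  rw [Matrix.mulVec_mulVec, Matrix.mul_nonsing_inv _ hu, Matrix.one_mulVec, hM0] at e3
  rw [neg_smul, ← e3, neg_neg]

end

end GrassmannSystem

end

theorem proposition3 (Ω : Set GrassmannSystem.Jet) (hΩ : IsOpen Ω)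
    (F G : GrassmannSystem.Jet → ℝ) (hF : ContDiffOn ℝ ∞ F Ω) (hG : ContDiffOn ℝ ∞ G Ω)
    (hconn : IsConnected (GrassmannSystem.fourfold Ω F G))
    (hnd : GrassmannSystem.IsNondegenerate Ω F G) :
    List.TFAE [
      GrassmannSystem.IsLinearisable Ω F G,
      GrassmannSystem.IsMongeAmpere Ω F G,
      GrassmannSystem.IsInvariantUnderSubgroupOfDim 8 Ω F G,
      GrassmannSystem.IsFlatOnSolutions Ω F G] := by
  have hR : GrassmannSystem.IsRegular Ω F G := ⟨hΩ, hF, hG, hnd⟩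
  -- Every implication into (b) passes through the vanishing of the Hessians on characteristic
  -- directions. Connectedness is used here; elsewhere only non-emptiness is needed.
  have hflat := hR.isMongeAmpere_of_isRankOneFlat hconn
  tfae_have 1 → 2 := fun h => hflat (hR.isRankOneFlat_of_isLinearisable h)
  tfae_have 2 → 1 := hR.isLinearisable_of_isMongeAmpere hconn.nonempty
  tfae_have 2 → 3 := hR.isInvariant_of_isMongeAmpere hconn.nonempty
  tfae_have 3 → 2 := fun h => hflat (hR.isRankOneFlat_of_isInvariant h)
  tfae_have 2 → 4 := hR.isFlatOnSolutions_of_isMongeAmpere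
  tfae_have 4 → 2 := fun h => hflat (hR.isRankOneFlat_of_isFlatOnSolutions h)
  tfae_finish
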